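/- **Setting.** For every sample size $n$ let $p=p(n)$ with $p/n\to\gamma\in(0,\infty)$ and let $n'=n'(n)$ be the test sample size, with $n/n'$ bounded. Fix finite index sets $\mathcal J_a,\mathcal J_c$, reals $(\alpha_i)_{i\in\mathcal J_a}$ and $\sigma^2\ge 0$; none of these depends on $n$. The training design is $\mathbf X=\mathbf Q^\top\mathbf D\mathbf O\in\mathbb R^{n\times p}$, where $\mathbf Q\in\mathbb O(n)$, $\mathbf D$ is rectangular diagonal with nonnegative entries (in any order), and $\mathbf O$, with rows $\mathbf o_i$, is Haar distributed on $\mathbb O(p)$ and independent of $(\mathbf Q,\mathbf D)$. The signal is $\boldsymbol\beta=\boldsymbol\beta'+\sum_{i\in\mathcal J_a}\sqrt n\,\alpha_i\mathbf o_i$, where $\boldsymbol\beta'$ is fixed or random, independent of $(\mathbf Q,\mathbf D,\mathbf O)$, and $\|\boldsymbol\beta'\|\le r\sqrt n$ for a constant $r$, almost surely for all large $n$. The response is $\mathbf y=\mathbf X\boldsymbol\beta+\boldsymbol\epsilon$, where $\boldsymbol\epsilon\sim N(0,\sigma^2\mathbf I_n)$ is independent of $(\mathbf Q,\mathbf D,\mathbf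 O,\boldsymbol\beta')$. The test design is $\tilde{\mathbf X}=\tilde{\mathbf Q}^\top\tilde{\mathbf D}\tilde{\mathbf O}\in\mathbb R^{n'\times p}$, where $\tilde{\mathbf Q}\in\mathbb O(n')$, $\tilde{\mathbf D}$ is rectangular diagonal with nonnegative entries, $(\tilde{\mathbf Q},\tilde{\mathbf D})$ is independent of $(\mathbf Q,\mathbf D,\mathbf O,\boldsymbol\beta',\boldsymbol\epsilon,\tilde{\mathbf O})$ and, conditionally on the training variables $(\mathbf Q,\mathbf D,\mathbf O,\boldsymbol\beta',\boldsymbol\epsilon)$, $\tilde{\mathbf O}$ is uniformly distributed on the orthogonal matrices whose $i$-th row is $\mathbf o_i$ for every $i\in\mathcal J_c$. No relation is assumed between different $n$. Put $\mathfrak d_i^2=\mathbb E[(\tilde{\mathbf D}^\top\tilde{\mathbf D})_{ii}]<\infty$, $\mathfrak d_{\mathsf{bulk}}^2=\frac1{p-|\mathcal J_c|}\sum_{i\notin\mathcal J_c}\mathfrak d_i^2$, $D_{ii}^2=(\mathbf D^\top\mathbf D)_{ii}$ for $i\le p$, and $\mathcal N=\{i:D_{ii}>0\}$. Assume: - for some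 constant $C$, almost surely $\|\mathbf D\|_{\mathsf{op}}\le C$ for all large $n$; and $\|\mathbb E[\tilde{\mathbf D}^\top\tilde{\mathbf D}]\|_{\mathsf{op}}\le C$ for all large $n$; - almost surely $\liminf_n D_{ii}^2>0$ for every $i\in\mathcal J_a$; - almost surely $\liminf_n\frac1n\sum_{i\in\mathcal N}\bigl(D_{ii}^2-|\mathcal N|^{-1}\sum_{j\in\mathcal N}D_{jj}^2\bigr)^2>0$ (the nonzero spectrum does not degenerate to one point); - $\hat{\mathfrak d}_i,\hat{\mathfrak d}_{\mathsf{bulk}}$ are estimators such that almost surely $|\hat{\mathfrak d}_i-\mathfrak d_i|\to0$ for all $i\in\mathcal J_a\cup\mathcal J_c$ and $|\hat{\mathfrak d}_{\mathsf{bulk}}-\mathfrak d_{\mathsf{bulk}}|\to0$. **Risk.** For $\lambda>0$ let $\hat{\boldsymbol\beta}_\lambda=(\mathbf X^\top\mathbf X+\lambda\mathbf I)^{-1}\mathbf X^\top\mathbf y$ and $$R_{\mathbf X,\mathbf y}(\hat{\boldsymbol\beta}_\lambda,\boldsymbol\beta)=\frac1{n'}\mathbb E\bigl[\|\tilde{\mathbf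 X}\hat{\boldsymbol\beta}_\lambda-\tilde{\mathbf X}\boldsymbol\beta\|^2\bigm|\text{training data}\bigr],$$ where the training data are $\mathbf X$ together with its right singular factor $\mathbf O$, $\mathbf y$, and the signal $\boldsymbol\beta$, and the expectation is taken with respect to a regular conditional distribution of $\tilde{\mathbf X}$. **Estimators.** Write $\hat\gamma=p/n$. For $S\subset\{1,\dots,p\}$ let $\mathbf O_S$ be the matrix of the rows $\mathbf o_i$, $i\in S$, let $\mathbf D_S^{\mathrm{sq}}=\mathrm{diag}(D_{ii})_{i\in S}$, $\mathbf Z_S=\mathbf X\mathbf O_S^\top$ and $\mathbf c_S=(\mathbf Z_S^\top\mathbf Z_S)^{-1}\mathbf Z_S^\top\mathbf y$. Put $\hat{\boldsymbol\alpha}=n^{-1/2}\mathbf c_{\mathcal J_a}$. With $S=\mathcal N\setminus\mathcal J_a$ and $m=|S|$ let $\mathbf X_{\mathsf{new}}=\mathbf D_S^{\mathrm{sq}}\mathbf O_S$, $\mathbf y_{\mathsf{new}}=\mathbf D_S^{\mathrm{sq}}\mathbf c_S$, and $v(z)=\frac1m\sum_{i\in S}\frac1{D_{ii}^2-z}$.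 Fix a finite grid $\lambda^{(1)},\dots,\lambda^{(L)}>0$ with at least two distinct values, at which $$a_k=\frac{(\lambda^{(k)})^2}{\hat\gamma}\bigl(v(-\lambda^{(k)})-\lambda^{(k)}v'(-\lambda^{(k)})\bigr),\quad b_k=(\lambda^{(k)})^2v'(-\lambda^{(k)}),\quad t_k=\frac1m\|\mathbf y_{\mathsf{new}}-\mathbf X_{\mathsf{new}}\hat{\boldsymbol\beta}_{\lambda^{(k)}}(\mathbf X_{\mathsf{new}},\mathbf y_{\mathsf{new}})\|^2,$$ $$\hat\sigma^2=\frac{\sum_k(\frac{t_k}{a_k}-\frac{t_1}{a_1})(\frac{b_k}{a_k}-\frac{b_1}{a_1})}{\sum_k(\frac{b_k}{a_k}-\frac{b_1}{a_1})^2},\qquad \hat r^2=\frac{\sum_k(\frac{t_k}{b_k}-\frac{t_1}{b_1})(\frac{a_k}{b_k}-\frac{a_1}{b_1})}{\sum_k(\frac{a_k}{b_k}-\frac{a_1}{b_1})^2}.$$ Finally, with $\hat w_i=\hat{\mathfrak d}_{\mathsf{bulk}}^2+\mathbb 1(i\in\mathcal J_c)(\hat{\mathfrak d}_i^2-\hat{\mathfrak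 d}_{\mathsf{bulk}}^2)$, $$\mathsf{aROTI\text{-}GCV}(\lambda)=\frac{\lambda^2}{n'}\sum_{i=1}^p\frac{\bigl(\hat r^2/\hat\gamma+\mathbb 1(i\in\mathcal J_a)\,n\hat\alpha_i^2\bigr)\hat w_i}{(D_{ii}^2+\lambda)^2}+\frac{\hat\sigma^2}{n'}\sum_{i=1}^{p}\frac{D_{ii}^2\,\hat w_i}{(D_{ii}^2+\lambda)^2}.$$ **Claim.** For all $0<\lambda_1<\lambda_2<\infty$, $$\sup_{\lambda\in[\lambda_1,\lambda_2]}\bigl|\mathsf{aROTI\text{-}GCV}(\lambda)-R_{\mathbf X,\mathbf y}(\hat{\boldsymbol\beta}_\lambda,\boldsymbol\beta)\bigr|\xrightarrow{a.s.}0 .$$ -/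

import Mathlib

open MeasureTheory ProbabilityTheory Filter Topology
open scoped Matrix ENNReal NNReal

namespace ROTI

noncomputable section

/-! ### Matrices, orthogonal groups, measurable structure -/

instance instMeasurableSpaceMatrix (m p : ℕ) : MeasurableSpace (Matrix (Fin m) (Fin p) ℝ) :=
  inferInstanceAs (MeasurableSpace (Fin m → Fin p → ℝ))

instance instBorelSpaceMatrix (m p : ℕ) : BorelSpace (Matrix (Fin m) (Fin p) ℝ) :=
  inferInstanceAs (BorelSpace (Fin m → Fin p → ℝ))

instance instStandardBorelSpaceMatrix (m p : ℕ) :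
    StandardBorelSpace (Matrix (Fin m) (Fin p) ℝ) :=
  inferInstanceAs (StandardBorelSpace (Fin m → Fin p → ℝ))

/-- The spectral norm (ℓ² → ℓ² operator norm) of a real matrix. -/
def opNorm {m p : ℕ} (A : Matrix (Fin m) (Fin p) ℝ) : ℝ :=
  letI := Matrix.instL2OpNormedAddCommGroup (m := Fin m) (n := Fin p) (𝕜 := ℝ)
  ‖A‖

/-- The orthogonal group `O(p)`. -/
abbrev Orth (p : ℕ) : Type := Matrix.orthogonalGroup (Fin p) ℝ

/-- The positions in `Fin p` that belong to an index set `J ⊆ ℕ` (positions are counted from 0). -/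
def idx (p : ℕ) (J : Finset ℕ) : Finset (Fin p) :=
  Finset.univ.filter fun i => (i : ℕ) ∈ J

/-- The closed subgroup of `O(p)` of all `U` whose `i`-th row is the standard basis vector `e_i`
for every `i ∈ J`. The matrices `U * O` with `U` in this subgroup are exactly the orthogonal
matrices that have the same `i`-th row as `O` for every `i ∈ J`. -/
def rowStabilizer (p : ℕ) (J : Finset ℕ) : Subgroup (Orth p) where
  carrier := {U | ∀ i ∈ idx p J, ∀ j, (U : Matrix (Fin p) (Fin p) ℝ) i j
    = (1 : Matrix (Fin p) (Fin p) ℝ) i j}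
  one_mem' := by
    intro i _ j
    rfl
  mul_mem' := by
    intro U V hU hV i hi j
    have h : ((U * V : Orth p) : Matrix (Fin p) (Fin p) ℝ) i j
        = ∑ k, (U : Matrix (Fin p) (Fin p) ℝ) i k * (V : Matrix (Fin p) (Fin p) ℝ) k j := rfl
    rw [h, ← hV i hi j]
    simp [hU i hi, Matrix.one_apply]
  inv_mem' := by
    intro U hU i hi j
    have h : ((U * U⁻¹ : Orth p) : Matrix (Fin p) (Fin p) ℝ) i j
        = ∑ k, (U : Matrix (Fin p) (Fin p) ℝ) i k * ((U⁻¹ : Orth p) : Matrix (Fin p) (Fin p) ℝ) k j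
        := rfl
    rw [mul_inv_cancel] at h
    simp only [hU i hi, Matrix.one_apply, ite_mul, one_mul, zero_mul, Finset.sum_ite_eq,
      Finset.mem_univ, if_true] at h
    rw [← h]
    rfl

/-- Rectangular diagonal matrix with nonnegative entries, the middle factor of an SVD. -/
def IsSingularValueMatrix {m p : ℕ} (D : Matrix (Fin m) (Fin p) ℝ) : Prop :=
  (∀ (i : Fin m) (j : Fin p), (i : ℕ) ≠ (j : ℕ) → D i j = 0) ∧
    ∀ (i : Fin m) (j : Fin p), 0 ≤ D i j

/-! ### Ridge regression and the estimators of signal size and noise level -/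

/-- The ridge estimator `(XᵀX + lam I)⁻¹ Xᵀ y`. -/
def ridge {ι : Type*} [Fintype ι] {p : ℕ} (X : Matrix ι (Fin p) ℝ) (y : ι → ℝ) (lam : ℝ) :
    Fin p → ℝ :=
  (Xᵀ * X + lam • (1 : Matrix (Fin p) (Fin p) ℝ))⁻¹ *ᵥ (Xᵀ *ᵥ y)

/-- The Stieltjes transform `z ↦ ∫ 1 / (x - z) dμ(x)` of the empirical measure `μ` of a finite
family `s` of reals. -/
def stieltjes {ι : Type*} [Fintype ι] (s : ι → ℝ) (z : ℝ) : ℝ :=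
  (∑ i, 1 / (s i - z)) / Fintype.card ι

/-- `(lam² / γ) (v(-lam) - lam v'(-lam))`, with `v` the Stieltjes transform of `s`. -/
def coefA {ι : Type*} [Fintype ι] (γ : ℝ) (s : ι → ℝ) (lam : ℝ) : ℝ :=
  lam ^ 2 / γ * (stieltjes s (-lam) - lam * deriv (stieltjes s) (-lam))

/-- `lam² v'(-lam)`, with `v` the Stieltjes transform of `s`. -/
def coefB {ι : Type*} [Fintype ι] (s : ι → ℝ) (lam : ℝ) : ℝ :=
  lam ^ 2 * deriv (stieltjes s) (-lam)

/-- The mean training error `‖y - X β̂_lam‖² / m` of ridge regression on `m` samples. -/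
def trainErr {ι : Type*} [Fintype ι] {p : ℕ} (X : Matrix ι (Fin p) ℝ) (y : ι → ℝ) (lam : ℝ) : ℝ :=
  (∑ i, (y i - (X *ᵥ ridge X y lam) i) ^ 2) / Fintype.card ι

/-- Given `t k = u * a k + w * b k`, the least squares value of `w` obtained after dividing by
`a k` and subtracting the equation of index `0`. -/
def olsSlope {L : ℕ} [NeZero L] (t a b : Fin L → ℝ) : ℝ :=
  (∑ k, (t k / a k - t 0 / a 0) * (b k / a k - b 0 / a 0)) / ∑ k, (b k / a k - b 0 / a 0) ^ 2

/-- Estimator of `σ²` from data `(X, y)`, where `s` lists the diagonal of `D Dᵀ` for the SVD of `X`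
and `g` is the grid of regularization strengths. -/
def sigmaSqHat {ι : Type*} [Fintype ι] {p L : ℕ} [NeZero L] (γ : ℝ) (g : Fin L → ℝ)
    (X : Matrix ι (Fin p) ℝ) (s : ι → ℝ) (y : ι → ℝ) : ℝ :=
  olsSlope (fun k => trainErr X y (g k)) (fun k => coefA γ s (g k)) (fun k => coefB s (g k))

/-- Estimator of `r²` from data `(X, y)`, with the same conventions. -/
def rSqHat {ι : Type*} [Fintype ι] {p L : ℕ} [NeZero L] (γ : ℝ) (g : Fin L → ℝ)
    (X : Matrix ι (Fin p) ℝ) (s : ι → ℝ) (y : ι → ℝ) : ℝ :=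
  olsSlope (fun k => trainErr X y (g k)) (fun k => coefB s (g k)) (fun k => coefA γ s (g k))

/-! ### Alignment: principal component regression and the reduced model -/

/-- The index set `𝓝` of the nonzero singular values. -/
def nonzeroIdx {n p : ℕ} (D : Matrix (Fin n) (Fin p) ℝ) : Finset (Fin p) :=
  Finset.univ.filter fun i => 0 < (Dᵀ * D) i i

/-- `𝓝 \ J`. -/
def residIdx {n p : ℕ} (D : Matrix (Fin n) (Fin p) ℝ) (J : Finset ℕ) : Finset (Fin p) :=
  nonzeroIdx D \ idx p J

/-- The rows of `O` with index in `S`. -/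
def rowsOf {p : ℕ} (O : Orth p) (S : Finset (Fin p)) : Matrix S (Fin p) ℝ :=
  (O : Matrix (Fin p) (Fin p) ℝ).submatrix (fun i => (i : Fin p)) id

/-- `(D_Sᵀ D_S)^{1/2}`: the diagonal matrix of the singular values with index in `S`. -/
def singDiag {n p : ℕ} (D : Matrix (Fin n) (Fin p) ℝ) (S : Finset (Fin p)) : Matrix S S ℝ :=
  Matrix.diagonal fun i => √((Dᵀ * D) i i)

/-- `(ZᵀZ)⁻¹ Zᵀ y` with `Z = X O_Sᵀ`: regression of `y` on the principal components in `S`. -/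
def pcr {n p : ℕ} (X : Matrix (Fin n) (Fin p) ℝ) (O : Orth p) (y : Fin n → ℝ)
    (S : Finset (Fin p)) : S → ℝ :=
  let Z : Matrix (Fin n) S ℝ := X * (rowsOf O S)ᵀ
  (Zᵀ * Z)⁻¹ *ᵥ (Zᵀ *ᵥ y)

/-- The estimator of `α`, indexed by the aligned positions (and extended by `0`). The regression
coefficient of `y` on the `i`-th component estimates `√n α_i`. -/
def alphaHat {n p : ℕ} (Ja : Finset ℕ) (X : Matrix (Fin n) (Fin p) ℝ) (O : Orth p)
    (y : Fin n → ℝ) (i : Fin p) : ℝ :=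
  if h : i ∈ idx p Ja then pcr X O y (idx p Ja) ⟨i, h⟩ / √(n : ℝ) else 0

/-- The design of the reduced model, `(D_Sᵀ D_S)^{1/2} O_S` with `S = 𝓝 \ J_a`. -/
def Xnew {n p : ℕ} (Ja : Finset ℕ) (D : Matrix (Fin n) (Fin p) ℝ) (O : Orth p) :
    Matrix (residIdx D Ja) (Fin p) ℝ :=
  singDiag D (residIdx D Ja) * rowsOf O (residIdx D Ja)

/-- The response of the reduced model,
`(D_Sᵀ D_S)^{1/2} (ZᵀZ)⁻¹ Zᵀ y` with `S = 𝓝 \ J_a` and `Z = X O_Sᵀ`. -/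
def ynew {n p : ℕ} (Ja : Finset ℕ) (D : Matrix (Fin n) (Fin p) ℝ)
    (X : Matrix (Fin n) (Fin p) ℝ) (O : Orth p) (y : Fin n → ℝ) : residIdx D Ja → ℝ :=
  singDiag D (residIdx D Ja) *ᵥ pcr X O y (residIdx D Ja)

/-- The squared singular values of the reduced design. -/
def sqSingNew {n p : ℕ} (Ja : Finset ℕ) (D : Matrix (Fin n) (Fin p) ℝ) : residIdx D Ja → ℝ :=
  fun i => (Dᵀ * D) i i

/-! ### The risk formula -/

/-- `𝔡_bulk² + 1(i ∈ J_c) (𝔡_i² - 𝔡_bulk²)`. -/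
def testWeight {p : ℕ} (Jc : Finset ℕ) (d2 : ℕ → ℝ) (dbulk2 : ℝ) (i : Fin p) : ℝ :=
  dbulk2 + if i ∈ idx p Jc then d2 i - dbulk2 else 0

/-- The bias part of the risk formula, for `n` training and `n'` test samples. -/
def biasFormula {n p : ℕ} (n' : ℕ) (γ : ℝ) (Ja Jc : Finset ℕ) (D : Matrix (Fin n) (Fin p) ℝ)
    (r2 : ℝ) (α : Fin p → ℝ) (d2 : ℕ → ℝ) (dbulk2 lam : ℝ) : ℝ :=
  lam ^ 2 / n' * ∑ i : Fin p,
    (r2 / γ + if i ∈ idx p Ja then n * α i ^ 2 else 0) * testWeight Jc d2 dbulk2 i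
      / ((Dᵀ * D) i i + lam) ^ 2

/-- The variance part of the risk formula, for `n` training and `n'` test samples. -/
def varFormula {n p : ℕ} (n' : ℕ) (Jc : Finset ℕ) (D : Matrix (Fin n) (Fin p) ℝ)
    (s2 : ℝ) (d2 : ℕ → ℝ) (dbulk2 lam : ℝ) : ℝ :=
  s2 / n' * ∑ i : Fin p,
    (Dᵀ * D) i i / ((Dᵀ * D) i i + lam) ^ 2 * testWeight Jc d2 dbulk2 i

/-! ### The model -/

/-- The random objects of the problem with `n` training samples, `n'` test samples and `p` features,
all defined on one sample space. -/
structure Data (Ω : Type*) (n n' p : ℕ) (Jc : Finset ℕ) where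
  /-- Left singular factor of the training design. -/
  Q : Ω → Orth n
  /-- Singular values of the training design. -/
  D : Ω → Matrix (Fin n) (Fin p) ℝ
  /-- Right singular factor of the training design; its rows are the vectors `o_i`. -/
  O : Ω → Orth p
  /-- The unaligned part `β'` of the signal. -/
  β' : Ω → Fin p → ℝ
  /-- The noise. -/
  ε : Ω → Fin n → ℝ
  /-- Left singular factor of the test design. -/
  Qt : Ω → Orth n'
  /-- Singular values of the test design. -/
  Dt : Ω → Matrix (Fin n') (Fin p) ℝ
  /-- The rotation that takes the training right singular factor `O` to the one of the test
  design, `V O`. It keeps the rows with index in `J_c`. -/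
  V : Ω → rowStabilizer p Jc

namespace Data

variable {Ω : Type*} {n n' p : ℕ} {Jc : Finset ℕ}

/-- The training design `X = Qᵀ D O`. -/
def X (M : Data Ω n n' p Jc) (ω : Ω) : Matrix (Fin n) (Fin p) ℝ :=
  (M.Q ω : Matrix (Fin n) (Fin n) ℝ)ᵀ * M.D ω * (M.O ω : Matrix (Fin p) (Fin p) ℝ)

/-- The right singular factor of the test design. -/
def Ot (M : Data Ω n n' p Jc) (ω : Ω) : Orth p :=
  (M.V ω : Orth p) * M.O ω

/-- The test design `X̃ = Q̃ᵀ D̃ Õ`. -/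
def Xt (M : Data Ω n n' p Jc) (ω : Ω) : Matrix (Fin n') (Fin p) ℝ :=
  (M.Qt ω : Matrix (Fin n') (Fin n') ℝ)ᵀ * M.Dt ω * (M.Ot ω : Matrix (Fin p) (Fin p) ℝ)

/-- The signal `β = β' + ∑_{i ∈ J_a} √n α_i o_i`. -/
def β (M : Data Ω n n' p Jc) (Ja : Finset ℕ) (α : ℕ → ℝ) (ω : Ω) : Fin p → ℝ :=
  M.β' ω + ∑ i ∈ idx p Ja, (√(n : ℝ) * α i) • (M.O ω : Matrix (Fin p) (Fin p) ℝ) i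

/-- The response `y = X β + ε`. -/
def y (M : Data Ω n n' p Jc) (Ja : Finset ℕ) (α : ℕ → ℝ) (ω : Ω) : Fin n → ℝ :=
  M.X ω *ᵥ M.β Ja α ω + M.ε ω

/-- The eigenvectors with index in `J_c` are shared by the training and the test design. -/
theorem Ot_row (M : Data Ω n n' p Jc) (ω : Ω) (i : Fin p) (hi : i ∈ idx p Jc) (j : Fin p) :
    (M.Ot ω : Matrix (Fin p) (Fin p) ℝ) i j = (M.O ω : Matrix (Fin p) (Fin p) ℝ) i j := by
  have h : (M.Ot ω : Matrix (Fin p) (Fin p) ℝ) i j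
      = ∑ k, ((M.V ω : Orth p) : Matrix (Fin p) (Fin p) ℝ) i k
        * (M.O ω : Matrix (Fin p) (Fin p) ℝ) k j := rfl
  rw [h]
  simp [(M.V ω).2 i hi, Matrix.one_apply]

variable [MeasurableSpace Ω]

/-- The training and test designs are right-rotationally invariant, coupled through the
eigenvectors in `J_c`, the signal part `β'` is independent of the training design, and the noise is
Gaussian with variance `σ²` and independent of everything else. -/
structure IsModel (M : Data Ω n n' p Jc) (P : Measure Ω) (σ : ℝ) : Prop where
  measurable_Q : Measurable M.Q
  measurable_D : Measurable M.D
  measurable_O : Measurable M.O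
  measurable_β' : Measurable M.β'
  measurable_ε : Measurable M.ε
  measurable_Qt : Measurable M.Qt
  measurable_Dt : Measurable M.Dt
  measurable_V : Measurable M.V
  /-- `D` and `D̃` hold the singular values. -/
  sing_D : ∀ᵐ ω ∂P, IsSingularValueMatrix (M.D ω)
  sing_Dt : ∀ᵐ ω ∂P, IsSingularValueMatrix (M.Dt ω)
  /-- `O` is uniformly distributed on `O(p)` and independent of `(Q, D)`. -/
  haar_O : (P.map M.O).IsHaarMeasure
  indep_O : IndepFun M.O (fun ω => (M.Q ω, M.D ω)) P
  /-- `β'` is fixed or random, independent of the training design. -/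
  indep_β' : IndepFun M.β' (fun ω => (M.Q ω, M.D ω, M.O ω)) P
  /-- The noise has independent `N(0, σ²)` entries and is independent of everything else. -/
  law_ε : P.map M.ε = Measure.pi fun _ => gaussianReal 0 (Real.toNNReal (σ ^ 2))
  indep_ε : IndepFun M.ε (fun ω => (M.Q ω, M.D ω, M.O ω, M.β' ω)) P
  /-- Given the training data, `Õ = V O` is uniformly distributed on the orthogonal matrices that
  share with `O` the rows with index in `J_c`. -/
  haar_V : (P.map M.V).IsHaarMeasure
  indep_V : IndepFun M.V (fun ω => (M.Qt ω, M.Dt ω)) P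
  /-- The test data are drawn independently of the training data, up to the coupling. -/
  indep_test : IndepFun (fun ω => (M.Qt ω, M.Dt ω, M.V ω))
    (fun ω => (M.Q ω, M.D ω, M.O ω, M.β' ω, M.ε ω)) P
  /-- `E[D̃ᵀ D̃]` is well defined. -/
  integrable_Dt : ∀ i, Integrable (fun ω => ((M.Dt ω)ᵀ * M.Dt ω) i i) P

/-- The matrix `E[D̃ᵀ D̃]`. -/
def expDtSq (M : Data Ω n n' p Jc) (P : Measure Ω) : Matrix (Fin p) (Fin p) ℝ :=
  Matrix.of fun i j => ∫ ω, ((M.Dt ω)ᵀ * M.Dt ω) i j ∂P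

/-- `𝔡_i² = E[(D̃ᵀ D̃)_ii]`. -/
def dSq (M : Data Ω n n' p Jc) (P : Measure Ω) (i : ℕ) : ℝ :=
  if h : i < p then M.expDtSq P ⟨i, h⟩ ⟨i, h⟩ else 0

/-- `𝔡_bulk² = (p - |J_c|)⁻¹ ∑_{i ∉ J_c} 𝔡_i²`. -/
def dBulkSq (M : Data Ω n n' p Jc) (P : Measure Ω) : ℝ :=
  (∑ i ∈ (idx p Jc)ᶜ, M.dSq P i) / ((p : ℝ) - (idx p Jc).card)

/-- The training data: `X` with its right singular vectors, `y`, and the signal `β`. -/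
def training (M : Data Ω n n' p Jc) (Ja : Finset ℕ) (α : ℕ → ℝ) (ω : Ω) :
    Matrix (Fin n) (Fin p) ℝ × (Fin n → ℝ) × Orth p × (Fin p → ℝ) :=
  (M.X ω, M.y Ja α ω, M.O ω, M.β Ja α ω)

/-- The out-of-sample risk `(1 / n') E[‖X̃ β̂_lam - X̃ β‖² | training data]`; the expectation is over
the regular conditional distribution of the test design given the training data. -/
def risk (M : Data Ω n n' p Jc) (P : Measure Ω) [IsFiniteMeasure P] (Ja : Finset ℕ) (α : ℕ → ℝ)
    (lam : ℝ) (ω : Ω) : ℝ :=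
  1 / n' * ∫ A : Matrix (Fin n') (Fin p) ℝ,
    ∑ i, ((A *ᵥ ridge (M.X ω) (M.y Ja α ω) lam) i - (A *ᵥ M.β Ja α ω) i) ^ 2
      ∂(condDistrib M.Xt (M.training Ja α) P (M.training Ja α ω))

/-- `aROTI-GCV(lam)`: the risk formula with every unknown parameter replaced by its estimate. -/
def aROTI (M : Data Ω n n' p Jc) {L : ℕ} [NeZero L] (Ja : Finset ℕ) (α : ℕ → ℝ)
    (g : Fin L → ℝ) (dHat : Ω → ℕ → ℝ) (dBulkHat : Ω → ℝ) (lam : ℝ) (ω : Ω) : ℝ :=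
  let γ : ℝ := p / n
  let D := M.D ω
  let yN := ynew Ja D (M.X ω) (M.O ω) (M.y Ja α ω)
  let r2 := rSqHat γ g (Xnew Ja D (M.O ω)) (sqSingNew Ja D) yN
  let s2 := sigmaSqHat γ g (Xnew Ja D (M.O ω)) (sqSingNew Ja D) yN
  biasFormula n' γ Ja Jc D r2 (alphaHat Ja (M.X ω) (M.O ω) (M.y Ja α ω))
      (fun i => dHat ω i ^ 2) (dBulkHat ω ^ 2) lam
    + varFormula n' Jc D s2 (fun i => dHat ω i ^ 2) (dBulkHat ω ^ 2) lam

end Data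

/-- The sum of squared deviations from their mean of the nonzero squared singular values,
divided by the sample size `n`. -/
def spectralSpread {n p : ℕ} (D : Matrix (Fin n) (Fin p) ℝ) : ℝ :=
  (∑ i ∈ nonzeroIdx D, ((Dᵀ * D) i i
    - (∑ j ∈ nonzeroIdx D, (Dᵀ * D) j j) / (nonzeroIdx D).card) ^ 2) / n

end

end ROTI

/-! In the bases of singular vectors the problem is diagonal. Write `s i` for the squared singular
values, `b = O β'`, `θ = O β` (so `θ = b` off `Ja`) and `e` for the coordinates of `Q ε`, extended
by zero. Then the ridge error has coordinates `-f θ i + k e i`, with `f = λ / (s i + λ)` and `k =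
√(s i) / (s i + λ)` (`Data.mulVec_ridge_sub`).

The test design is `G O`, where `G` is independent of the training data. Haar averaging over the
stabilizer of the shared rows spreads the squared mass of a vector evenly over the unshared
coordinates. So the conditional risk is exactly `1/n' * ∑ w i (-f θ i + k e i)²`, with the
population test weights `w` (`Data.IsModel.risk_eq`). The estimator `aROTI` has the same shape: on
unaligned components `b i²` is replaced by an estimate of `u = ‖β'‖² / p`, `e i²` by an estimate of
`σ²`, and `b i * e i` by zero.

The replacement costs `o(n)`, because three kinds of centered sums with bounded coefficients
depending on `D` are negligible: the quadratic form in the Haar-rotated direction of `β'`, the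
bilinear form in direction and noise, and the quadratic form in the noise. After normalization each
has fourth moment `O(n⁻²)`. This is summable, so almost sure convergence follows with no assumption
on the joint law over different `n`. Fourth moments on the sphere are compared with Gaussian ones by
homogeneity and rotation invariance. Both `f` and `k` are Lipschitz in `λ`, so convergence on a
countable dense grid becomes uniform on `[l₁, l₂]`.

The estimates of `u` and `σ²` come from the reduced model. Its training error is `u γ̂ a + σ² b +
o(1)`, where `γ̂ = p / n` and `a`, `b` are now the two regression coefficients (`trainErr_decomp`).
Recovering the two unknowns from several `λ` is stable because the determinant `a b' - a' b` at two
distinct `λ` is bounded below by the pairwise spread of the spectrum (`sum_sq_sub_le_abs_det`). Only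
differences from `u` and `σ²` tend to zero; `‖β'‖² / n` itself need not converge.

The aligned components are finitely many. There `n α̂ i² = (θ i + e i / √(s i))²`. This estimates
the whole coordinate `θ i`, which is what the risk contains, and the noise on finitely many
coordinates has energy `o(n)`. The extra term `u` that the formula adds on these components is
bounded, hence negligible after division by `n`. -/

namespace ROTI

/-! ### Diagonalization of ridge regression, component regression and the reduced model -/

section Algebra

/-- The coordinates of `v : Fin n → ℝ`, read on `Fin p` and extended by zero. -/
noncomputable def extend {n : ℕ} (p : ℕ) (v : Fin n → ℝ) (i : Fin p) : ℝ :=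
  if h : (i : ℕ) < n then v ⟨i, h⟩ else 0

variable {n p : ℕ}

theorem Orth.mul_transpose (O : Orth p) :
    (O : Matrix (Fin p) (Fin p) ℝ) * (O : Matrix (Fin p) (Fin p) ℝ)ᵀ = 1 :=
  (Matrix.mem_orthogonalGroup_iff (Fin p) ℝ).1 O.2

theorem Orth.transpose_mul (O : Orth p) :
    (O : Matrix (Fin p) (Fin p) ℝ)ᵀ * (O : Matrix (Fin p) (Fin p) ℝ) = 1 :=
  (Matrix.mem_orthogonalGroup_iff' (Fin p) ℝ).1 O.2

theorem Orth.sum_sq_mulVec (O : Orth p) (x : Fin p → ℝ) :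
    ∑ i, ((O : Matrix (Fin p) (Fin p) ℝ) *ᵥ x) i ^ 2 = ∑ i, x i ^ 2 := by
  have h : ((O : Matrix (Fin p) (Fin p) ℝ) *ᵥ x) ⬝ᵥ ((O : Matrix (Fin p) (Fin p) ℝ) *ᵥ x)
      = x ⬝ᵥ x := by
    rw [Matrix.dotProduct_mulVec, Matrix.vecMul_mulVec, ← Matrix.dotProduct_mulVec,
      Orth.transpose_mul, Matrix.one_mulVec]
  simpa [dotProduct, sq] using h

theorem IsSingularValueMatrix.gram {D : Matrix (Fin n) (Fin p) ℝ} (hD : IsSingularValueMatrix D) :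
    Dᵀ * D = Matrix.diagonal fun i => (Dᵀ * D) i i := by
  ext i j
  by_cases hij : i = j
  · subst hij; simp
  · rw [Matrix.diagonal_apply_ne _ hij, Matrix.mul_apply]
    refine Finset.sum_eq_zero fun k _ => ?_
    rw [Matrix.transpose_apply]
    by_cases hk : (k : ℕ) = i
    · rw [hD.1 k j (by rw [hk]; exact fun h => hij (Fin.ext h)), mul_zero]
    · rw [hD.1 k i hk, zero_mul]

theorem gram_nonneg (D : Matrix (Fin n) (Fin p) ℝ) (i : Fin p) : 0 ≤ (Dᵀ * D) i i := by
  rw [Matrix.mul_apply]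
  exact Finset.sum_nonneg fun k _ => by rw [Matrix.transpose_apply]; exact mul_self_nonneg _

theorem IsSingularValueMatrix.gram_apply {D : Matrix (Fin n) (Fin p) ℝ}
    (hD : IsSingularValueMatrix D) (i : Fin p) (h : (i : ℕ) < n) :
    (Dᵀ * D) i i = D ⟨i, h⟩ i ^ 2 := by
  rw [Matrix.mul_apply, Finset.sum_eq_single ⟨i, h⟩]
  · rw [Matrix.transpose_apply, sq]
  · intro k _ hk
    rw [hD.1 k i (fun e => hk (Fin.ext e)), mul_zero]
  · simp

theorem IsSingularValueMatrix.gram_eq_zero {D : Matrix (Fin n) (Fin p) ℝ}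
    (hD : IsSingularValueMatrix D) (i : Fin p) (h : ¬ (i : ℕ) < n) :
    (Dᵀ * D) i i = 0 := by
  rw [Matrix.mul_apply]
  refine Finset.sum_eq_zero fun k _ => ?_
  rw [hD.1 k i (fun e => h (e ▸ k.2)), mul_zero]

/-- For `i ≥ n` both the singular value and the extended coordinate vanish, so one formula covers
all `i < p` whatever the order of `n` and `p`. Nonnegativity of the entries is what makes the root
of the Gram entry the entry itself. -/
theorem IsSingularValueMatrix.transpose_mulVec {D : Matrix (Fin n) (Fin p) ℝ}
    (hD : IsSingularValueMatrix D) (v : Fin n → ℝ) (i : Fin p) :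
    (Dᵀ *ᵥ v) i = √((Dᵀ * D) i i) * extend p v i := by
  unfold extend
  by_cases h : (i : ℕ) < n
  · rw [hD.gram_apply i h, Real.sqrt_sq (hD.2 _ _), dif_pos h, Matrix.mulVec, dotProduct,
      Finset.sum_eq_single ⟨i, h⟩]
    · rw [Matrix.transpose_apply]
    · intro k _ hk
      rw [Matrix.transpose_apply, hD.1 k i (fun e => hk (Fin.ext e)), zero_mul]
    · simp
  · rw [dif_neg h, mul_zero, Matrix.mulVec, dotProduct]
    refine Finset.sum_eq_zero fun k _ => ?_
    rw [Matrix.transpose_apply, hD.1 k i (fun e => h (e ▸ k.2)), zero_mul]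

theorem design_gram {D : Matrix (Fin n) (Fin p) ℝ} (hD : IsSingularValueMatrix D)
    (Q : Orth n) (O : Orth p) (X : Matrix (Fin n) (Fin p) ℝ)
    (hX : X = (Q : Matrix (Fin n) (Fin n) ℝ)ᵀ * D * (O : Matrix (Fin p) (Fin p) ℝ)) :
    Xᵀ * X = (O : Matrix (Fin p) (Fin p) ℝ)ᵀ * Matrix.diagonal (fun i => (Dᵀ * D) i i)
      * (O : Matrix (Fin p) (Fin p) ℝ) := by
  rw [← hD.gram, hX]
  simp only [Matrix.transpose_mul, Matrix.transpose_transpose, Matrix.mul_assoc]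
  rw [← Matrix.mul_assoc (Q : Matrix (Fin n) (Fin n) ℝ) _ (D * _), Orth.mul_transpose,
    Matrix.one_mul]

/-- The right-hand side of the normal equations decouples in the basis of right singular vectors.
Everything later uses the data only through this identity and `design_gram`. -/
theorem design_response {D : Matrix (Fin n) (Fin p) ℝ} (hD : IsSingularValueMatrix D)
    (Q : Orth n) (O : Orth p) (X : Matrix (Fin n) (Fin p) ℝ)
    (hX : X = (Q : Matrix (Fin n) (Fin n) ℝ)ᵀ * D * (O : Matrix (Fin p) (Fin p) ℝ))
    (β : Fin p → ℝ) (ε : Fin n → ℝ) (i : Fin p) :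
    ((O : Matrix (Fin p) (Fin p) ℝ) *ᵥ (Xᵀ *ᵥ (X *ᵥ β + ε))) i
      = (Dᵀ * D) i i * ((O : Matrix (Fin p) (Fin p) ℝ) *ᵥ β) i
        + √((Dᵀ * D) i i) * extend p ((Q : Matrix (Fin n) (Fin n) ℝ) *ᵥ ε) i := by
  rw [Matrix.mulVec_add, Matrix.mulVec_mulVec β, design_gram hD Q O X hX, Matrix.mulVec_add,
    Matrix.mulVec_mulVec, Matrix.mulVec_mulVec]
  have h1 : (O : Matrix (Fin p) (Fin p) ℝ) * ((O : Matrix (Fin p) (Fin p) ℝ)ᵀ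
      * Matrix.diagonal (fun i => (Dᵀ * D) i i) * (O : Matrix (Fin p) (Fin p) ℝ))
      = Matrix.diagonal (fun i => (Dᵀ * D) i i) * (O : Matrix (Fin p) (Fin p) ℝ) := by
    rw [← Matrix.mul_assoc, ← Matrix.mul_assoc, Orth.mul_transpose, Matrix.one_mul]
  have h2 : (O : Matrix (Fin p) (Fin p) ℝ) * Xᵀ = Dᵀ * (Q : Matrix (Fin n) (Fin n) ℝ) := by
    rw [hX]
    simp only [Matrix.transpose_mul, Matrix.transpose_transpose]
    rw [← Matrix.mul_assoc, Orth.mul_transpose, Matrix.one_mul]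
  rw [h1, h2, ← Matrix.mulVec_mulVec, ← Matrix.mulVec_mulVec, Pi.add_apply,
    Matrix.mulVec_diagonal, hD.transpose_mulVec]

/-- Conjugation by `O` turns the regularized Gram matrix into a diagonal one, whose inverse is
explicit. The spectrum `s` and the right-hand side `z` are abstract because the lemma serves both
the full design and the reduced one, whose spectrum is zero on the removed components. -/
theorem ridge_rotated {ι : Type*} [Fintype ι] (O : Orth p) (X : Matrix ι (Fin p) ℝ)
    (y : ι → ℝ) (s z : Fin p → ℝ) (hs : ∀ i, 0 ≤ s i)
    (hX : Xᵀ * X = (O : Matrix (Fin p) (Fin p) ℝ)ᵀ * Matrix.diagonal s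
      * (O : Matrix (Fin p) (Fin p) ℝ))
    (hy : ∀ i, ((O : Matrix (Fin p) (Fin p) ℝ) *ᵥ (Xᵀ *ᵥ y)) i = z i)
    {lam : ℝ} (hl : 0 < lam) (i : Fin p) :
    ((O : Matrix (Fin p) (Fin p) ℝ) *ᵥ ridge X y lam) i = z i / (s i + lam) := by
  set U : Matrix (Fin p) (Fin p) ℝ := (O : Matrix (Fin p) (Fin p) ℝ)
  have hpos : ∀ i, s i + lam ≠ 0 := fun i => by have := hs i; positivity
  have hA : Xᵀ * X + lam • (1 : Matrix (Fin p) (Fin p) ℝ)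
      = Uᵀ * Matrix.diagonal (fun i => s i + lam) * U := by
    have h1 : Matrix.diagonal (fun i => s i + lam)
        = Matrix.diagonal s + lam • (1 : Matrix (Fin p) (Fin p) ℝ) := by
      rw [← Matrix.diagonal_one, ← Matrix.diagonal_smul, Matrix.diagonal_add]
      congr 1; ext i; simp
    rw [hX, h1, Matrix.mul_add, Matrix.add_mul, Matrix.mul_smul, Matrix.mul_one,
      Matrix.smul_mul, Orth.transpose_mul]
  have hinv : (Xᵀ * X + lam • (1 : Matrix (Fin p) (Fin p) ℝ))⁻¹
      = Uᵀ * Matrix.diagonal (fun i => (s i + lam)⁻¹) * U := by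
    apply Matrix.inv_eq_right_inv
    rw [hA]
    calc Uᵀ * Matrix.diagonal (fun i => s i + lam) * U
          * (Uᵀ * Matrix.diagonal (fun i => (s i + lam)⁻¹) * U)
        = Uᵀ * Matrix.diagonal (fun i => s i + lam) * (U * Uᵀ)
          * Matrix.diagonal (fun i => (s i + lam)⁻¹) * U := by simp only [Matrix.mul_assoc]
      _ = Uᵀ * (Matrix.diagonal (fun i => s i + lam)
          * Matrix.diagonal (fun i => (s i + lam)⁻¹)) * U := by
          rw [Orth.mul_transpose, Matrix.mul_one]; simp only [Matrix.mul_assoc]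
      _ = 1 := by
          rw [Matrix.diagonal_mul_diagonal]
          have : (fun i => (s i + lam) * (s i + lam)⁻¹) = fun _ => (1 : ℝ) := by
            ext i; exact mul_inv_cancel₀ (hpos i)
          rw [this, Matrix.diagonal_one, Matrix.mul_one, Orth.transpose_mul]
  rw [ridge, hinv, Matrix.mulVec_mulVec, ← Matrix.mul_assoc, ← Matrix.mul_assoc,
    Orth.mul_transpose, Matrix.one_mul, ← Matrix.mulVec_mulVec, Matrix.mulVec_diagonal, hy,
    div_eq_inv_mul]

/-- The principal components are orthogonal, so `ZᵀZ` is diagonal and the regression splits into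
scalar ones. Only the singular values inside `S` have to be nonzero. -/
theorem pcr_apply (O : Orth p) (X : Matrix (Fin n) (Fin p) ℝ) (y : Fin n → ℝ)
    (s z : Fin p → ℝ) (S : Finset (Fin p)) (hs : ∀ i ∈ S, s i ≠ 0)
    (hX : Xᵀ * X = (O : Matrix (Fin p) (Fin p) ℝ)ᵀ * Matrix.diagonal s
      * (O : Matrix (Fin p) (Fin p) ℝ))
    (hy : ∀ i, ((O : Matrix (Fin p) (Fin p) ℝ) *ᵥ (Xᵀ *ᵥ y)) i = z i) (i : S) :
    pcr X O y S i = z i / s i := by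
  set U : Matrix (Fin p) (Fin p) ℝ := (O : Matrix (Fin p) (Fin p) ℝ) with hU
  have hR : ∀ A : Matrix (Fin p) (Fin p) ℝ,
      rowsOf O S * A = (U * A).submatrix (fun i : S => (i : Fin p)) id := by
    intro A; ext i j; rfl
  have hG : (X * (rowsOf O S)ᵀ)ᵀ * (X * (rowsOf O S)ᵀ)
      = Matrix.diagonal fun i : S => s i := by
    have h1 : (X * (rowsOf O S)ᵀ)ᵀ * (X * (rowsOf O S)ᵀ)
        = (U * (Xᵀ * X) * Uᵀ).submatrix (fun i : S => (i : Fin p)) (fun i : S => (i : Fin p)) := by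
      rw [Matrix.transpose_mul, Matrix.transpose_transpose, Matrix.mul_assoc,
        ← Matrix.mul_assoc Xᵀ, ← Matrix.mul_assoc, hR]
      ext i j; rfl
    rw [h1, hX]
    have h2 : U * (Uᵀ * Matrix.diagonal s * U) * Uᵀ = Matrix.diagonal s := by
      calc U * (Uᵀ * Matrix.diagonal s * U) * Uᵀ
          = (U * Uᵀ) * Matrix.diagonal s * (U * Uᵀ) := by simp only [Matrix.mul_assoc]
        _ = _ := by rw [Orth.mul_transpose, Matrix.one_mul, Matrix.mul_one]
    rw [h2]
    ext i j
    rw [Matrix.submatrix_apply]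
    by_cases hij : i = j
    · rw [hij, Matrix.diagonal_apply_eq, Matrix.diagonal_apply_eq]
    · rw [Matrix.diagonal_apply_ne _ hij,
        Matrix.diagonal_apply_ne _ fun h => hij (Subtype.ext h)]
  have hinv : (Matrix.diagonal fun i : S => s i)⁻¹ = Matrix.diagonal fun i : S => (s i)⁻¹ := by
    apply Matrix.inv_eq_right_inv
    rw [Matrix.diagonal_mul_diagonal, ← Matrix.diagonal_one]
    congr 1; ext i; exact mul_inv_cancel₀ (hs i i.2)
  have hz : (X * (rowsOf O S)ᵀ)ᵀ *ᵥ y = fun i : S => z i := by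
    ext i
    rw [Matrix.transpose_mul, Matrix.transpose_transpose, ← Matrix.mulVec_mulVec, ← hy]
    rfl
  change (((X * (rowsOf O S)ᵀ)ᵀ * (X * (rowsOf O S)ᵀ))⁻¹ *ᵥ ((X * (rowsOf O S)ᵀ)ᵀ *ᵥ y)) i = _
  rw [hG, hinv, hz, Matrix.mulVec_diagonal, div_eq_inv_mul]

theorem Xnew_transpose_mulVec (Ja : Finset ℕ) (D : Matrix (Fin n) (Fin p) ℝ) (O : Orth p)
    (y : residIdx D Ja → ℝ) :
    (Xnew Ja D O)ᵀ *ᵥ y = (O : Matrix (Fin p) (Fin p) ℝ)ᵀ *ᵥ fun i =>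
      if h : i ∈ residIdx D Ja then √((Dᵀ * D) i i) * y ⟨i, h⟩ else 0 := by
  ext j
  rw [Xnew, singDiag, Matrix.transpose_mul, Matrix.diagonal_transpose, ← Matrix.mulVec_mulVec]
  simp only [Matrix.mulVec, dotProduct, Matrix.transpose_apply, mul_dite, mul_zero]
  rw [Finset.sum_dite]
  simp only [Finset.sum_const_zero, add_zero]
  let e : residIdx D Ja ≃ {x // x ∈ Finset.univ.filter fun x => x ∈ residIdx D Ja} :=
    Equiv.subtypeEquivRight fun x => by simp
  rw [← e.sum_comp]
  refine Finset.sum_congr rfl fun i _ => ?_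
  rw [← dotProduct, ← Matrix.mulVec, Matrix.mulVec_diagonal]
  rfl

/-- The reduced design has a trivial left singular factor, so ridge multiplies the `i`-th response
by `s / (s + lam)` and leaves the fraction `lam / (s + lam)` as residual. -/
theorem trainErr_Xnew (Ja : Finset ℕ) (D : Matrix (Fin n) (Fin p) ℝ) (O : Orth p)
    (y : residIdx D Ja → ℝ) {lam : ℝ} (hl : 0 < lam) :
    trainErr (Xnew Ja D O) y lam
      = (∑ i : residIdx D Ja, (lam * y i / ((Dᵀ * D) i i + lam)) ^ 2) / (residIdx D Ja).card := by
  set U : Matrix (Fin p) (Fin p) ℝ := (O : Matrix (Fin p) (Fin p) ℝ) with hU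
  have hs0 := gram_nonneg D
  have hx : ∀ x : Fin p → ℝ, ∀ i, (Xnew Ja D O *ᵥ x) i = √((Dᵀ * D) i i) * (U *ᵥ x) i := by
    intro x i
    rw [Xnew, singDiag, ← Matrix.mulVec_mulVec, Matrix.mulVec_diagonal]
    rfl
  have hG : (Xnew Ja D O)ᵀ * Xnew Ja D O = Uᵀ
      * Matrix.diagonal (fun i => if i ∈ residIdx D Ja then (Dᵀ * D) i i else 0) * U := by
    -- Comparing the two matrices on basis vectors lets the formula for `Xnewᵀ y` be reused.
    apply Matrix.ext_of_mulVec_single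
    intro j
    rw [← Matrix.mulVec_mulVec, Xnew_transpose_mulVec, ← Matrix.mulVec_mulVec,
      ← Matrix.mulVec_mulVec]
    congr 1
    ext i
    rw [Matrix.mulVec_diagonal]
    by_cases h : i ∈ residIdx D Ja
    · rw [dif_pos h, hx, if_pos h, ← mul_assoc, Real.mul_self_sqrt (hs0 i)]
    · rw [dif_neg h, if_neg h, zero_mul]
  have hr := ridge_rotated O (Xnew Ja D O) y _ _ (fun i => by split_ifs <;> simp [hs0 i]) hG
    (fun i => by
      rw [Xnew_transpose_mulVec, Matrix.mulVec_mulVec, Orth.mul_transpose, Matrix.one_mulVec]) hl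
  rw [trainErr, Fintype.card_coe]
  congr 1
  refine Finset.sum_congr rfl fun i _ => ?_
  have hi : (i : Fin p) ∈ residIdx D Ja := i.2
  rw [hx, hr, dif_pos hi, if_pos hi]
  have h1 := Real.mul_self_sqrt (hs0 i)
  have h2 : (Dᵀ * D) i i + lam ≠ 0 := by have := hs0 i; positivity
  congr 1
  rw [mul_div_assoc', ← mul_assoc, h1]
  field_simp
  ring

theorem deriv_stieltjes {ι : Type*} [Fintype ι] (s : ι → ℝ) (hs : ∀ i, 0 ≤ s i) {lam : ℝ}
    (hl : 0 < lam) :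
    deriv (stieltjes s) (-lam) = (∑ i, 1 / (s i + lam) ^ 2) / Fintype.card ι := by
  apply HasDerivAt.deriv
  unfold stieltjes
  apply HasDerivAt.div_const
  apply HasDerivAt.fun_sum
  intro i _
  have h : s i - -lam ≠ 0 := by have := hs i; rw [sub_neg_eq_add]; positivity
  have := ((hasDerivAt_const (-lam) (1 : ℝ)).div ((hasDerivAt_id (-lam)).const_sub (s i)) h)
  have e : 1 / (s i + lam) ^ 2
      = (0 * (s i - id (-lam)) - 1 * -1) / (s i - id (-lam)) ^ 2 := by simp
  rw [e]
  exact this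

theorem coefB_eq {ι : Type*} [Fintype ι] (s : ι → ℝ) (hs : ∀ i, 0 ≤ s i) {lam : ℝ}
    (hl : 0 < lam) :
    coefB s lam = lam ^ 2 * ((∑ i, 1 / (s i + lam) ^ 2) / Fintype.card ι) := by
  rw [coefB, deriv_stieltjes s hs hl]

/-- This is `1 / (s + lam) - lam / (s + lam)² = s / (s + lam)²`, summed. Together with `coefB_eq` it
identifies the coefficients with the mean contributions of signal and noise to the training error.
-/
theorem coefA_eq {ι : Type*} [Fintype ι] (γ : ℝ) (s : ι → ℝ) (hs : ∀ i, 0 ≤ s i) {lam : ℝ}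
    (hl : 0 < lam) :
    coefA γ s lam = lam ^ 2 / γ * ((∑ i, s i / (s i + lam) ^ 2) / Fintype.card ι) := by
  rw [coefA, deriv_stieltjes s hs hl, stieltjes]
  congr 1
  rw [mul_div_assoc', ← sub_div, Finset.mul_sum, ← Finset.sum_sub_distrib]
  congr 1
  refine Finset.sum_congr rfl fun i _ => ?_
  have h : s i + lam ≠ 0 := by have := hs i; positivity
  rw [sub_neg_eq_add]
  field_simp
  ring

end Algebra

/-! ### Invariance of Haar and Gaussian measures, transitivity on spheres -/

section Invariance

instance instSecondCountableTopologyOrth (p : ℕ) : SecondCountableTopology (Orth p) :=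
  haveI : SecondCountableTopology (Matrix (Fin p) (Fin p) ℝ) :=
    inferInstanceAs (SecondCountableTopology (Fin p → Fin p → ℝ))
  TopologicalSpace.Subtype.secondCountableTopology
    (fun A : Matrix (Fin p) (Fin p) ℝ => A ∈ Matrix.orthogonalGroup (Fin p) ℝ)

/-- A left-invariant probability measure on a group is right-invariant. -/
theorem lintegral_mul_right_eq_of_isMulLeftInvariant {G : Type*} [Group G] [MeasurableSpace G]
    [MeasurableMul₂ G] [MeasurableInv G] (μ : Measure G) [IsProbabilityMeasure μ]
    [μ.IsMulLeftInvariant] (f : G → ℝ≥0∞) (hf : Measurable f) (g : G) :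
    ∫⁻ x, f (x * g) ∂μ = ∫⁻ x, f x ∂μ := by
  -- Invariance under inversion: integrate `F (y⁻¹ * x)` over both variables and use left invariance
  -- in either order. Right translation is then left translation conjugated by inversion.
  have key : ∀ F : G → ℝ≥0∞, Measurable F → ∫⁻ x, F x ∂μ = ∫⁻ x, F x⁻¹ ∂μ := by
    intro F hF
    calc ∫⁻ x, F x ∂μ = ∫⁻ _, ∫⁻ x, F x ∂μ ∂μ := by simp
      _ = ∫⁻ y, ∫⁻ x, F (y⁻¹ * x) ∂μ ∂μ := by
          congr 1; ext y; exact (lintegral_mul_left_eq_self F y⁻¹).symm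
      _ = ∫⁻ x, ∫⁻ y, F (y⁻¹ * x) ∂μ ∂μ := by
          apply lintegral_lintegral_swap
          exact (hF.comp (by fun_prop)).aemeasurable
      _ = ∫⁻ x, ∫⁻ y, F (x⁻¹ * y)⁻¹ ∂μ ∂μ := by
          congr 1; ext x; congr 1; ext y; rw [mul_inv_rev, inv_inv]
      _ = ∫⁻ x, ∫⁻ y, F y⁻¹ ∂μ ∂μ := by
          congr 1; ext x; exact lintegral_mul_left_eq_self (fun y => F y⁻¹) x⁻¹
      _ = _ := by simp
  rw [key (fun x => f (x * g)) (hf.comp (measurable_mul_const g)), key f hf,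
    ← lintegral_mul_left_eq_self (fun x => f x⁻¹) g⁻¹]
  simp

/-- The standard Gaussian law on `Fin n → ℝ` is invariant under orthogonal matrices. -/
theorem map_mulVec_pi_gaussianReal {n : ℕ} (U : Orth n) :
    (Measure.pi fun _ : Fin n => gaussianReal 0 1).map
      (fun x => (U : Matrix (Fin n) (Fin n) ℝ) *ᵥ x) = Measure.pi fun _ => gaussianReal 0 1 := by
  -- On `EuclideanSpace` the matrix is a linear isometry, under which `stdGaussian` is invariant;
  -- the identity is then pulled back along `toLp`.
  let f₀ : EuclideanSpace ℝ (Fin n) →ₗᵢ[ℝ] EuclideanSpace ℝ (Fin n) :=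
    { toLinearMap := Matrix.toEuclideanLin (U : Matrix (Fin n) (Fin n) ℝ)
      norm_map' := fun x => by
        rw [EuclideanSpace.norm_eq, EuclideanSpace.norm_eq]
        congr 1
        simpa [Matrix.toLpLin_apply] using Orth.sum_sq_mulVec U x.ofLp }
  let f := f₀.toLinearIsometryEquiv rfl
  have hf : ∀ x : Fin n → ℝ, f (WithLp.toLp 2 x)
      = WithLp.toLp 2 ((U : Matrix (Fin n) (Fin n) ℝ) *ᵥ x) := fun x => rfl
  have hm : Measurable fun x : Fin n → ℝ => (U : Matrix (Fin n) (Fin n) ℝ) *ᵥ x := by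
    fun_prop
  have h1 : ((Measure.pi fun _ : Fin n => gaussianReal 0 1).map
      (fun x => (U : Matrix (Fin n) (Fin n) ℝ) *ᵥ x)).map (WithLp.toLp 2)
      = (Measure.pi fun _ => gaussianReal 0 1).map (WithLp.toLp 2) := by
    rw [Measure.map_map (by fun_prop) hm, map_pi_eq_stdGaussian]
    conv_rhs => rw [← stdGaussian_map f, ← map_pi_eq_stdGaussian,
      Measure.map_map (by fun_prop) (by fun_prop)]
    rfl
  exact (MeasurableEquiv.toLp 2 (Fin n → ℝ)).map_measurableEquiv_injective h1

/-- The orthogonal group acts transitively on spheres. -/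
theorem exists_orth_mulVec {p : ℕ} (x y : Fin p → ℝ) (h : ∑ i, x i ^ 2 = ∑ i, y i ^ 2) :
    ∃ U : Orth p, (U : Matrix (Fin p) (Fin p) ℝ) *ᵥ x = y := by
  by_cases hxy : x = y
  · exact ⟨1, by simp [hxy]⟩
  set v := x - y with hv
  have hvv : v ⬝ᵥ v ≠ 0 := by
    rw [Ne, dotProduct_self_eq_zero, hv, sub_eq_zero]; exact hxy
  have hvx : v ⬝ᵥ v = 2 * (v ⬝ᵥ x) := by
    have h' : x ⬝ᵥ x = y ⬝ᵥ y := by simpa [dotProduct, sq] using h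
    rw [hv]
    simp only [sub_dotProduct, dotProduct_sub]
    rw [dotProduct_comm x y, h']; ring
  -- The Householder reflection in the hyperplane orthogonal to `x - y`; it sends `x` to `y` because
  -- equality of norms gives `v ⬝ᵥ v = 2 * (v ⬝ᵥ x)`.
  let A : Matrix (Fin p) (Fin p) ℝ := 1 - (2 / (v ⬝ᵥ v)) • Matrix.vecMulVec v v
  have hA : A ∈ Matrix.orthogonalGroup (Fin p) ℝ := by
    rw [Matrix.mem_orthogonalGroup_iff]
    have ht : Aᵀ = A := by
      ext i j
      simp [A, Matrix.vecMulVec_apply, Matrix.one_apply, eq_comm,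
        mul_comm]
    rw [ht]
    have hsq : Matrix.vecMulVec v v * Matrix.vecMulVec v v
        = (v ⬝ᵥ v) • Matrix.vecMulVec v v := by
      rw [Matrix.vecMulVec_mul_vecMulVec, Matrix.vecMulVec_smul]
    simp only [A, Matrix.sub_mul, Matrix.mul_sub, Matrix.one_mul, Matrix.mul_one,
      Matrix.smul_mul, Matrix.mul_smul, hsq, smul_smul]
    rw [div_mul_cancel₀ _ hvv]
    module
  refine ⟨⟨A, hA⟩, ?_⟩
  change A *ᵥ x = y
  simp only [A]
  rw [Matrix.sub_mulVec, Matrix.one_mulVec, Matrix.smul_mulVec, Matrix.vecMulVec_mulVec]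
  ext i
  have : v i = x i - y i := rfl
  simp
  rw [hvx] at hvv ⊢
  have hq : v ⬝ᵥ x ≠ 0 := right_ne_zero_of_mul hvv
  generalize v ⬝ᵥ x = q at hq ⊢
  rw [this]
  field_simp
  ring

end Invariance

/-! ### Fourth moments of sums of independent centered variables -/

section FourthMoment

variable {Ω : Type*} [MeasurableSpace Ω] {μ : Measure Ω}

theorem integrable_pow_of_memLp_four [IsProbabilityMeasure μ] {X : Ω → ℝ} (hX : MemLp X 4 μ)
    {k : ℕ} (hk : k ≤ 4) : Integrable (fun ω => X ω ^ k) μ := by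
  rcases Nat.eq_zero_or_pos k with rfl | h
  · simp
  have h1 : MemLp X (k : ℕ) μ := hX.mono_exponent (by exact_mod_cast hk)
  have h2 := h1.integrable_norm_pow h.ne'
  refine h2.mono (hX.1.pow k) (Eventually.of_forall fun ω => ?_)
  simp

theorem integral_pow_two_add_of_indepFun [IsProbabilityMeasure μ] {X Y : Ω → ℝ}
    (hX : MemLp X 4 μ) (hY : MemLp Y 4 μ) (h : IndepFun X Y μ)
    (hY0 : ∫ ω, Y ω ∂μ = 0) (a : ℝ) :
    ∫ ω, (X ω + a * Y ω) ^ 2 ∂μ = ∫ ω, X ω ^ 2 ∂μ + a ^ 2 * ∫ ω, Y ω ^ 2 ∂μ := by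
  have iX := fun k (hk : k ≤ 4) => integrable_pow_of_memLp_four hX hk
  have iY := fun k (hk : k ≤ 4) => integrable_pow_of_memLp_four hY hk
  have hXY : IndepFun (fun ω => X ω ^ 1) (fun ω => Y ω ^ 1) μ :=
    h.comp (measurable_id.pow_const 1) (measurable_id.pow_const 1)
  have i11 : Integrable (fun ω => X ω ^ 1 * Y ω ^ 1) μ :=
    hXY.integrable_mul (iX 1 (by norm_num)) (iY 1 (by norm_num))
  have e11 : ∫ ω, X ω ^ 1 * Y ω ^ 1 ∂μ = 0 := by
    rw [hXY.integral_fun_mul_eq_mul_integral (iX 1 (by norm_num)).1 (iY 1 (by norm_num)).1]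
    simp [hY0]
  have e : ∀ ω, (X ω + a * Y ω) ^ 2
      = X ω ^ 2 + (2 * a) * (X ω ^ 1 * Y ω ^ 1) + a ^ 2 * Y ω ^ 2 := fun ω => by ring
  simp_rw [e]
  rw [integral_add ((iX 2 (by norm_num)).fun_add (i11.const_mul _))
      ((iY 2 (by norm_num)).const_mul _),
    integral_add (iX 2 (by norm_num)) (i11.const_mul _), integral_const_mul,
    integral_const_mul, e11]
  ring

/-- In the binomial expansion every term of odd degree in `X` and `Y` contains a centered first
moment as a factor, so only the even ones survive. -/
theorem integral_pow_four_add_of_indepFun [IsProbabilityMeasure μ] {X Y : Ω → ℝ}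
    (hX : MemLp X 4 μ) (hY : MemLp Y 4 μ) (h : IndepFun X Y μ) (hX0 : ∫ ω, X ω ∂μ = 0)
    (hY0 : ∫ ω, Y ω ∂μ = 0) (a : ℝ) :
    ∫ ω, (X ω + a * Y ω) ^ 4 ∂μ = ∫ ω, X ω ^ 4 ∂μ
      + 6 * a ^ 2 * ((∫ ω, X ω ^ 2 ∂μ) * ∫ ω, Y ω ^ 2 ∂μ) + a ^ 4 * ∫ ω, Y ω ^ 4 ∂μ := by
  have iX := fun k (hk : k ≤ 4) => integrable_pow_of_memLp_four hX hk
  have iY := fun k (hk : k ≤ 4) => integrable_pow_of_memLp_four hY hk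
  have hXY : ∀ j k : ℕ, IndepFun (fun ω => X ω ^ j) (fun ω => Y ω ^ k) μ := fun j k =>
    h.comp (measurable_id.pow_const j) (measurable_id.pow_const k)
  have iXY : ∀ j k : ℕ, j ≤ 4 → k ≤ 4 → Integrable (fun ω => X ω ^ j * Y ω ^ k) μ :=
    fun j k hj hk => (hXY j k).integrable_mul (iX j hj) (iY k hk)
  have eXY : ∀ j k : ℕ, j ≤ 4 → k ≤ 4 → ∫ ω, X ω ^ j * Y ω ^ k ∂μ
      = (∫ ω, X ω ^ j ∂μ) * ∫ ω, Y ω ^ k ∂μ := fun j k hj hk =>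
    (hXY j k).integral_fun_mul_eq_mul_integral (iX j hj).1 (iY k hk).1
  have e : ∀ ω, (X ω + a * Y ω) ^ 4 = X ω ^ 4 + (4 * a) * (X ω ^ 3 * Y ω ^ 1)
      + (6 * a ^ 2) * (X ω ^ 2 * Y ω ^ 2) + (4 * a ^ 3) * (X ω ^ 1 * Y ω ^ 3)
      + a ^ 4 * Y ω ^ 4 := fun ω => by ring
  simp_rw [e]
  have j4 := iX 4 le_rfl
  have j31 := (iXY 3 1 (by norm_num) (by norm_num)).const_mul (4 * a)
  have j22 := (iXY 2 2 (by norm_num) (by norm_num)).const_mul (6 * a ^ 2)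
  have j13 := (iXY 1 3 (by norm_num) (by norm_num)).const_mul (4 * a ^ 3)
  have j04 := (iY 4 le_rfl).const_mul (a ^ 4)
  rw [integral_add (((j4.fun_add j31).fun_add j22).fun_add j13) j04,
    integral_add ((j4.fun_add j31).fun_add j22) j13,
    integral_add (j4.fun_add j31) j22, integral_add j4 j31]
  simp only [integral_const_mul]
  rw [eXY 3 1 (by norm_num) (by norm_num), eXY 2 2 (by norm_num) (by norm_num),
    eXY 1 3 (by norm_num) (by norm_num)]
  simp [hX0, hY0]

/-- The fourth moment of a linear combination of independent centered variables. -/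
theorem integral_sum_pow_four_le [IsProbabilityMeasure μ] {ι : Type*} {ξ : ι → Ω → ℝ}
    (hm : ∀ i, Measurable (ξ i)) (hξ : iIndepFun ξ μ) (h4 : ∀ i, MemLp (ξ i) 4 μ)
    (h0 : ∀ i, ∫ ω, ξ i ω ∂μ = 0) {κ : ℝ} (hκ2 : ∀ i, ∫ ω, ξ i ω ^ 2 ∂μ ≤ κ)
    (hκ4 : ∀ i, ∫ ω, ξ i ω ^ 4 ∂μ ≤ κ ^ 2) (a : ι → ℝ) (s : Finset ι) :
    ∫ ω, (∑ i ∈ s, a i * ξ i ω) ^ 4 ∂μ ≤ 3 * κ ^ 2 * (∑ i ∈ s, a i ^ 2) ^ 2 := by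
  classical
  have hind : iIndepFun (fun i ω => a i * ξ i ω) μ :=
    hξ.comp (fun i x => a i * x) (fun i => measurable_const_mul _)
  have hL : ∀ s : Finset ι, MemLp (fun ω => ∑ i ∈ s, a i * ξ i ω) 4 μ := fun s =>
    memLp_finsetSum s fun i _ => (h4 i).const_mul (a i)
  have h1 : ∀ s : Finset ι, ∫ ω, ∑ i ∈ s, a i * ξ i ω ∂μ = 0 := by
    intro s
    rw [integral_finsetSum]
    · simp [integral_const_mul, h0]
    · intro i _
      have := integrable_pow_of_memLp_four (h4 i) (k := 1) (by norm_num)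
      simp only [pow_one] at this
      exact this.const_mul _
  have hsplit : ∀ (s : Finset ι) (i : ι), i ∉ s →
      IndepFun (fun ω => ∑ j ∈ s, a j * ξ j ω) (ξ i) μ := by
    intro s i hi
    -- Independence of the weighted family separates the partial sum from `a i * ξ i`, and dividing
    -- by `a i` recovers `ξ i`. If `a i = 0`, that coefficient is first replaced by `1`, which does
    -- not change the sum over `s`.
    by_cases ha : a i = 0
    · have hind' : iIndepFun (fun j ω => (if j = i then 1 else a j) * ξ j ω) μ :=
        hξ.comp (fun j x => (if j = i then 1 else a j) * x) (fun j => measurable_const_mul _)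
      have := hind'.indepFun_finsetSum_of_notMem (fun j => (hm j).const_mul _) hi
      convert this using 1
      · ext ω
        rw [Finset.sum_apply]
        refine Finset.sum_congr rfl fun j hj => ?_
        rw [if_neg (ne_of_mem_of_not_mem hj hi)]
      · ext ω; simp
    · have := (hind.indepFun_finsetSum_of_notMem (fun j => (hm j).const_mul _) hi).comp
        measurable_id (measurable_const_mul (a i)⁻¹)
      convert this using 1
      · ext ω; simp
      · ext ω; simp [ha]
  have h2 : ∀ s : Finset ι, ∫ ω, (∑ i ∈ s, a i * ξ i ω) ^ 2 ∂μ ≤ κ * ∑ i ∈ s, a i ^ 2 := by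
    intro s
    induction s using Finset.induction_on with
    | empty => simp
    | insert i s hi ih =>
      simp_rw [Finset.sum_insert hi, add_comm (a i * _)]
      rw [integral_pow_two_add_of_indepFun (hL s) (h4 i) (hsplit s i hi) (h0 i)]
      nlinarith [mul_le_mul_of_nonneg_left (hκ2 i) (sq_nonneg (a i))]
  induction s using Finset.induction_on with
  | empty => simp
  | insert i s hi ih =>
    simp_rw [Finset.sum_insert hi, add_comm (a i * _)]
    rw [integral_pow_four_add_of_indepFun (hL s) (h4 i) (hsplit s i hi) (h1 s) (h0 i)]
    have hA : 0 ≤ ∑ j ∈ s, a j ^ 2 := Finset.sum_nonneg fun j _ => sq_nonneg _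
    have hv : 0 ≤ ∫ ω, ξ i ω ^ 2 ∂μ := integral_nonneg fun ω => sq_nonneg _
    have hκ : 0 ≤ κ := hv.trans (hκ2 i)
    have hmul : (∫ ω, (∑ j ∈ s, a j * ξ j ω) ^ 2 ∂μ) * ∫ ω, ξ i ω ^ 2 ∂μ
        ≤ (κ * ∑ j ∈ s, a j ^ 2) * κ := mul_le_mul (h2 s) (hκ2 i) hv (by positivity)
    have e1 := mul_le_mul_of_nonneg_left hmul (by positivity : 0 ≤ 6 * a i ^ 2)
    have e2 := mul_le_mul_of_nonneg_left (hκ4 i) (by positivity : 0 ≤ a i ^ 4)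
    -- With `A` the sum over `s`, the target `3κ²(A + a²)²` exceeds `3κ²A²` by `6κ²Aa² + 3κ²a⁴`,
    -- while the step only adds `6κ²Aa² + κ²a⁴`.
    nlinarith [mul_nonneg (sq_nonneg κ) (by positivity : 0 ≤ a i ^ 4)]

/-- A uniform fourth moment bound for linear combinations of independent copies of a centered
variable. -/
theorem exists_lintegral_sum_pow_four_le (ν : Measure ℝ) [IsProbabilityMeasure ν] {φ : ℝ → ℝ}
    (hm : Measurable φ) (h4 : MemLp φ 4 ν) (h0 : ∫ x, φ x ∂ν = 0) :
    ∃ K : ℝ, 0 ≤ K ∧ ∀ (n : ℕ) (a : Fin n → ℝ),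
      ∫⁻ x, ENNReal.ofReal ((∑ i, a i * φ (x i)) ^ 4) ∂(Measure.pi fun _ : Fin n => ν)
        ≤ ENNReal.ofReal (K * (∑ i, a i ^ 2) ^ 2) := by
  -- The summand `1` ensures `κ ≤ κ²`, so that `κ` dominates the second moment and `κ²` the fourth.
  set κ : ℝ := 1 + ∫ x, φ x ^ 2 ∂ν + ∫ x, φ x ^ 4 ∂ν with hκ
  have p2 : 0 ≤ ∫ x, φ x ^ 2 ∂ν := integral_nonneg fun x => sq_nonneg _
  have p4 : 0 ≤ ∫ x, φ x ^ 4 ∂ν := integral_nonneg fun x => by positivity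
  refine ⟨3 * κ ^ 2, by positivity, fun n a => ?_⟩
  have hev : ∀ i : Fin n, MeasurePreserving (fun x : Fin n → ℝ => x i)
      (Measure.pi fun _ : Fin n => ν) ν := fun i => measurePreserving_eval (fun _ => ν) i
  have hmemi : ∀ i : Fin n, MemLp (fun x : Fin n → ℝ => φ (x i)) 4
      (Measure.pi fun _ : Fin n => ν) := fun i => h4.comp_measurePreserving (hev i)
  have hint : ∀ (i : Fin n) (k : ℕ), ∫ x : Fin n → ℝ, φ (x i) ^ k ∂(Measure.pi fun _ : Fin n => ν)
      = ∫ x, φ x ^ k ∂ν := fun i k =>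
    integral_comp_eval (μ := fun _ : Fin n => ν) (i := i) (f := fun x => φ x ^ k)
      (hm.pow_const k).aestronglyMeasurable
  have hS : MemLp (fun x : Fin n → ℝ => ∑ i, a i * φ (x i)) 4
      (Measure.pi fun _ : Fin n => ν) := memLp_finsetSum _ fun i _ => (hmemi i).const_mul (a i)
  rw [← ofReal_integral_eq_lintegral_ofReal (integrable_pow_of_memLp_four hS le_rfl)
    (Eventually.of_forall fun x => by positivity)]
  apply ENNReal.ofReal_le_ofReal
  refine integral_sum_pow_four_le (ξ := fun (i : Fin n) (x : Fin n → ℝ) => φ (x i))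
    (fun i => hm.comp (measurable_pi_apply i))
    (iIndepFun_pi (X := fun _ : Fin n => φ) fun i => hm.aemeasurable) hmemi (fun i => ?_)
    (fun i => ?_) (fun i => ?_) a Finset.univ
  · simpa [h0] using hint i 1
  · rw [hint i 2]; linarith
  · rw [hint i 4]; nlinarith

end FourthMoment

/-! ### Measurability and quadratic forms in a uniformly random direction -/

section Sphere

theorem measurable_matrix_entry {m p : ℕ} (i : Fin m) (j : Fin p) :
    Measurable fun A : Matrix (Fin m) (Fin p) ℝ => A i j :=
  (measurable_pi_apply j).comp (measurable_pi_apply (X := fun _ : Fin m => Fin p → ℝ) i)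

theorem measurable_mulVec {Ω : Type*} [MeasurableSpace Ω] {m p : ℕ}
    {A : Ω → Matrix (Fin m) (Fin p) ℝ} {x : Ω → Fin p → ℝ} (hA : Measurable A)
    (hx : Measurable x) : Measurable fun ω => A ω *ᵥ x ω := by
  refine measurable_pi_iff.2 fun i => ?_
  simp only [Matrix.mulVec, dotProduct]
  exact Finset.measurable_sum _ fun j _ => ((measurable_matrix_entry i j).comp hA).mul
    ((measurable_pi_apply j).comp hx)

theorem measurable_matrix_mul {Ω : Type*} [MeasurableSpace Ω] {m p q : ℕ}
    {A : Ω → Matrix (Fin m) (Fin p) ℝ} {B : Ω → Matrix (Fin p) (Fin q) ℝ} (hA : Measurable A)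
    (hB : Measurable B) : Measurable fun ω => A ω * B ω := by
  refine measurable_pi_iff.2 fun i => measurable_pi_iff.2 fun j => ?_
  simp only [Matrix.mul_apply]
  exact Finset.measurable_sum _ fun k _ => ((measurable_matrix_entry i k).comp hA).mul
    ((measurable_matrix_entry k j).comp hB)

theorem measurable_matrix_transpose {Ω : Type*} [MeasurableSpace Ω] {m p : ℕ}
    {A : Ω → Matrix (Fin m) (Fin p) ℝ} (hA : Measurable A) : Measurable fun ω => (A ω)ᵀ :=
  measurable_pi_iff.2 fun i => measurable_pi_iff.2 fun j => (measurable_matrix_entry j i).comp hA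

theorem measurable_orth_coe (p : ℕ) :
    Measurable fun O : Orth p => (O : Matrix (Fin p) (Fin p) ℝ) :=
  measurable_subtype_coe

theorem memLp_sq_gaussianReal (v : ℝ≥0) : MemLp (fun x : ℝ => x ^ 2) 4 (gaussianReal 0 v) := by
  have h8 : MemLp (id : ℝ → ℝ) 8 (gaussianReal 0 v) := memLp_id_gaussianReal' 8 (by simp)
  have : ENNReal.HolderTriple 8 8 4 := ⟨by
    have h : (8 : ℝ≥0∞) = 2 * 4 := by norm_num
    rw [h, ENNReal.mul_inv (by simp) (by simp), ← add_mul, ENNReal.inv_two_add_inv_two, one_mul]⟩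
  have := h8.mul h8 (r := 4)
  convert this using 1
  ext x
  simp [sq]

theorem integral_sq_gaussianReal (v : ℝ≥0) : ∫ x, x ^ 2 ∂(gaussianReal 0 v) = v := by
  have h := variance_fun_id_gaussianReal (μ := 0) (v := v)
  rw [variance_eq_integral aemeasurable_id'] at h
  simpa using h

theorem exists_lintegral_linear_gaussian_le (v : ℝ≥0) :
    ∃ K : ℝ, 0 ≤ K ∧ ∀ (n : ℕ) (a : Fin n → ℝ),
      ∫⁻ x, ENNReal.ofReal ((∑ i, a i * x i) ^ 4)
          ∂(Measure.pi fun _ : Fin n => gaussianReal 0 v)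
        ≤ ENNReal.ofReal (K * (∑ i, a i ^ 2) ^ 2) :=
  exists_lintegral_sum_pow_four_le (φ := fun x => x) _ measurable_id
    (memLp_id_gaussianReal' 4 (by simp)) (by simp)

theorem exists_lintegral_quadratic_gaussian_le (v : ℝ≥0) :
    ∃ K : ℝ, 0 ≤ K ∧ ∀ (n : ℕ) (a : Fin n → ℝ),
      ∫⁻ x, ENNReal.ofReal ((∑ i, a i * (x i ^ 2 - v)) ^ 4)
          ∂(Measure.pi fun _ : Fin n => gaussianReal 0 v)
        ≤ ENNReal.ofReal (K * (∑ i, a i ^ 2) ^ 2) := by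
  refine exists_lintegral_sum_pow_four_le (φ := fun x => x ^ 2 - v) _ (by fun_prop)
    ((memLp_sq_gaussianReal v).sub (memLp_const _)) ?_
  have hi : Integrable (fun x : ℝ => x ^ 2) (gaussianReal 0 v) :=
    (memLp_sq_gaussianReal v).integrable (by norm_num)
  rw [integral_sub hi (integrable_const _), integral_sq_gaussianReal]
  simp

/-- Jensen's inequality for `t ↦ t⁴` at `E‖g‖² = p`. It bounds the radial factor from below when
Gaussian moments are transferred to the sphere. -/
theorem pow_four_le_lintegral_sum_sq (p : ℕ) :
    ENNReal.ofReal ((p : ℝ) ^ 4) ≤ ∫⁻ x, ENNReal.ofReal ((∑ i, x i ^ 2) ^ 4)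
      ∂(Measure.pi fun _ : Fin p => gaussianReal 0 1) := by
  have hm : ∀ i : Fin p, MemLp (fun x : Fin p → ℝ => x i ^ 2) 4
      (Measure.pi fun _ : Fin p => gaussianReal 0 1) := fun i =>
    (memLp_sq_gaussianReal 1).comp_measurePreserving
      (measurePreserving_eval (fun _ => gaussianReal 0 1) i)
  have hS : MemLp (fun x : Fin p → ℝ => ∑ i, x i ^ 2) 4
      (Measure.pi fun _ : Fin p => gaussianReal 0 1) := memLp_finsetSum _ fun i _ => hm i
  have h1 : ∫ x : Fin p → ℝ, ∑ i, x i ^ 2 ∂(Measure.pi fun _ : Fin p => gaussianReal 0 1) = p := by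
    rw [integral_finsetSum _ fun i _ => (hm i).integrable (by norm_num)]
    have : ∀ i : Fin p, ∫ x : Fin p → ℝ, x i ^ 2 ∂(Measure.pi fun _ : Fin p => gaussianReal 0 1)
        = 1 := fun i => by
      rw [integral_comp_eval (μ := fun _ : Fin p => gaussianReal 0 1) (i := i)
        (f := fun x => x ^ 2) (by fun_prop), integral_sq_gaussianReal]
      rfl
    simp [this]
  have hS4 := integrable_pow_of_memLp_four hS le_rfl
  have hS1 : Integrable (fun x : Fin p → ℝ => ∑ i, x i ^ 2)
      (Measure.pi fun _ : Fin p => gaussianReal 0 1) := hS.integrable (by norm_num)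
  rw [← ofReal_integral_eq_lintegral_ofReal hS4 (Eventually.of_forall fun x => by positivity)]
  apply ENNReal.ofReal_le_ofReal
  -- The integrand is the tangent line of `t ↦ t⁴` at `t = p`, evaluated at `‖x‖²`.
  have h2 : ∫ x : Fin p → ℝ, (4 * (p : ℝ) ^ 3 * (∑ i, x i ^ 2) - 3 * (p : ℝ) ^ 4)
      ∂(Measure.pi fun _ : Fin p => gaussianReal 0 1) = (p : ℝ) ^ 4 := by
    rw [integral_sub (hS1.const_mul _) (integrable_const _), integral_const_mul, h1]
    simp
    ring
  rw [← h2]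
  refine integral_mono ((hS1.const_mul _).sub (integrable_const _)) hS4 fun x => ?_
  have hX : 0 ≤ ∑ i, x i ^ 2 := Finset.sum_nonneg fun i _ => sq_nonneg _
  generalize ∑ i, x i ^ 2 = X at hX ⊢
  have hp : (0 : ℝ) ≤ p := Nat.cast_nonneg p
  generalize (p : ℝ) = q at hp ⊢
  have : X ^ 4 - (4 * q ^ 3 * X - 3 * q ^ 4) = (X - q) ^ 2 * ((X + q) ^ 2 + 2 * q ^ 2) := by ring
  have h0 : 0 ≤ (X - q) ^ 2 * ((X + q) ^ 2 + 2 * q ^ 2) := by positivity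
  simp only
  linarith

/-- The fourth moment of a centered quadratic form in a uniformly random direction. -/
theorem exists_lintegral_sphere_quadratic_le :
    ∃ K : ℝ, 0 ≤ K ∧ ∀ (p : ℕ) (μ : Measure (Orth p)) [IsProbabilityMeasure μ]
      [μ.IsMulLeftInvariant] (c : Fin p → ℝ) (B : ℝ) (x : Fin p → ℝ), 0 < p →
      (∀ i, |c i| ≤ B) → ∑ i, x i ^ 2 ≤ 1 →
      ∫⁻ O, ENNReal.ofReal ((∑ i, c i * (((O : Matrix (Fin p) (Fin p) ℝ) *ᵥ x) i ^ 2
          - (∑ j, x j ^ 2) / p)) ^ 4) ∂μ ≤ ENNReal.ofReal (K * B ^ 4 / (p : ℝ) ^ 2) := by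
  obtain ⟨K, hK, hq⟩ := exists_lintegral_quadratic_gaussian_le 1
  refine ⟨K * 16, by positivity, fun p μ _ _ c B x hp hc hx => ?_⟩
  have hp' : (0 : ℝ) < p := by exact_mod_cast hp
  set G := Measure.pi fun _ : Fin p => gaussianReal 0 1 with hG
  set F : (Fin p → ℝ) → ℝ := fun y => (∑ i, c i * (y i ^ 2 - (∑ j, y j ^ 2) / p)) ^ 4 with hF
  have hFm : Measurable F := by simp only [hF]; fun_prop
  have hF0 : ∀ y, 0 ≤ F y := fun y => by simp only [hF]; positivity
  have hFh : ∀ (t : ℝ) y, F (t • y) = (t ^ 2) ^ 4 * F y := by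
    intro t y
    simp only [hF, Pi.smul_apply, smul_eq_mul, mul_pow, ← Finset.mul_sum]
    rw [← mul_pow]
    congr 1
    conv_rhs => rw [Finset.mul_sum]
    refine Finset.sum_congr rfl fun i _ => by ring
  -- The fourth moment as a function of the starting vector. By right invariance it depends only on
  -- the norm, and it is homogeneous of degree 8.
  set I : (Fin p → ℝ) → ℝ≥0∞ := fun y =>
    ∫⁻ O, ENNReal.ofReal (F ((O : Matrix (Fin p) (Fin p) ℝ) *ᵥ y)) ∂μ with hI
  have hmO : ∀ y : Fin p → ℝ, Measurable fun O : Orth p =>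
      ENNReal.ofReal (F ((O : Matrix (Fin p) (Fin p) ℝ) *ᵥ y)) := fun y =>
    (hFm.comp (measurable_mulVec (measurable_orth_coe p) measurable_const)).ennreal_ofReal
  have hIinv : ∀ y z : Fin p → ℝ, ∑ i, y i ^ 2 = ∑ i, z i ^ 2 → I y = I z := by
    intro y z h
    obtain ⟨U, hU⟩ := exists_orth_mulVec y z h
    have := lintegral_mul_right_eq_of_isMulLeftInvariant μ _ (hmO y) U
    simp only [hI]
    rw [← lintegral_mul_right_eq_of_isMulLeftInvariant μ _ (hmO y) U]
    congr 1
    ext O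
    rw [← hU, Matrix.mulVec_mulVec]
    rfl
  have hIh : ∀ (t : ℝ) y, I (t • y) = ENNReal.ofReal ((t ^ 2) ^ 4) * I y := by
    intro t y
    simp only [hI, Matrix.mulVec_smul, hFh]
    rw [← lintegral_const_mul _ (hmO y)]
    congr 1; ext O
    rw [ENNReal.ofReal_mul (by positivity)]
  -- The vectors `‖g‖ x` and `‖x‖ g` have equal norms, so `‖g‖⁸ I x = ‖x‖⁸ I g`, and `‖x‖ ≤ 1`. No
  -- division by a norm is needed.
  have hcmp : ∀ g : Fin p → ℝ, ENNReal.ofReal ((∑ i, g i ^ 2) ^ 4) * I x ≤ I g := by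
    intro g
    have hg0 : 0 ≤ ∑ i, g i ^ 2 := Finset.sum_nonneg fun i _ => sq_nonneg _
    have hx0 : 0 ≤ ∑ i, x i ^ 2 := Finset.sum_nonneg fun i _ => sq_nonneg _
    have h := hIinv (√(∑ i, g i ^ 2) • x) (√(∑ i, x i ^ 2) • g) (by
      simp only [Pi.smul_apply, smul_eq_mul, mul_pow, ← Finset.mul_sum,
        Real.sq_sqrt hg0, Real.sq_sqrt hx0]
      ring)
    rw [hIh, hIh, Real.sq_sqrt hg0, Real.sq_sqrt hx0] at h
    rw [h]
    refine (mul_le_mul_left (ENNReal.ofReal_le_ofReal (pow_le_one₀ hx0 hx)) _).trans ?_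
    simp
  -- Averaging `I` over a Gaussian vector removes the rotation, since the Gaussian law is itself
  -- rotation invariant.
  have hswap : ∫⁻ g, I g ∂G = ∫⁻ g, ENNReal.ofReal (F g) ∂G := by
    simp only [hI]
    rw [lintegral_lintegral_swap]
    · have : ∀ O : Orth p, ∫⁻ g, ENNReal.ofReal (F ((O : Matrix (Fin p) (Fin p) ℝ) *ᵥ g)) ∂G
          = ∫⁻ g, ENNReal.ofReal (F g) ∂G := by
        intro O
        conv_rhs => rw [hG, ← map_mulVec_pi_gaussianReal O]
        rw [lintegral_map hFm.ennreal_ofReal (by fun_prop)]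
      simp [this]
    · refine (hFm.comp ?_).ennreal_ofReal.aemeasurable
      exact measurable_mulVec ((measurable_orth_coe p).comp measurable_snd) measurable_fst
  have hgauss : ∫⁻ g, ENNReal.ofReal (F g) ∂G ≤ ENNReal.ofReal (K * (p * (4 * B ^ 2)) ^ 2) := by
    set m : ℝ := (∑ i, c i) / p with hm
    have hB : 0 ≤ B := (abs_nonneg _).trans (hc ⟨0, hp⟩)
    have hmB : |m| ≤ B := by
      rw [hm, abs_div, abs_of_pos hp', div_le_iff₀ hp']
      calc |∑ i, c i| ≤ ∑ i, |c i| := Finset.abs_sum_le_sum_abs _ _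
        _ ≤ ∑ _i : Fin p, B := Finset.sum_le_sum fun i _ => hc i
        _ = B * p := by simp [mul_comm]
    -- Subtracting the random mean of the squares amounts to centering the coefficients. After that
    -- the constant `1` may be subtracted freely, which leaves a sum of independent centered terms.
    have he : ∀ g : Fin p → ℝ, ∑ i, c i * (g i ^ 2 - (∑ j, g j ^ 2) / p)
        = ∑ i, (c i - m) * (g i ^ 2 - ((1 : ℝ≥0) : ℝ)) := by
      intro g
      have e1 : ∑ i, (c i - m) * (g i ^ 2 - ((1 : ℝ≥0) : ℝ))
          = ∑ i, c i * g i ^ 2 - m * ∑ i, g i ^ 2 - (∑ i, c i - p * m) := by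
        rw [Finset.mul_sum, ← Finset.sum_sub_distrib]
        have : (p : ℝ) * m = ∑ _i : Fin p, m := by simp
        rw [this, ← Finset.sum_sub_distrib, ← Finset.sum_sub_distrib]
        refine Finset.sum_congr rfl fun i _ => ?_
        rw [NNReal.coe_one]; ring
      have e2 : ∑ i, c i * (g i ^ 2 - (∑ j, g j ^ 2) / p)
          = ∑ i, c i * g i ^ 2 - (∑ i, c i) * ((∑ j, g j ^ 2) / p) := by
        rw [Finset.sum_mul, ← Finset.sum_sub_distrib]
        exact Finset.sum_congr rfl fun i _ => by ring
      rw [e1, e2, hm]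
      field_simp
      ring
    simp only [hF, he]
    refine (hq p fun i => c i - m).trans (ENNReal.ofReal_le_ofReal ?_)
    have hs : ∑ i, (c i - m) ^ 2 ≤ p * (4 * B ^ 2) := by
      calc ∑ i, (c i - m) ^ 2 ≤ ∑ _i : Fin p, 4 * B ^ 2 := Finset.sum_le_sum fun i _ => by
            have h1 := abs_le.1 (hc i)
            have h2 := abs_le.1 hmB
            nlinarith
        _ = _ := by simp
    have : 0 ≤ ∑ i, (c i - m) ^ 2 := Finset.sum_nonneg fun i _ => sq_nonneg _
    gcongr
  have hfin : ENNReal.ofReal ((p : ℝ) ^ 4) * I x ≤ ENNReal.ofReal (K * (p * (4 * B ^ 2)) ^ 2) := by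
    calc ENNReal.ofReal ((p : ℝ) ^ 4) * I x
        ≤ (∫⁻ g, ENNReal.ofReal ((∑ i, g i ^ 2) ^ 4) ∂G) * I x :=
          mul_le_mul_left (pow_four_le_lintegral_sum_sq p) _
      _ = ∫⁻ g, ENNReal.ofReal ((∑ i, g i ^ 2) ^ 4) * I x ∂G :=
          (lintegral_mul_const _ (by fun_prop)).symm
      _ ≤ ∫⁻ g, I g ∂G := lintegral_mono hcmp
      _ ≤ _ := hswap ▸ hgauss
  have hIx : I x ≤ ENNReal.ofReal (K * 16 * B ^ 4 / (p : ℝ) ^ 2) := by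
    have e : K * 16 * B ^ 4 / (p : ℝ) ^ 2 = K * (p * (4 * B ^ 2)) ^ 2 / (p : ℝ) ^ 4 := by
      field_simp; ring
    rw [e, ENNReal.ofReal_div_of_pos (by positivity),
      ENNReal.le_div_iff_mul_le (Or.inl (by simpa using by positivity)) (Or.inl (by simp)),
      mul_comm]
    exact hfin
  refine le_trans (le_of_eq ?_) hIx
  simp only [hI, hF, Orth.sum_sq_mulVec]

end Sphere

/-! ### Conditional fourth moment bounds for signal, cross and noise sums -/

section Concentration

/-- Almost sure convergence to zero from summable fourth moments. -/
theorem ae_tendsto_zero_of_lintegral_pow_four_le {Ω : Type*} [MeasurableSpace Ω] {P : Measure Ω}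
    {Y : ℕ → Ω → ℝ} (hm : ∀ n, Measurable (Y n)) {C : ℝ}
    (h : ∀ᶠ n : ℕ in atTop,
      ∫⁻ ω, ENNReal.ofReal (Y n ω ^ 4) ∂P ≤ ENNReal.ofReal (C / (n : ℝ) ^ 2)) :
    ∀ᵐ ω ∂P, Tendsto (fun n => Y n ω) atTop (𝓝 0) := by
  obtain ⟨N, hN⟩ := eventually_atTop.1 h
  set Z : ℕ → Ω → ℝ≥0∞ := fun n ω => ENNReal.ofReal (Y (n + N) ω ^ 4) with hZ
  have hZm : ∀ n, Measurable (Z n) := fun n => ((hm (n + N)).pow_const 4).ennreal_ofReal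
  have hs : Summable fun n : ℕ => |C| / ((n + N : ℕ) : ℝ) ^ 2 := by
    have h1 : Summable fun n : ℕ => |C| / (n : ℝ) ^ 2 := by
      simp_rw [div_eq_mul_inv]
      exact (Real.summable_nat_pow_inv.2 (by norm_num)).mul_left _
    exact (summable_nat_add_iff (f := fun n : ℕ => |C| / (n : ℝ) ^ 2) N).2 h1
  -- The sum of the fourth powers has finite mean, hence is almost surely finite and its terms tend
  -- to zero. The joint law of the `Y n` plays no role.
  have hsum : ∑' n, ∫⁻ ω, Z n ω ∂P ≠ ∞ := by
    refine ne_top_of_le_ne_top hs.tsum_ofReal_ne_top (ENNReal.tsum_le_tsum fun n => ?_)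
    refine (hN (n + N) (by omega)).trans (ENNReal.ofReal_le_ofReal ?_)
    gcongr
    exact le_abs_self C
  rw [← lintegral_tsum fun n => (hZm n).aemeasurable] at hsum
  filter_upwards [ae_lt_top (Measurable.tsum hZm) hsum] with ω hω
  have h1 := ENNReal.tendsto_atTop_zero_of_tsum_ne_top hω.ne
  have h2 : Tendsto (fun n => (Z n ω).toReal) atTop (𝓝 0) := by
    simpa [Function.comp_def] using (ENNReal.tendsto_toReal ENNReal.zero_ne_top).comp h1
  have h3 : Tendsto (fun n => √(√((Z n ω).toReal))) atTop (𝓝 0) := by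
    have := (Real.continuous_sqrt.comp Real.continuous_sqrt).tendsto 0
    simpa [Function.comp_def] using this.comp h2
  have h4 : ∀ n, √(√((Z n ω).toReal)) = |Y (n + N) ω| := by
    intro n
    simp only [hZ]
    rw [ENNReal.toReal_ofReal (by positivity), show Y (n + N) ω ^ 4 = (Y (n + N) ω ^ 2) ^ 2 by ring,
      Real.sqrt_sq (sq_nonneg _), Real.sqrt_sq_eq_abs]
  simp only [h4] at h3
  exact (tendsto_add_atTop_iff_nat N).1 ((tendsto_zero_iff_abs_tendsto_zero _).2 h3)

/-- Under the product law, a bound valid for every frozen value of `Y` survives averaging over `Y`.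
This is how one conditions on part of the training data below. -/
theorem lintegral_le_of_indepFun {Ω 𝒳 𝒴 : Type*} [MeasurableSpace Ω] [MeasurableSpace 𝒳]
    [MeasurableSpace 𝒴] {P : Measure Ω} [IsProbabilityMeasure P] {X : Ω → 𝒳} {Y : Ω → 𝒴}
    (h : IndepFun X Y P) (hX : Measurable X) (hY : Measurable Y) {H : 𝒳 → 𝒴 → ℝ≥0∞}
    (hH : Measurable (Function.uncurry H)) {C : ℝ≥0∞}
    (hC : ∀ y, ∫⁻ ω, H (X ω) y ∂P ≤ C) : ∫⁻ ω, H (X ω) (Y ω) ∂P ≤ C := by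
  have hYp : IsProbabilityMeasure (P.map Y) := Measure.isProbabilityMeasure_map hY.aemeasurable
  have hXp : IsProbabilityMeasure (P.map X) := Measure.isProbabilityMeasure_map hX.aemeasurable
  have e : ∫⁻ ω, H (X ω) (Y ω) ∂P = ∫⁻ z, Function.uncurry H z ∂(P.map fun ω => (X ω, Y ω)) := by
    rw [lintegral_map hH (hX.prodMk hY)]; rfl
  rw [e, (indepFun_iff_map_prod_eq_prod_map_map hX.aemeasurable hY.aemeasurable).1 h,
    lintegral_prod_symm' _ hH]
  calc ∫⁻ y, ∫⁻ x, Function.uncurry H (x, y) ∂(P.map X) ∂(P.map Y)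
      ≤ ∫⁻ _, C ∂(P.map Y) := lintegral_mono fun y => by
        rw [lintegral_map (f := fun x => Function.uncurry H (x, y))
          (hH.comp measurable_prodMk_right) hX]
        exact hC y
    _ = C := by simp

theorem sum_ite_val_eq {n p : ℕ} (f : Fin p → Fin n → ℝ) (i : Fin p) :
    ∑ k : Fin n, (if (k : ℕ) = i then f i k else 0)
      = if h : (i : ℕ) < n then f i ⟨i, h⟩ else 0 := by
  split_ifs with h
  · rw [Finset.sum_eq_single ⟨i, h⟩]
    · simp
    · intro k _ hk
      rw [if_neg fun e => hk (Fin.ext e)]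
    · simp
  · refine Finset.sum_eq_zero fun k _ => if_neg fun e => h (by rw [← e]; exact k.2)

/-- Both sides run over the indices below `min n p`. This moves sums between the `p` right and the
`n` left singular directions. -/
theorem sum_dite_lt_comm {n p : ℕ} (f : Fin p → Fin n → ℝ) :
    ∑ i : Fin p, (if h : (i : ℕ) < n then f i ⟨i, h⟩ else 0)
      = ∑ k : Fin n, if h : (k : ℕ) < p then f ⟨k, h⟩ k else 0 := by
  simp_rw [← sum_ite_val_eq f, ← sum_ite_val_eq fun k i => f i k]
  rw [Finset.sum_comm]
  simp only [eq_comm]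

theorem sum_mul_extend {n p : ℕ} (c : Fin p → ℝ) (v : Fin n → ℝ) :
    ∑ i, c i * extend p v i = ∑ k, extend n c k * v k := by
  have h := sum_dite_lt_comm fun (i : Fin p) (k : Fin n) => c i * v k
  simpa only [extend, mul_dite, dite_mul, mul_zero, zero_mul] using h

/-- The extended vector is identically zero at coordinates `i ≥ n`, so the variance `w` is
subtracted only for `i < n`. -/
theorem sum_mul_extend_sq_sub {n p : ℕ} (c : Fin p → ℝ) (v : Fin n → ℝ) (w : ℝ) :
    ∑ i : Fin p, c i * (extend p v i ^ 2 - if (i : ℕ) < n then w else 0)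
      = ∑ k, extend n c k * (v k ^ 2 - w) := by
  have h := sum_dite_lt_comm fun (i : Fin p) (k : Fin n) => c i * (v k ^ 2 - w)
  have e : ∀ i : Fin p, c i * (extend p v i ^ 2 - if (i : ℕ) < n then w else 0)
      = if h : (i : ℕ) < n then c i * (v ⟨i, h⟩ ^ 2 - w) else 0 := by
    intro i
    unfold extend
    split_ifs <;> simp
  rw [Finset.sum_congr rfl fun i _ => e i, h]
  simp only [extend, dite_mul, zero_mul]

theorem sum_extend_sq_le {n p : ℕ} (v : Fin n → ℝ) :
    ∑ i, extend p v i ^ 2 ≤ ∑ k, v k ^ 2 := by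
  have h := sum_dite_lt_comm fun (i : Fin p) (k : Fin n) => v k ^ 2
  have e : ∀ i : Fin p, extend p v i ^ 2 = if h : (i : ℕ) < n then v ⟨i, h⟩ ^ 2 else 0 := by
    intro i; unfold extend; split_ifs <;> simp
  simp only [e, h]
  refine Finset.sum_le_sum fun k _ => ?_
  split_ifs
  · exact le_rfl
  · exact sq_nonneg _

/-- The law is the standard Gaussian scaled by `√v`, which includes the degenerate noise `v = 0`. -/
theorem map_mulVec_pi_gaussianReal_of_var {n : ℕ} (v : ℝ≥0) (U : Orth n) :
    (Measure.pi fun _ : Fin n => gaussianReal 0 v).map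
      (fun x => (U : Matrix (Fin n) (Fin n) ℝ) *ᵥ x) = Measure.pi fun _ => gaussianReal 0 v := by
  have hv : gaussianReal 0 v = (gaussianReal 0 1).map (fun x => √(v : ℝ) * x) := by
    rw [gaussianReal_map_const_mul]
    congr 1
    · simp
    · ext; simp
  have hpi : (Measure.pi fun _ : Fin n => gaussianReal 0 v)
      = (Measure.pi fun _ : Fin n => gaussianReal 0 1).map fun x => √(v : ℝ) • x := by
    rw [hv]
    have : IsProbabilityMeasure ((gaussianReal 0 1).map (fun x => √(v : ℝ) * x)) :=
      Measure.isProbabilityMeasure_map (by fun_prop)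
    rw [← Measure.pi_map_pi (μ := fun _ : Fin n => gaussianReal 0 1)
      (f := fun _ x => √(v : ℝ) * x) fun _ => by fun_prop]
    rfl
  rw [hpi, Measure.map_map (by fun_prop) (by fun_prop)]
  conv_rhs => rw [← map_mulVec_pi_gaussianReal U, Measure.map_map (by fun_prop) (by fun_prop)]
  congr 1
  ext x
  simp [Matrix.mulVec_smul]

/-- `x / ‖x‖`, or `0` if `x = 0`. -/
noncomputable def direction {p : ℕ} (x : Fin p → ℝ) : Fin p → ℝ := (√(∑ i, x i ^ 2))⁻¹ • x

theorem sum_direction_sq_le {p : ℕ} (x : Fin p → ℝ) : ∑ i, direction x i ^ 2 ≤ 1 := by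
  have h0 : 0 ≤ ∑ i, x i ^ 2 := Finset.sum_nonneg fun i _ => sq_nonneg _
  simp only [direction, Pi.smul_apply, smul_eq_mul, mul_pow, ← Finset.mul_sum, inv_pow,
    Real.sq_sqrt h0]
  exact inv_mul_le_one

theorem smul_direction {p : ℕ} (x : Fin p → ℝ) : √(∑ i, x i ^ 2) • direction x = x := by
  have h0 : 0 ≤ ∑ i, x i ^ 2 := Finset.sum_nonneg fun i _ => sq_nonneg _
  by_cases h : ∑ i, x i ^ 2 = 0
  · have : x = 0 := by
      ext i
      have := (Finset.sum_eq_zero_iff_of_nonneg fun i _ => sq_nonneg (x i)).1 h i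
        (Finset.mem_univ _)
      exact pow_eq_zero_iff (by norm_num) |>.1 this
    simp [direction, this]
  · have : √(∑ i, x i ^ 2) ≠ 0 := by rw [Ne, Real.sqrt_eq_zero h0]; exact h
    rw [direction, smul_smul, mul_inv_cancel₀ this, one_smul]

theorem measurable_direction {p : ℕ} : Measurable (direction (p := p)) := by
  unfold direction; fun_prop

theorem measurable_extend {n p : ℕ} : Measurable (extend (n := n) p) := by
  refine measurable_pi_iff.2 fun i => ?_
  unfold extend
  split_ifs <;> fun_prop

theorem measurable_gram {n p : ℕ} (i : Fin p) :
    Measurable fun D : Matrix (Fin n) (Fin p) ℝ => (Dᵀ * D) i i :=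
  (measurable_matrix_entry i i).comp
    (measurable_matrix_mul (measurable_matrix_transpose measurable_id) measurable_id)

namespace Data

variable {Ω : Type*} {n n' p : ℕ} {Jc : Finset ℕ}

/-- The direction of the unaligned signal in the basis of right singular vectors. -/
noncomputable def signalDir (M : Data Ω n n' p Jc) (ω : Ω) : Fin p → ℝ :=
  (M.O ω : Matrix (Fin p) (Fin p) ℝ) *ᵥ direction (M.β' ω)

/-- The noise in the basis of left singular vectors. -/
noncomputable def noiseCoord (M : Data Ω n n' p Jc) (ω : Ω) : Fin p → ℝ :=
  extend p ((M.Q ω : Matrix (Fin n) (Fin n) ℝ) *ᵥ M.ε ω)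

variable [MeasurableSpace Ω] {P : Measure Ω} {σ : ℝ} {M : Data Ω n n' p Jc}

theorem IsModel.measurable_signalDir (h : M.IsModel P σ) : Measurable M.signalDir :=
  measurable_mulVec ((measurable_orth_coe p).comp h.measurable_O)
    (measurable_direction.comp h.measurable_β')

theorem IsModel.measurable_noiseCoord (h : M.IsModel P σ) : Measurable M.noiseCoord :=
  measurable_extend.comp
    (measurable_mulVec ((measurable_orth_coe n).comp h.measurable_Q) h.measurable_ε)

theorem IsModel.measurable_coef (h : M.IsModel P σ) {φ : Fin p → ℝ → ℝ}
    (hφ : ∀ i, Measurable (φ i)) (i : Fin p) :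
    Measurable fun ω => φ i (((M.D ω)ᵀ * M.D ω) i i) :=
  (hφ i).comp ((measurable_gram i).comp h.measurable_D)

/-- Once `Q`, `D` and `β'` are frozen the coefficients are constants and `O` is Haar, so the sphere
bound applies. The signal enters through its direction because no moment of `β'` is assumed; its
norm is restored pathwise later. -/
theorem exists_lintegral_signal_le :
    ∃ K : ℝ, 0 ≤ K ∧ ∀ {Ω : Type*} [MeasurableSpace Ω] {P : Measure Ω} [IsProbabilityMeasure P]
      {n n' p : ℕ} {Jc : Finset ℕ} {M : Data Ω n n' p Jc} {σ : ℝ} (_ : M.IsModel P σ)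
      {φ : Fin p → ℝ → ℝ} (_ : ∀ i, Measurable (φ i)) {B : ℝ}
      (_ : ∀ i t, 0 ≤ t → |φ i t| ≤ B) (_ : 0 < p),
      ∫⁻ ω, ENNReal.ofReal ((∑ i, φ i (((M.D ω)ᵀ * M.D ω) i i) * (M.signalDir ω i ^ 2
        - (∑ j, M.signalDir ω j ^ 2) / p)) ^ 4) ∂P ≤ ENNReal.ofReal (K * B ^ 4 / (p : ℝ) ^ 2) := by
  obtain ⟨K, hK, hsph⟩ := exists_lintegral_sphere_quadratic_le
  refine ⟨K, hK, @fun Ω _ P _ n n' p Jc M σ h φ hφ B hB hp => ?_⟩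
  have hmO := h.measurable_O
  have hprob : IsProbabilityMeasure (P.map M.O) :=
    Measure.isProbabilityMeasure_map hmO.aemeasurable
  have hhaar := h.haar_O
  let H : (Orth p) → Matrix (Fin n) (Fin p) ℝ → (Fin p → ℝ) → ℝ≥0∞ := fun O D x =>
    ENNReal.ofReal ((∑ i, φ i ((Dᵀ * D) i i) *
      (((O : Matrix (Fin p) (Fin p) ℝ) *ᵥ direction x) i ^ 2 - (∑ j, direction x j ^ 2) / p)) ^ 4)
  have hHm : Measurable fun z : Orth p × Matrix (Fin n) (Fin p) ℝ × (Fin p → ℝ) =>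
      H z.1 z.2.1 z.2.2 := by
    refine (Measurable.pow_const (Finset.measurable_sum _ fun i _ => ?_) 4).ennreal_ofReal
    have hd : Measurable fun z : Orth p × Matrix (Fin n) (Fin p) ℝ × (Fin p → ℝ) =>
        direction z.2.2 := measurable_direction.comp (by fun_prop)
    refine ((hφ i).comp ((measurable_gram i).comp (by fun_prop))).mul (Measurable.sub ?_ ?_)
    · exact (measurable_pi_iff.1 (measurable_mulVec ((measurable_orth_coe p).comp
        measurable_fst) hd)
        i).pow_const 2
    · exact (Finset.measurable_sum _ fun j _ => (measurable_pi_iff.1 hd j).pow_const 2).div_const _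
  -- The freezing is done in two stages: `(Q, D)` for a fixed vector `x` here, then `β'` in place of
  -- `x`, which is independent of `(Q, D, O)`.
  have h1 : ∀ x, ∫⁻ ω, H (M.O ω) (M.D ω) x ∂P ≤ ENNReal.ofReal (K * B ^ 4 / (p : ℝ) ^ 2) := by
    intro x
    refine lintegral_le_of_indepFun h.indep_O hmO (h.measurable_Q.prodMk h.measurable_D)
      (H := fun O z => H O z.2 x) ?_ fun z => ?_
    · exact hHm.comp (f := fun z : Orth p × Orth n × Matrix (Fin n) (Fin p) ℝ =>
        (z.1, z.2.2, x)) (by fun_prop)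
    · have hHO : Measurable fun O => H O z.2 x :=
        hHm.comp (f := fun O : Orth p => (O, z.2, x)) (by fun_prop)
      rw [← lintegral_map (f := fun O => H O z.2 x) hHO hmO]
      exact hsph p (P.map M.O) _ B (direction x) hp (fun i => hB i _ (gram_nonneg _ i))
        (sum_direction_sq_le x)
  have h2 := lintegral_le_of_indepFun h.indep_β'.symm
    (h.measurable_Q.prodMk (h.measurable_D.prodMk hmO)) h.measurable_β'
    (H := fun z x => H z.2.2 z.2.1 x)
    (hHm.comp (f := fun z : (Orth n × Matrix (Fin n) (Fin p) ℝ × Orth p) × (Fin p → ℝ) =>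
        (z.1.2.2, z.1.2.1, z.2)) (by fun_prop)) h1
  simpa only [H, signalDir, Orth.sum_sq_mulVec] using h2

/-- With everything but the noise frozen, the sum is linear in `ε`. Its coefficient vector has norm
at most `B`, since the direction has norm at most one and `Q` is orthogonal. -/
theorem exists_lintegral_cross_le (σ : ℝ) :
    ∃ K : ℝ, 0 ≤ K ∧ ∀ {Ω : Type*} [MeasurableSpace Ω] {P : Measure Ω} [IsProbabilityMeasure P]
      {n n' p : ℕ} {Jc : Finset ℕ} {M : Data Ω n n' p Jc} (_ : M.IsModel P σ)
      {φ : Fin p → ℝ → ℝ} (_ : ∀ i, Measurable (φ i)) {B : ℝ}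
      (_ : ∀ i t, 0 ≤ t → |φ i t| ≤ B) (_ : 0 < p),
      ∫⁻ ω, ENNReal.ofReal ((∑ i, φ i (((M.D ω)ᵀ * M.D ω) i i) * M.signalDir ω i
        * M.noiseCoord ω i) ^ 4) ∂P ≤ ENNReal.ofReal (K * B ^ 4) := by
  obtain ⟨K, hK, hlin⟩ := exists_lintegral_linear_gaussian_le (Real.toNNReal (σ ^ 2))
  refine ⟨K, hK, @fun Ω _ P _ n n' p Jc M h φ hφ B hB hp => ?_⟩
  have hB0 : 0 ≤ B := (abs_nonneg _).trans (hB ⟨0, hp⟩ 0 le_rfl)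
  let a : Orth n × Matrix (Fin n) (Fin p) ℝ × Orth p × (Fin p → ℝ) → Fin p → ℝ :=
    fun z i => φ i ((z.2.1ᵀ * z.2.1) i i)
      * ((z.2.2.1 : Matrix (Fin p) (Fin p) ℝ) *ᵥ direction z.2.2.2) i
  have ham : Measurable a := by
    refine measurable_pi_iff.2 fun i => ?_
    refine ((hφ i).comp ((measurable_gram i).comp (by fun_prop))).mul ?_
    exact measurable_pi_iff.1 (measurable_mulVec ((measurable_orth_coe p).comp (by fun_prop))
      (measurable_direction.comp (by fun_prop))) i
  have key := lintegral_le_of_indepFun h.indep_ε h.measurable_ε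
    (h.measurable_Q.prodMk (h.measurable_D.prodMk (h.measurable_O.prodMk h.measurable_β')))
    (H := fun v z => ENNReal.ofReal ((∑ k : Fin n,
      ((z.1 : Matrix (Fin n) (Fin n) ℝ)ᵀ *ᵥ extend n (a z)) k * v k) ^ 4))
    (C := ENNReal.ofReal (K * B ^ 4)) ?_ fun z => ?_
  · refine le_trans (le_of_eq ?_) key
    congr 1
    ext ω
    congr 2
    rw [noiseCoord, sum_mul_extend]
    change extend n _ ⬝ᵥ ((M.Q ω : Matrix (Fin n) (Fin n) ℝ) *ᵥ M.ε ω) = _ ⬝ᵥ _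
    rw [Matrix.dotProduct_mulVec, ← Matrix.mulVec_transpose]
    rfl
  · refine (Measurable.pow_const (Finset.measurable_sum _ fun k _ => ?_) 4).ennreal_ofReal
    refine Measurable.mul ?_ (by fun_prop)
    refine measurable_pi_iff.1 (measurable_mulVec (measurable_matrix_transpose
      ((measurable_orth_coe n).comp (by fun_prop))) (measurable_extend.comp (ham.comp ?_))) k
    fun_prop
  · have hm : Measurable fun v : Fin n → ℝ => ENNReal.ofReal ((∑ k : Fin n,
        ((z.1 : Matrix (Fin n) (Fin n) ℝ)ᵀ *ᵥ extend n (a z)) k * v k) ^ 4) := by fun_prop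
    rw [← lintegral_map hm h.measurable_ε, h.law_ε]
    refine (hlin n _).trans (ENNReal.ofReal_le_ofReal ?_)
    have e1 : ∑ k, ((z.1 : Matrix (Fin n) (Fin n) ℝ)ᵀ *ᵥ extend n (a z)) k ^ 2
        = ∑ k, extend n (a z) k ^ 2 := Orth.sum_sq_mulVec z.1⁻¹ _
    have e2 : ∑ k, extend n (a z) k ^ 2 ≤ B ^ 2 := by
      refine (sum_extend_sq_le _).trans ?_
      calc ∑ i, a z i ^ 2
          ≤ ∑ i, B ^ 2 * ((z.2.2.1 : Matrix (Fin p) (Fin p) ℝ) *ᵥ direction z.2.2.2) i ^ 2 := by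
            refine Finset.sum_le_sum fun i _ => ?_
            simp only [a, mul_pow]
            refine mul_le_mul_of_nonneg_right ?_ (sq_nonneg _)
            exact sq_le_sq' (by linarith [abs_le.1 (hB i _ (gram_nonneg z.2.1 i))])
              (abs_le.1 (hB i _ (gram_nonneg z.2.1 i))).2
        _ ≤ B ^ 2 := by
            rw [← Finset.mul_sum, Orth.sum_sq_mulVec]
            exact mul_le_of_le_one_right (sq_nonneg _) (sum_direction_sq_le _)
    rw [e1]
    have e3 : 0 ≤ ∑ k, extend n (a z) k ^ 2 := Finset.sum_nonneg fun k _ => sq_nonneg _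
    calc K * (∑ k, extend n (a z) k ^ 2) ^ 2 ≤ K * (B ^ 2) ^ 2 := by gcongr
      _ = K * B ^ 4 := by ring

/-- For frozen `(Q, D)` the vector `Q ε` has the law of `ε`, so this is a sum of independent
centered squares. There are at most `n` coefficients, each bounded by `B`; hence the factor `n²`. -/
theorem exists_lintegral_noise_le (σ : ℝ) :
    ∃ K : ℝ, 0 ≤ K ∧ ∀ {Ω : Type*} [MeasurableSpace Ω] {P : Measure Ω} [IsProbabilityMeasure P]
      {n n' p : ℕ} {Jc : Finset ℕ} {M : Data Ω n n' p Jc} (_ : M.IsModel P σ)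
      {φ : Fin p → ℝ → ℝ} (_ : ∀ i, Measurable (φ i)) {B : ℝ}
      (_ : ∀ i t, 0 ≤ t → |φ i t| ≤ B) (_ : 0 < p),
      ∫⁻ ω, ENNReal.ofReal ((∑ i : Fin p, φ i (((M.D ω)ᵀ * M.D ω) i i) * (M.noiseCoord ω i ^ 2
        - if (i : ℕ) < n then σ ^ 2 else 0)) ^ 4) ∂P
        ≤ ENNReal.ofReal (K * B ^ 4 * (n : ℝ) ^ 2) := by
  obtain ⟨K, hK, hquad⟩ := exists_lintegral_quadratic_gaussian_le (Real.toNNReal (σ ^ 2))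
  have hσ : ((Real.toNNReal (σ ^ 2) : ℝ≥0) : ℝ) = σ ^ 2 := Real.coe_toNNReal _ (sq_nonneg _)
  rw [hσ] at hquad
  refine ⟨K, hK, @fun Ω _ P _ n n' p Jc M h φ hφ B hB hp => ?_⟩
  have hB0 : 0 ≤ B := (abs_nonneg _).trans (hB ⟨0, hp⟩ 0 le_rfl)
  let a : Matrix (Fin n) (Fin p) ℝ → Fin p → ℝ := fun D i => φ i ((Dᵀ * D) i i)
  have ham : Measurable a :=
    measurable_pi_iff.2 fun i => (hφ i).comp (measurable_gram i)
  have hind : IndepFun M.ε (fun ω => (M.Q ω, M.D ω)) P :=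
    h.indep_ε.comp measurable_id
      (measurable_fst.prodMk (measurable_fst.comp measurable_snd))
  have key := lintegral_le_of_indepFun hind h.measurable_ε (h.measurable_Q.prodMk h.measurable_D)
    (H := fun v z => ENNReal.ofReal ((∑ k : Fin n, extend n (a z.2) k
      * (((z.1 : Matrix (Fin n) (Fin n) ℝ) *ᵥ v) k ^ 2 - σ ^ 2)) ^ 4))
    (C := ENNReal.ofReal (K * B ^ 4 * (n : ℝ) ^ 2)) ?_ fun z => ?_
  · refine le_trans (le_of_eq ?_) key
    congr 1
    ext ω
    congr 2
    rw [noiseCoord, sum_mul_extend_sq_sub]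
  · refine (Measurable.pow_const (Finset.measurable_sum _ fun k _ => ?_) 4).ennreal_ofReal
    refine Measurable.mul (measurable_pi_iff.1 (measurable_extend.comp (ham.comp ?_)) k)
      (Measurable.sub_const (Measurable.pow_const (measurable_pi_iff.1 (measurable_mulVec
        ((measurable_orth_coe n).comp ?_) ?_) k) 2) _) <;> fun_prop
  · have hm : Measurable fun v : Fin n → ℝ => ENNReal.ofReal ((∑ k : Fin n, extend n (a z.2) k
        * (v k ^ 2 - σ ^ 2)) ^ 4) := by fun_prop
    have hU : Measurable fun v : Fin n → ℝ => (z.1 : Matrix (Fin n) (Fin n) ℝ) *ᵥ v := by fun_prop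
    rw [← lintegral_map (f := fun v => ENNReal.ofReal ((∑ k : Fin n, extend n (a z.2) k
      * (((z.1 : Matrix (Fin n) (Fin n) ℝ) *ᵥ v) k ^ 2 - σ ^ 2)) ^ 4)) (hm.comp hU) h.measurable_ε,
      h.law_ε, ← lintegral_map hm hU, map_mulVec_pi_gaussianReal_of_var]
    refine (hquad n _).trans (ENNReal.ofReal_le_ofReal ?_)
    have e2 : ∑ k, extend n (a z.2) k ^ 2 ≤ n * B ^ 2 := by
      calc ∑ k, extend n (a z.2) k ^ 2 ≤ ∑ _k : Fin n, B ^ 2 := by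
            refine Finset.sum_le_sum fun k _ => ?_
            unfold extend
            split_ifs with hk
            · exact sq_le_sq' (by linarith [abs_le.1 (hB ⟨k, hk⟩ _ (gram_nonneg z.2 ⟨k, hk⟩))])
                (abs_le.1 (hB ⟨k, hk⟩ _ (gram_nonneg z.2 ⟨k, hk⟩))).2
            · rw [zero_pow two_ne_zero]; positivity
        _ = n * B ^ 2 := by simp
    have e3 : 0 ≤ ∑ k, extend n (a z.2) k ^ 2 := Finset.sum_nonneg fun k _ => sq_nonneg _
    calc K * (∑ k, extend n (a z.2) k ^ 2) ^ 2 ≤ K * (n * B ^ 2) ^ 2 := by gcongr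
      _ = _ := by ring

end Data

end Concentration

/-! ### Almost sure limits of the centered sums -/

section Limits

variable {Ω : Type*} [MeasurableSpace Ω] {P : Measure Ω} [IsProbabilityMeasure P]
  {p n' : ℕ → ℕ} {Jc : Finset ℕ} {σ γ : ℝ} {M : ∀ n, Data Ω n (n' n) (p n) Jc}

theorem eventually_dim_bounds (hγ : 0 < γ)
    (hp : Tendsto (fun n => (p n : ℝ) / n) atTop (𝓝 γ)) :
    ∀ᶠ n : ℕ in atTop, 0 < n ∧ 0 < p n ∧ γ / 2 * n ≤ p n ∧ (p n : ℝ) ≤ 2 * γ * n := by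
  filter_upwards [hp.eventually (lt_mem_nhds (half_lt_self hγ)),
    hp.eventually (gt_mem_nhds (by linarith : γ < 2 * γ)), eventually_gt_atTop 0] with n h1 h2 hn
  have hn' : (0 : ℝ) < n := by exact_mod_cast hn
  rw [lt_div_iff₀ hn'] at h1
  rw [div_lt_iff₀ hn'] at h2
  refine ⟨hn, ?_, h1.le, h2.le⟩
  have : (0 : ℝ) < p n := lt_trans (by positivity) h1
  exact_mod_cast this

/-- The direction already has norm at most one, so no division is needed here. The cross sum is
divided by `√n` and the noise sum by `n`; in each case the fourth moment becomes `O(n⁻²)`, using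
that `p` is of order `n`. -/
theorem ae_tendsto_signal (hM : ∀ n, (M n).IsModel P σ) (hγ : 0 < γ)
    (hp : Tendsto (fun n => (p n : ℝ) / n) atTop (𝓝 γ)) {φ : ∀ n, Fin (p n) → ℝ → ℝ}
    (hφ : ∀ n i, Measurable (φ n i)) {B : ℝ}
    (hB : ∀ᶠ n in atTop, ∀ i t, 0 ≤ t → |φ n i t| ≤ B) :
    ∀ᵐ ω ∂P, Tendsto (fun n => ∑ i, φ n i ((((M n).D ω)ᵀ * (M n).D ω) i i)
      * ((M n).signalDir ω i ^ 2 - (∑ j, (M n).signalDir ω j ^ 2) / p n)) atTop (𝓝 0) := by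
  obtain ⟨K, hK, h⟩ := Data.exists_lintegral_signal_le
  refine ae_tendsto_zero_of_lintegral_pow_four_le (C := K * B ^ 4 / (γ / 2) ^ 2) (fun n => ?_) ?_
  · have hm := measurable_pi_iff.1 (hM n).measurable_signalDir
    exact Finset.measurable_sum _ fun i _ => ((hM n).measurable_coef (hφ n) i).mul
      (((hm i).pow_const 2).sub
        ((Finset.measurable_sum _ fun j _ => (hm j).pow_const 2).div_const _))
  · filter_upwards [hB, eventually_dim_bounds hγ hp] with n hn ⟨h0, h1, h2, _⟩
    refine (h (hM n) (hφ n) hn h1).trans (ENNReal.ofReal_le_ofReal ?_)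
    have h0' : (0 : ℝ) < n := by exact_mod_cast h0
    rw [div_div, ← mul_pow]
    gcongr

theorem ae_tendsto_cross (hM : ∀ n, (M n).IsModel P σ) (hγ : 0 < γ)
    (hp : Tendsto (fun n => (p n : ℝ) / n) atTop (𝓝 γ)) {φ : ∀ n, Fin (p n) → ℝ → ℝ}
    (hφ : ∀ n i, Measurable (φ n i)) {B : ℝ}
    (hB : ∀ᶠ n in atTop, ∀ i t, 0 ≤ t → |φ n i t| ≤ B) :
    ∀ᵐ ω ∂P, Tendsto (fun n : ℕ => (∑ i, φ n i ((((M n).D ω)ᵀ * (M n).D ω) i i)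
      * (M n).signalDir ω i * (M n).noiseCoord ω i) / √(n : ℝ)) atTop (𝓝 0) := by
  obtain ⟨K, hK, h⟩ := Data.exists_lintegral_cross_le σ
  refine ae_tendsto_zero_of_lintegral_pow_four_le (C := K * B ^ 4) (fun n => ?_) ?_
  · have hm := measurable_pi_iff.1 (hM n).measurable_signalDir
    have hm' := measurable_pi_iff.1 (hM n).measurable_noiseCoord
    exact (Finset.measurable_sum _ fun i _ => (((hM n).measurable_coef (hφ n) i).mul
      (hm i)).mul (hm' i)).div_const _
  · filter_upwards [hB, eventually_dim_bounds hγ hp] with n hn ⟨h0, h1, h2, _⟩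
    have h0' : (0 : ℝ) < n := by exact_mod_cast h0
    have e : ∀ x : ℝ, (x / √(n : ℝ)) ^ 4 = 1 / (n : ℝ) ^ 2 * x ^ 4 := by
      intro x
      have : √(n : ℝ) ^ 4 = (n : ℝ) ^ 2 := by
        rw [show √(n : ℝ) ^ 4 = (√(n : ℝ) ^ 2) ^ 2 by ring, Real.sq_sqrt h0'.le]
      rw [div_pow, this]; ring
    simp_rw [e, ENNReal.ofReal_mul (by positivity : 0 ≤ 1 / (n : ℝ) ^ 2)]
    have e' : K * B ^ 4 / (n : ℝ) ^ 2 = 1 / (n : ℝ) ^ 2 * (K * B ^ 4) := by ring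
    rw [lintegral_const_mul' _ _ ENNReal.ofReal_ne_top, e', ENNReal.ofReal_mul (by positivity)]
    exact mul_le_mul' le_rfl (h (hM n) (hφ n) hn h1)

theorem ae_tendsto_noise (hM : ∀ n, (M n).IsModel P σ) (hγ : 0 < γ)
    (hp : Tendsto (fun n => (p n : ℝ) / n) atTop (𝓝 γ)) {φ : ∀ n, Fin (p n) → ℝ → ℝ}
    (hφ : ∀ n i, Measurable (φ n i)) {B : ℝ}
    (hB : ∀ᶠ n in atTop, ∀ i t, 0 ≤ t → |φ n i t| ≤ B) :
    ∀ᵐ ω ∂P, Tendsto (fun n : ℕ => (∑ i : Fin (p n), φ n i ((((M n).D ω)ᵀ * (M n).D ω) i i)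
      * ((M n).noiseCoord ω i ^ 2 - if (i : ℕ) < n then σ ^ 2 else 0)) / n) atTop (𝓝 0) := by
  obtain ⟨K, hK, h⟩ := Data.exists_lintegral_noise_le σ
  refine ae_tendsto_zero_of_lintegral_pow_four_le (C := K * B ^ 4) (fun n => ?_) ?_
  · have hm' := measurable_pi_iff.1 (hM n).measurable_noiseCoord
    exact (Finset.measurable_sum _ fun i _ => ((hM n).measurable_coef (hφ n) i).mul
      (((hm' i).pow_const 2).sub_const _)).div_const _
  · filter_upwards [hB, eventually_dim_bounds hγ hp] with n hn ⟨h0, h1, h2, _⟩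
    have h0' : (0 : ℝ) < n := by exact_mod_cast h0
    have e₀ : ∀ x : ℝ, (x / n) ^ 4 = 1 / (n : ℝ) ^ 4 * x ^ 4 := fun x => by rw [div_pow]; ring
    simp_rw [e₀, ENNReal.ofReal_mul (by positivity : 0 ≤ 1 / (n : ℝ) ^ 4)]
    rw [lintegral_const_mul' _ _ ENNReal.ofReal_ne_top]
    have e : K * B ^ 4 / (n : ℝ) ^ 2 = 1 / (n : ℝ) ^ 4 * (K * B ^ 4 * (n : ℝ) ^ 2) := by
      field_simp
    rw [e, ENNReal.ofReal_mul (by positivity)]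
    exact mul_le_mul' le_rfl (h (hM n) (hφ n) hn h1)

end Limits

/-! ### Conditional law of the test design and the exact risk -/

section Risk

variable {p : ℕ}

/-- The permutation matrix of a permutation that fixes `J` lies in the row stabilizer of `J`. -/
theorem exists_rowStabilizer_perm (J : Finset ℕ) (τ : Equiv.Perm (Fin p))
    (hτ : ∀ i ∈ idx p J, τ i = i) :
    ∃ U : rowStabilizer p J, ∀ y : Fin p → ℝ,
      ((U : Orth p) : Matrix (Fin p) (Fin p) ℝ) *ᵥ y = y ∘ τ := by
  let A : Matrix (Fin p) (Fin p) ℝ := Matrix.of fun i j => if τ i = j then 1 else 0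
  have hA : A ∈ Matrix.orthogonalGroup (Fin p) ℝ := by
    rw [Matrix.mem_orthogonalGroup_iff]
    ext i j
    change ∑ k, A i k * A j k = _
    simp [A, Matrix.one_apply, eq_comm]
  refine ⟨⟨⟨A, hA⟩, fun i hi j => ?_⟩, fun y => ?_⟩
  · change A i j = _
    simp [A, hτ i hi, Matrix.one_apply]
  · ext i
    change (A *ᵥ y) i = _
    simp [A, Matrix.mulVec, dotProduct]

theorem rowStabilizer_mulVec_apply {J : Finset ℕ} (V : rowStabilizer p J) (x : Fin p → ℝ)
    {k : Fin p} (hk : k ∈ idx p J) :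
    (((V : Orth p) : Matrix (Fin p) (Fin p) ℝ) *ᵥ x) k = x k := by
  simp [Matrix.mulVec, dotProduct, V.2 k hk, Matrix.one_apply]

theorem measurable_rowStabilizer_mulVec (J : Finset ℕ) (x : Fin p → ℝ) (k : Fin p) :
    Measurable fun V : rowStabilizer p J =>
      (((V : Orth p) : Matrix (Fin p) (Fin p) ℝ) *ᵥ x) k :=
  measurable_pi_iff.1 (measurable_mulVec ((measurable_orth_coe p).comp measurable_subtype_coe)
    measurable_const) k

theorem integrable_rowStabilizer_sq (J : Finset ℕ) (μ : Measure (rowStabilizer p J))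
    [IsProbabilityMeasure μ] (x : Fin p → ℝ) (k : Fin p) :
    Integrable (fun V : rowStabilizer p J =>
      (((V : Orth p) : Matrix (Fin p) (Fin p) ℝ) *ᵥ x) k ^ 2) μ := by
  refine Integrable.of_bound
    ((measurable_rowStabilizer_mulVec J x k).pow_const 2).aestronglyMeasurable (∑ i, x i ^ 2)
    (Eventually.of_forall fun V => ?_)
  rw [Real.norm_of_nonneg (sq_nonneg _), ← Orth.sum_sq_mulVec (V : Orth p) x]
  exact Finset.single_le_sum (f := fun i =>
    (((V : Orth p) : Matrix (Fin p) (Fin p) ℝ) *ᵥ x) i ^ 2) (fun i _ => sq_nonneg _)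
    (Finset.mem_univ k)

/-- A uniformly random rotation of the orthogonal complement of the shared rows spreads the mass of
a vector evenly. -/
theorem integral_rowStabilizer_sq (J : Finset ℕ) (μ : Measure (rowStabilizer p J))
    [IsProbabilityMeasure μ] [μ.IsMulLeftInvariant] (x : Fin p → ℝ) (k : Fin p) :
    ∫ V : rowStabilizer p J, (((V : Orth p) : Matrix (Fin p) (Fin p) ℝ) *ᵥ x) k ^ 2 ∂μ
      = if k ∈ idx p J then x k ^ 2
        else (∑ i ∈ (idx p J)ᶜ, x i ^ 2) / ((p : ℝ) - (idx p J).card) := by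
  split_ifs with hk
  · simp [rowStabilizer_mulVec_apply _ x hk]
  -- A transposition of two unshared coordinates lies in the stabilizer, so left invariance makes
  -- all unshared second moments equal. Their sum is deterministic because the norm is preserved and
  -- the shared coordinates are fixed.
  · have hsame : ∀ l ∈ (idx p J)ᶜ,
        ∫ V : rowStabilizer p J, (((V : Orth p) : Matrix (Fin p) (Fin p) ℝ) *ᵥ x) l ^ 2 ∂μ
        = ∫ V : rowStabilizer p J, (((V : Orth p) : Matrix (Fin p) (Fin p) ℝ) *ᵥ x) k ^ 2 ∂μ := by
      intro l hl
      rw [Finset.mem_compl] at hl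
      obtain ⟨U, hU⟩ := exists_rowStabilizer_perm J (Equiv.swap k l) fun i hi =>
        Equiv.swap_apply_of_ne_of_ne (fun h => hk (h ▸ hi)) (fun h => hl (h ▸ hi))
      rw [← integral_mul_left_eq_self (fun V : rowStabilizer p J =>
        (((V : Orth p) : Matrix (Fin p) (Fin p) ℝ) *ᵥ x) k ^ 2) U]
      congr 1
      ext V
      have : ((((U * V : rowStabilizer p J) : Orth p) : Matrix (Fin p) (Fin p) ℝ) *ᵥ x)
          = ((U : Orth p) : Matrix (Fin p) (Fin p) ℝ)
            *ᵥ (((V : Orth p) : Matrix (Fin p) (Fin p) ℝ) *ᵥ x) := by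
        rw [Matrix.mulVec_mulVec]; rfl
      rw [this, hU]
      simp
    have hsum : ∑ l ∈ (idx p J)ᶜ,
        ∫ V : rowStabilizer p J, (((V : Orth p) : Matrix (Fin p) (Fin p) ℝ) *ᵥ x) l ^ 2 ∂μ
        = ∑ i ∈ (idx p J)ᶜ, x i ^ 2 := by
      rw [← integral_finsetSum _ fun l _ => integrable_rowStabilizer_sq J μ x l]
      have : ∀ V : rowStabilizer p J,
          ∑ l ∈ (idx p J)ᶜ, (((V : Orth p) : Matrix (Fin p) (Fin p) ℝ) *ᵥ x) l ^ 2
          = ∑ i ∈ (idx p J)ᶜ, x i ^ 2 := by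
        intro V
        have h1 := Orth.sum_sq_mulVec (V : Orth p) x
        rw [← Finset.sum_add_sum_compl (idx p J), ← Finset.sum_add_sum_compl (idx p J)
          fun i => x i ^ 2, Finset.sum_congr rfl fun i hi => by
            rw [rowStabilizer_mulVec_apply V x hi]] at h1
        linarith
      simp [this]
    have hcard : (((idx p J)ᶜ.card : ℕ) : ℝ) = (p : ℝ) - (idx p J).card := by
      rw [Finset.card_compl, Fintype.card_fin, Nat.cast_sub]
      simpa using Finset.card_le_univ (idx p J)
    have hpos : (0 : ℝ) < (idx p J)ᶜ.card := by
      exact_mod_cast Finset.card_pos.2 ⟨k, Finset.mem_compl.2 hk⟩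
    rw [Finset.sum_congr rfl hsame, Finset.sum_const, nsmul_eq_mul, hcard] at hsum
    rw [hcard] at hpos
    rw [← hsum]
    field_simp

namespace Data

variable {Ω : Type*} [MeasurableSpace Ω] {n n' : ℕ} {Jc : Finset ℕ} {P : Measure Ω}
  {σ : ℝ} {M : Data Ω n n' p Jc}

/-- A sum times an average does not depend on which of the two factors is averaged. So mass spread
evenly against the individual `𝔡_i²` equals the original mass against their mean, and only the bulk
average survives. -/
theorem sum_testWeight_mul (M : Data Ω n n' p Jc) (P : Measure Ω) (x : Fin p → ℝ) :
    ∑ k : Fin p, M.dSq P k * (if k ∈ idx p Jc then x k ^ 2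
        else (∑ i ∈ (idx p Jc)ᶜ, x i ^ 2) / ((p : ℝ) - (idx p Jc).card))
      = ∑ k, testWeight Jc (M.dSq P) (M.dBulkSq P) k * x k ^ 2 := by
  rw [← Finset.sum_add_sum_compl (idx p Jc), ← Finset.sum_add_sum_compl (idx p Jc)
    fun k => testWeight Jc (M.dSq P) (M.dBulkSq P) k * x k ^ 2]
  congr 1
  · refine Finset.sum_congr rfl fun k hk => ?_
    simp [testWeight, hk]
  · have h1 : ∀ k ∈ (idx p Jc)ᶜ, M.dSq P k * (if k ∈ idx p Jc then x k ^ 2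
        else (∑ i ∈ (idx p Jc)ᶜ, x i ^ 2) / ((p : ℝ) - (idx p Jc).card))
        = M.dSq P k * ((∑ i ∈ (idx p Jc)ᶜ, x i ^ 2) / ((p : ℝ) - (idx p Jc).card)) := by
      intro k hk
      rw [if_neg (Finset.mem_compl.1 hk)]
    have h2 : ∀ k ∈ (idx p Jc)ᶜ, testWeight Jc (M.dSq P) (M.dBulkSq P) k * x k ^ 2
        = M.dBulkSq P * x k ^ 2 := by
      intro k hk
      simp [testWeight, Finset.mem_compl.1 hk]
    rw [Finset.sum_congr rfl h1, Finset.sum_congr rfl h2, ← Finset.sum_mul, ← Finset.mul_sum,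
      dBulkSq]
    ring

theorem sum_sq_mulVec_of_isSingularValueMatrix {D : Matrix (Fin n') (Fin p) ℝ}
    (hD : IsSingularValueMatrix D) (y : Fin p → ℝ) :
    ∑ i, (D *ᵥ y) i ^ 2 = ∑ k, (Dᵀ * D) k k * y k ^ 2 := by
  have h : (D *ᵥ y) ⬝ᵥ (D *ᵥ y) = y ⬝ᵥ ((Dᵀ * D) *ᵥ y) := by
    rw [← Matrix.mulVec_mulVec, Matrix.dotProduct_mulVec y, Matrix.vecMul_transpose]
  rw [hD.gram] at h
  simp only [dotProduct, Matrix.mulVec_diagonal, ← sq] at h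
  rw [h]
  exact Finset.sum_congr rfl fun k _ => by ring

/-- Since `D̃ᵀD̃` is diagonal there are no cross terms, and independence of `D̃` and `V` factors
each diagonal one into `𝔡_k²` times a Haar average. -/
theorem IsModel.integral_test_sq [IsProbabilityMeasure P] (h : M.IsModel P σ) (x : Fin p → ℝ) :
    ∫ ω, ∑ i, (M.Dt ω *ᵥ (((M.V ω : Orth p) : Matrix (Fin p) (Fin p) ℝ) *ᵥ x)) i ^ 2 ∂P
      = ∑ k, testWeight Jc (M.dSq P) (M.dBulkSq P) k * x k ^ 2 := by
  have hprob : IsProbabilityMeasure (P.map M.V) :=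
    Measure.isProbabilityMeasure_map h.measurable_V.aemeasurable
  have hhaar := h.haar_V
  have e1 : (fun ω => ∑ i, (M.Dt ω *ᵥ (((M.V ω : Orth p) : Matrix (Fin p) (Fin p) ℝ) *ᵥ x)) i ^ 2)
      =ᵐ[P] fun ω => ∑ k, ((M.Dt ω)ᵀ * M.Dt ω) k k
        * (((M.V ω : Orth p) : Matrix (Fin p) (Fin p) ℝ) *ᵥ x) k ^ 2 := by
    filter_upwards [h.sing_Dt] with ω hω
    exact sum_sq_mulVec_of_isSingularValueMatrix hω _
  have hind : ∀ k, IndepFun (fun ω => ((M.Dt ω)ᵀ * M.Dt ω) k k)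
      (fun ω => (((M.V ω : Orth p) : Matrix (Fin p) (Fin p) ℝ) *ᵥ x) k ^ 2) P := fun k =>
    (h.indep_V.comp ((measurable_rowStabilizer_mulVec Jc x k).pow_const 2)
      ((measurable_gram k).comp measurable_snd)).symm
  have hVi : ∀ k, Integrable (fun ω =>
      (((M.V ω : Orth p) : Matrix (Fin p) (Fin p) ℝ) *ᵥ x) k ^ 2) P := fun k =>
    (integrable_rowStabilizer_sq Jc (P.map M.V) x k).comp_measurable h.measurable_V
  have hint : ∀ k, Integrable (fun ω => ((M.Dt ω)ᵀ * M.Dt ω) k k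
      * (((M.V ω : Orth p) : Matrix (Fin p) (Fin p) ℝ) *ᵥ x) k ^ 2) P := fun k =>
    (hind k).integrable_mul (h.integrable_Dt k) (hVi k)
  rw [integral_congr_ae e1, integral_finsetSum _ fun k _ => hint k, ← sum_testWeight_mul]
  refine Finset.sum_congr rfl fun k _ => ?_
  rw [(hind k).integral_fun_mul_eq_mul_integral (h.integrable_Dt k).1 (hVi k).1]
  have e2 : M.dSq P k = ∫ ω, ((M.Dt ω)ᵀ * M.Dt ω) k k ∂P := by
    rw [dSq, dif_pos k.2]; rfl
  rw [e2, ← integral_rowStabilizer_sq Jc (P.map M.V) x k, integral_map h.measurable_V.aemeasurable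
    ((measurable_rowStabilizer_mulVec Jc x k).pow_const 2).aestronglyMeasurable]

/-- The measurability assumptions are listed separately, without a model, so that the lemma also
applies to coordinate projections on a product space. -/
theorem measurable_training {Ω : Type*} [MeasurableSpace Ω] {M : Data Ω n n' p Jc}
    (hQ : Measurable M.Q) (hD : Measurable M.D)
    (hO : Measurable M.O) (hβ : Measurable M.β') (hε : Measurable M.ε) (Ja : Finset ℕ)
    (α : ℕ → ℝ) : Measurable (M.training Ja α) := by
  have hX : Measurable M.X := measurable_matrix_mul (measurable_matrix_mul
    (measurable_matrix_transpose ((measurable_orth_coe n).comp hQ)) hD)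
    ((measurable_orth_coe p).comp hO)
  have hb : Measurable (M.β Ja α) := by
    refine hβ.add (Finset.measurable_sum _ fun i _ => ?_)
    have hr : Measurable fun ω => (fun j => (M.O ω : Matrix (Fin p) (Fin p) ℝ) i j) :=
      measurable_pi_iff.2 fun j =>
        (measurable_matrix_entry i j).comp ((measurable_orth_coe p).comp hO)
    exact hr.const_smul (√(n : ℝ) * α i)
  exact hX.prodMk (((measurable_mulVec hX hb).add hε).prodMk (hO.prodMk hb))

theorem IsModel.indepFun_test_training (h : M.IsModel P σ) (Ja : Finset ℕ) (α : ℕ → ℝ) :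
    IndepFun (fun ω => (M.Qt ω, M.Dt ω, M.V ω)) (M.training Ja α) P := by
  -- The training data as an explicit function of `(Q, D, O, β', ε)`: the same construction applied
  -- to the coordinate projections, with dummy test variables.
  let N : Data (Orth n × Matrix (Fin n) (Fin p) ℝ × Orth p × (Fin p → ℝ) × (Fin n → ℝ)) n n' p Jc :=
    { Q := fun z => z.1, D := fun z => z.2.1, O := fun z => z.2.2.1, β' := fun z => z.2.2.2.1
      ε := fun z => z.2.2.2.2, Qt := fun _ => 1, Dt := fun _ => 0, V := fun _ => 1 }
  exact h.indep_test.comp measurable_id (measurable_training (M := N) measurable_fst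
    (measurable_fst.comp measurable_snd) (measurable_fst.comp (measurable_snd.comp measurable_snd))
    (measurable_fst.comp (measurable_snd.comp (measurable_snd.comp measurable_snd)))
    (measurable_snd.comp (measurable_snd.comp (measurable_snd.comp measurable_snd))) Ja α)

/-- The values of the training data. -/
abbrev TrainingSpace (n p : ℕ) : Type :=
  Matrix (Fin n) (Fin p) ℝ × (Fin n → ℝ) × Orth p × (Fin p → ℝ)

/-- The test design is `G O` with `G = Q̃ᵀ D̃ V` independent of the training data and `O` one of
their components. So the conditional law is that of `G`, multiplied on the right by the observed
`O`. -/
theorem IsModel.condDistrib_Xt [IsProbabilityMeasure P] (h : M.IsModel P σ) (Ja : Finset ℕ)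
    (α : ℕ → ℝ) :
    ∀ᵐ ω ∂P, condDistrib M.Xt (M.training Ja α) P (M.training Ja α ω)
      = P.map fun ω' => (M.Qt ω' : Matrix (Fin n') (Fin n') ℝ)ᵀ * M.Dt ω'
        * ((M.V ω' : Orth p) : Matrix (Fin p) (Fin p) ℝ) * (M.O ω : Matrix (Fin p) (Fin p) ℝ) := by
  set tr : Ω → TrainingSpace n p := M.training Ja α with htr
  have hT : Measurable tr := measurable_training h.measurable_Q h.measurable_D h.measurable_O
    h.measurable_β' h.measurable_ε Ja α
  set g : Orth n' × Matrix (Fin n') (Fin p) ℝ × rowStabilizer p Jc → Matrix (Fin n') (Fin p) ℝ :=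
    fun z => (z.1 : Matrix (Fin n') (Fin n') ℝ)ᵀ * z.2.1
      * ((z.2.2 : Orth p) : Matrix (Fin p) (Fin p) ℝ) with hg
  have hgm : Measurable g := measurable_matrix_mul (measurable_matrix_mul
    (measurable_matrix_transpose ((measurable_orth_coe n').comp measurable_fst))
    (measurable_fst.comp measurable_snd)) ((measurable_orth_coe p).comp
      (measurable_subtype_coe.comp (measurable_snd.comp measurable_snd)))
  set W := fun ω => (M.Qt ω, M.Dt ω, M.V ω) with hW
  have hWm : Measurable W := h.measurable_Qt.prodMk (h.measurable_Dt.prodMk h.measurable_V)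
  have hGm : Measurable fun ω => g (W ω) := hgm.comp hWm
  set ν := P.map fun ω => g (W ω) with hν
  have hνp : IsProbabilityMeasure ν := Measure.isProbabilityMeasure_map hGm.aemeasurable
  have hmul : Measurable fun z : TrainingSpace n p × Matrix (Fin n') (Fin p) ℝ =>
      z.2 * (z.1.2.2.1 : Matrix (Fin p) (Fin p) ℝ) :=
    measurable_matrix_mul measurable_snd ((measurable_orth_coe p).comp
      (measurable_fst.comp (measurable_snd.comp (measurable_snd.comp measurable_fst))))
  have hXt : ∀ ω, M.Xt ω = g (W ω) * ((tr ω).2.2.1 : Matrix (Fin p) (Fin p) ℝ) := by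
    intro ω
    change _ * (_ * _) = _
    rw [← Matrix.mul_assoc]
    rfl
  have hXtm : Measurable M.Xt := by
    have : M.Xt = fun ω => g (W ω) * ((tr ω).2.2.1 : Matrix (Fin p) (Fin p) ℝ) := funext hXt
    rw [this]
    exact hmul.comp (hT.prodMk hGm)
  -- The candidate for the conditional law. It is shown to disintegrate the joint law, and
  -- uniqueness of disintegrations identifies it with `condDistrib` almost everywhere.
  set κ : Kernel (TrainingSpace n p) (Matrix (Fin n') (Fin p) ℝ) :=
    (Kernel.id ×ₖ Kernel.const (TrainingSpace n p) ν).map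
    fun z => z.2 * (z.1.2.2.1 : Matrix (Fin p) (Fin p) ℝ) with hκ
  have hκp : IsMarkovKernel κ := Kernel.IsMarkovKernel.map _ hmul
  have hκl : ∀ (t : TrainingSpace n p) (f : Matrix (Fin n') (Fin p) ℝ → ℝ≥0∞), Measurable f →
      ∫⁻ A, f A ∂(κ t) = ∫⁻ A, f (A * (t.2.2.1 : Matrix (Fin p) (Fin p) ℝ)) ∂ν := by
    intro t f hf
    have hf1 : Measurable fun z : TrainingSpace n p × Matrix (Fin n') (Fin p) ℝ =>
        f (z.2 * (z.1.2.2.1 : Matrix (Fin p) (Fin p) ℝ)) := hf.comp hmul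
    rw [hκ, Kernel.map_apply _ hmul, lintegral_map hf hmul, Kernel.prod_apply, Kernel.id_apply,
      Kernel.const_apply, lintegral_prod _ hf1.aemeasurable]
    rw [lintegral_dirac' (f := fun t : TrainingSpace n p =>
      ∫⁻ A, f (A * (t.2.2.1 : Matrix (Fin p) (Fin p) ℝ)) ∂ν)]
    exact hf1.lintegral_prod_right
  have hmulO : ∀ O : Orth p, Measurable fun A : Matrix (Fin n') (Fin p) ℝ =>
      A * (O : Matrix (Fin p) (Fin p) ℝ) := fun O =>
    measurable_matrix_mul measurable_id measurable_const
  have hind : IndepFun (fun ω => g (W ω)) tr P :=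
    (h.indepFun_test_training Ja α).comp hgm measurable_id
  have hcomp : P.map (fun ω => (tr ω, M.Xt ω)) = P.map tr ⊗ₘ κ := by
    refine Measure.ext_of_lintegral _ fun f hf => ?_
    have hf2 : Measurable fun z : TrainingSpace n p × Matrix (Fin n') (Fin p) ℝ =>
        f (z.1, z.2 * (z.1.2.2.1 : Matrix (Fin p) (Fin p) ℝ)) :=
      hf.comp (measurable_fst.prodMk hmul)
    have hTp : IsProbabilityMeasure (P.map tr) :=
      Measure.isProbabilityMeasure_map hT.aemeasurable
    rw [Measure.lintegral_compProd hf, lintegral_map hf (hT.prodMk hXtm)]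
    have e1 : ∀ t, ∫⁻ A, f (t, A) ∂(κ t)
        = ∫⁻ A, f (t, A * (t.2.2.1 : Matrix (Fin p) (Fin p) ℝ)) ∂ν := fun t =>
      hκl t (fun A => f (t, A)) (hf.comp measurable_prodMk_left)
    simp_rw [e1, hXt]
    have e2 : ∫⁻ ω, f (tr ω, g (W ω) * ((tr ω).2.2.1 : Matrix (Fin p) (Fin p) ℝ)) ∂P
        = ∫⁻ z, f (z.1, z.2 * (z.1.2.2.1 : Matrix (Fin p) (Fin p) ℝ))
          ∂(P.map fun ω => (tr ω, g (W ω))) := by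
      rw [lintegral_map hf2 (hT.prodMk hGm)]
    rw [e2, (indepFun_iff_map_prod_eq_prod_map_map hT.aemeasurable hGm.aemeasurable).1 hind.symm,
      lintegral_prod _ hf2.aemeasurable]
  have hae := condDistrib_ae_eq_of_measure_eq_compProd tr hXtm.aemeasurable hcomp
  filter_upwards [ae_of_ae_map hT.aemeasurable hae] with ω hω
  rw [hω]
  refine Measure.ext_of_lintegral _ fun f hf => ?_
  have hf1 : Measurable fun A : Matrix (Fin n') (Fin p) ℝ =>
      f (A * ((tr ω).2.2.1 : Matrix (Fin p) (Fin p) ℝ)) := hf.comp (hmulO _)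
  have hm : Measurable fun ω' => g (W ω') * (M.O ω : Matrix (Fin p) (Fin p) ℝ) :=
    (hmulO (M.O ω)).comp hGm
  rw [hκl _ f hf, hν, lintegral_map hf1 hGm]
  exact (lintegral_map hf hm).symm

/-- The conditional risk in closed form. -/
theorem IsModel.risk_eq [IsProbabilityMeasure P] (h : M.IsModel P σ) (Ja : Finset ℕ)
    (α : ℕ → ℝ) :
    ∀ᵐ ω ∂P, ∀ lam, M.risk P Ja α lam ω = 1 / n' * ∑ k,
      testWeight Jc (M.dSq P) (M.dBulkSq P) k * ((M.O ω : Matrix (Fin p) (Fin p) ℝ) *ᵥ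
        (ridge (M.X ω) (M.y Ja α ω) lam - M.β Ja α ω)) k ^ 2 := by
  -- The identity of conditional laws does not involve `lam`, so one null set serves all
  -- regularization strengths.
  filter_upwards [h.condDistrib_Xt Ja α] with ω hω lam
  rw [risk, hω]
  congr 1
  set u := ridge (M.X ω) (M.y Ja α ω) lam with hu
  rw [← h.integral_test_sq]
  have hm : Measurable fun ω' => (M.Qt ω' : Matrix (Fin n') (Fin n') ℝ)ᵀ * M.Dt ω'
        * ((M.V ω' : Orth p) : Matrix (Fin p) (Fin p) ℝ) * (M.O ω : Matrix (Fin p) (Fin p) ℝ) :=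
    measurable_matrix_mul (measurable_matrix_mul (measurable_matrix_mul
      (measurable_matrix_transpose ((measurable_orth_coe n').comp h.measurable_Qt))
      h.measurable_Dt) ((measurable_orth_coe p).comp
        (measurable_subtype_coe.comp h.measurable_V))) measurable_const
  rw [integral_map hm.aemeasurable]
  · congr 1
    ext ω'
    -- The left factor `Q̃ᵀ` is an isometry and does not affect the squared norm.
    rw [← Orth.sum_sq_mulVec (M.Qt ω')⁻¹ (M.Dt ω' *ᵥ _)]
    refine Finset.sum_congr rfl fun i _ => ?_
    rw [← Pi.sub_apply, ← Matrix.mulVec_sub, Matrix.mulVec_mulVec, Matrix.mulVec_mulVec,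
      Matrix.mulVec_mulVec]
    rfl
  · refine Measurable.aestronglyMeasurable (Finset.measurable_sum _ fun i _ => ?_)
    have hv : ∀ v : Fin p → ℝ, Measurable fun A : Matrix (Fin n') (Fin p) ℝ => (A *ᵥ v) i :=
      fun v => measurable_pi_iff.1 (measurable_mulVec measurable_id measurable_const) i
    exact ((hv _).sub (hv _)).pow_const 2

end Data

end Risk

/-! ### Stability of the least squares estimators -/

section LeastSquares

/-- Stability of the least squares slope: if `t = u a + w b + δ` then the slope is close to `w`. -/
theorem abs_olsSlope_sub_le {L : ℕ} [NeZero L] {c B κ u w : ℝ} (hc : 0 < c) (hκ : 0 < κ)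
    {t a b δ : Fin L → ℝ} (ha : ∀ k, c ≤ a k) (ha' : ∀ k, a k ≤ B) (hb : ∀ k, |b k| ≤ B)
    {k₀ : Fin L} (hsep : κ ≤ |b k₀ * a 0 - b 0 * a k₀|)
    (ht : ∀ k, t k = u * a k + w * b k + δ k) :
    |olsSlope t a b - w| ≤ L * (2 / c * (2 * B / c)) / (κ ^ 2 / B ^ 4) * ∑ k, |δ k| := by
  have hB : 0 < B := hc.trans_le ((ha 0).trans (ha' 0))
  have ha0 : ∀ k, 0 < a k := fun k => hc.trans_le (ha k)
  set Δ := ∑ k, |δ k| with hΔ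
  have hδ : ∀ k, |δ k| ≤ Δ := fun k =>
    Finset.single_le_sum (f := fun k => |δ k|) (fun _ _ => abs_nonneg _) (Finset.mem_univ k)
  have hΔ0 : 0 ≤ Δ := Finset.sum_nonneg fun _ _ => abs_nonneg _
  set x : Fin L → ℝ := fun k => b k / a k - b 0 / a 0 with hx
  set d : Fin L → ℝ := fun k => δ k / a k - δ 0 / a 0 with hd
  have hquot : ∀ (y : ℝ) k (C : ℝ), |y| ≤ C → |y / a k| ≤ C / c := by
    intro y k C hy
    rw [abs_div, abs_of_pos (ha0 k)]
    exact div_le_div₀ ((abs_nonneg _).trans hy) hy hc (ha k)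
  have hxb : ∀ k, |x k| ≤ 2 * B / c := fun k => by
    have h1 := hquot _ k B (hb k)
    have h2 := hquot _ 0 B (hb 0)
    calc |x k| ≤ |b k / a k| + |b 0 / a 0| := abs_sub _ _
      _ ≤ B / c + B / c := add_le_add h1 h2
      _ = 2 * B / c := by ring
  have hdb : ∀ k, |d k| ≤ 2 / c * Δ := fun k => by
    have h1 := hquot _ k Δ (hδ k)
    have h2 := hquot _ 0 Δ (hδ 0)
    calc |d k| ≤ |δ k / a k| + |δ 0 / a 0| := abs_sub _ _
      _ ≤ Δ / c + Δ / c := add_le_add h1 h2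
      _ = 2 / c * Δ := by ring
  -- A single grid point `k₀` whose coefficient vector is not parallel to that of index `0` already
  -- keeps the denominator away from zero.
  have hden : κ ^ 2 / B ^ 4 ≤ ∑ k, x k ^ 2 := by
    have h1 : x k₀ = (b k₀ * a 0 - b 0 * a k₀) / (a k₀ * a 0) := by
      simp only [hx]
      have := (ha0 k₀).ne'
      have := (ha0 0).ne'
      field_simp
    have h2 : κ / B ^ 2 ≤ |x k₀| := by
      rw [h1, abs_div, abs_of_pos (mul_pos (ha0 _) (ha0 _))]
      refine div_le_div₀ (abs_nonneg _) hsep (mul_pos (ha0 _) (ha0 _)) ?_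
      rw [sq]
      exact mul_le_mul (ha' _) (ha' _) (ha0 _).le hB.le
    calc κ ^ 2 / B ^ 4 = (κ / B ^ 2) ^ 2 := by rw [div_pow]; ring
      _ ≤ |x k₀| ^ 2 := pow_le_pow_left₀ (by positivity) h2 2
      _ = x k₀ ^ 2 := sq_abs _
      _ ≤ _ := Finset.single_le_sum (f := fun k => x k ^ 2) (fun _ _ => sq_nonneg _)
        (Finset.mem_univ k₀)
  have hden0 : 0 < ∑ k, x k ^ 2 := lt_of_lt_of_le (by positivity) hden
  -- After division by `a k`, subtracting the equation of index `0` cancels `u` and leaves `w * x k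
  -- + d k`.
  have hkey : olsSlope t a b - w = (∑ k, d k * x k) / ∑ k, x k ^ 2 := by
    rw [olsSlope, div_sub' hden0.ne']
    congr 1
    rw [mul_comm, Finset.mul_sum, ← Finset.sum_sub_distrib]
    refine Finset.sum_congr rfl fun k _ => ?_
    simp only [hx, hd, ht]
    have := (ha0 k).ne'
    have := (ha0 0).ne'
    field_simp
    ring
  rw [hkey, abs_div, abs_of_pos hden0]
  calc |∑ k, d k * x k| / ∑ k, x k ^ 2
      ≤ (∑ k, |d k * x k|) / (κ ^ 2 / B ^ 4) :=
        div_le_div₀ (Finset.sum_nonneg fun _ _ => abs_nonneg _)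
          (Finset.abs_sum_le_sum_abs _ _) (by positivity) hden
    _ ≤ (∑ _k : Fin L, 2 / c * Δ * (2 * B / c)) / (κ ^ 2 / B ^ 4) := by
        gcongr with k
        rw [abs_mul]
        exact mul_le_mul (hdb k) (hxb k) (abs_nonneg _) (by positivity)
    _ = _ := by simp; ring

/-- Quantitative linear independence of the two regression coefficients at different
regularization strengths, in terms of the spread of the spectrum. -/
theorem sum_sq_sub_le_abs_det {ι : Type*} [Fintype ι] {s : ι → ℝ} {C lam μ G g₀ : ℝ}
    (hs : ∀ i, 0 ≤ s i) (hsC : ∀ i, s i ≤ C) (hg₀ : 0 < g₀) (hl : g₀ ≤ lam) (hμ : g₀ ≤ μ)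
    (hlG : lam ≤ G) (hμG : μ ≤ G) :
    |μ - lam| * (g₀ ^ 2 / (C + G) ^ 8) * ∑ i, ∑ j, (s i - s j) ^ 2
      ≤ |(∑ i, 1 / (s i + lam) ^ 2) * (∑ i, s i / (s i + μ) ^ 2)
        - (∑ i, 1 / (s i + μ) ^ 2) * ∑ i, s i / (s i + lam) ^ 2| := by
  have hl0 : 0 < lam := hg₀.trans_le hl
  have hμ0 : 0 < μ := hg₀.trans_le hμ
  set R : ι → ι → ℝ := fun i j => ((s j + lam) * (s i + μ) + (s i + lam) * (s j + μ))
    / ((s i + lam) ^ 2 * (s j + μ) ^ 2 * ((s j + lam) ^ 2 * (s i + μ) ^ 2)) with hR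
  -- Symmetrizing the double sum in `(i, j)` gives a Lagrange-type identity: each pair contributes
  -- `(s j - s i)` times a difference of squares that contains the factor `(μ - lam) * (s j - s i)`.
  -- So all pairs have the same sign.
  have hdet : (∑ i, 1 / (s i + lam) ^ 2) * (∑ i, s i / (s i + μ) ^ 2)
        - (∑ i, 1 / (s i + μ) ^ 2) * ∑ i, s i / (s i + lam) ^ 2
      = (μ - lam) / 2 * ∑ i, ∑ j, (s i - s j) ^ 2 * R i j := by
    have h1 : (∑ i, 1 / (s i + lam) ^ 2) * (∑ i, s i / (s i + μ) ^ 2)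
        - (∑ i, 1 / (s i + μ) ^ 2) * ∑ i, s i / (s i + lam) ^ 2
        = ∑ i, ∑ j, (1 / (s i + lam) ^ 2 * (s j / (s j + μ) ^ 2)
          - 1 / (s i + μ) ^ 2 * (s j / (s j + lam) ^ 2)) := by
      rw [Finset.sum_mul_sum, Finset.sum_mul_sum, ← Finset.sum_sub_distrib]
      simp_rw [← Finset.sum_sub_distrib]
    have h2 : ∑ i, ∑ j, (1 / (s i + lam) ^ 2 * (s j / (s j + μ) ^ 2)
          - 1 / (s i + μ) ^ 2 * (s j / (s j + lam) ^ 2))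
        = ∑ i, ∑ j, (1 / (s j + lam) ^ 2 * (s i / (s i + μ) ^ 2)
          - 1 / (s j + μ) ^ 2 * (s i / (s i + lam) ^ 2)) := Finset.sum_comm
    have h3 : ∀ X Y : ℝ, X = Y → X = (X + Y) / 2 := fun X Y h => by rw [h]; ring
    rw [h1, h3 _ _ h2, ← Finset.sum_add_distrib, Finset.mul_sum, Finset.sum_div]
    refine Finset.sum_congr rfl fun i _ => ?_
    rw [← Finset.sum_add_distrib, Finset.mul_sum, Finset.sum_div]
    refine Finset.sum_congr rfl fun j _ => ?_
    have e1 : s i + lam ≠ 0 := by have := hs i; positivity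
    have e2 : s j + lam ≠ 0 := by have := hs j; positivity
    have e3 : s i + μ ≠ 0 := by have := hs i; positivity
    have e4 : s j + μ ≠ 0 := by have := hs j; positivity
    simp only [hR]
    field_simp
    ring
  have hRlow : ∀ i j, 2 * (g₀ ^ 2 / (C + G) ^ 8) ≤ R i j := by
    intro i j
    have a1 : g₀ ≤ s i + lam := by have := hs i; linarith
    have a2 : g₀ ≤ s j + lam := by have := hs j; linarith
    have a3 : g₀ ≤ s i + μ := by have := hs i; linarith
    have a4 : g₀ ≤ s j + μ := by have := hs j; linarith
    have b1 : s i + lam ≤ C + G := add_le_add (hsC i) hlG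
    have b2 : s j + lam ≤ C + G := add_le_add (hsC j) hlG
    have b3 : s i + μ ≤ C + G := add_le_add (hsC i) hμG
    have b4 : s j + μ ≤ C + G := add_le_add (hsC j) hμG
    have p1 := hg₀.trans_le a1
    have p2 := hg₀.trans_le a2
    have p3 := hg₀.trans_le a3
    have p4 := hg₀.trans_le a4
    simp only [hR]
    rw [← mul_div_assoc]
    refine div_le_div₀ (by positivity) ?_ (by positivity) ?_
    · have := mul_le_mul a2 a3 hg₀.le p2.le
      have := mul_le_mul a1 a4 hg₀.le p1.le
      nlinarith
    · calc (s i + lam) ^ 2 * (s j + μ) ^ 2 * ((s j + lam) ^ 2 * (s i + μ) ^ 2)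
          ≤ (C + G) ^ 2 * (C + G) ^ 2 * ((C + G) ^ 2 * (C + G) ^ 2) := by gcongr
        _ = (C + G) ^ 8 := by ring
  rw [hdet, abs_mul, abs_div, abs_of_pos (two_pos : (0 : ℝ) < 2)]
  calc |μ - lam| * (g₀ ^ 2 / (C + G) ^ 8) * ∑ i, ∑ j, (s i - s j) ^ 2
      = |μ - lam| / 2 * ∑ i, ∑ j, (s i - s j) ^ 2 * (2 * (g₀ ^ 2 / (C + G) ^ 8)) := by
        simp_rw [← Finset.sum_mul]; ring
    _ ≤ |μ - lam| / 2 * ∑ i, ∑ j, (s i - s j) ^ 2 * R i j := by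
        gcongr with i _ j _
        exact hRlow i j
    _ ≤ _ := by
        gcongr
        exact le_abs_self _

/-- Uniform bounds on the regression coefficients for a spectrum that does not degenerate. -/
theorem exists_coef_bounds {L : ℕ} [NeZero L] {g : Fin L → ℝ} (hg : ∀ k, 0 < g k) {k₀ : Fin L}
    (hk₀ : g k₀ ≠ g 0) {C v γ : ℝ} (hC : 0 < C) (hv : 0 < v) (hγ : 0 < γ) :
    ∃ c B κ : ℝ, 0 < c ∧ 0 < κ ∧ ∀ {ι : Type} [Fintype ι] (s : ι → ℝ) (n γ' : ℝ), 0 < n →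
      (Fintype.card ι : ℝ) ≤ n → γ / 2 ≤ γ' → γ' ≤ 2 * γ → (∀ i, 0 ≤ s i) → (∀ i, s i ≤ C) →
      (∀ x, 0 ≤ x → x ≤ C → v * n ≤ ∑ i, (s i - x) ^ 2) →
      (∀ k, c ≤ coefA γ' s (g k) ∧ coefA γ' s (g k) ≤ B ∧ c ≤ coefB s (g k) ∧ coefB s (g k) ≤ B)
      ∧ κ ≤ |coefB s (g k₀) * coefA γ' s (g 0) - coefB s (g 0) * coefA γ' s (g k₀)| := by
  obtain ⟨kmin, -, hmin⟩ := Finset.exists_min_image Finset.univ g ⟨0, Finset.mem_univ _⟩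
  obtain ⟨kmax, -, hmax⟩ := Finset.exists_max_image Finset.univ g ⟨0, Finset.mem_univ _⟩
  set g₀ := g kmin with hg₀d
  set G := g kmax with hGd
  have hg₀ : 0 < g₀ := hg kmin
  have hlow : ∀ k, g₀ ≤ g k := fun k => hmin k (Finset.mem_univ k)
  have hup : ∀ k, g k ≤ G := fun k => hmax k (Finset.mem_univ k)
  have hG : 0 < G := hg kmax
  refine ⟨min (g₀ ^ 2 / (2 * γ) * (v / C / (C + G) ^ 2)) (g₀ ^ 2 * (1 / (C + G) ^ 2)),
    max (G ^ 2 / (γ / 2) * (1 / g₀)) (G ^ 2 * (1 / g₀ ^ 2)),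
    g₀ ^ 2 * (g₀ ^ 2 / (2 * γ)) * (|g k₀ - g 0| * (g₀ ^ 2 / (C + G) ^ 8) * v),
    lt_min (by positivity) (by positivity), ?_, ?_⟩
  · have : 0 < |g k₀ - g 0| := abs_pos.2 (sub_ne_zero.2 hk₀)
    positivity
  intro ι _ s n γ' hn hcard hγ1 hγ2 hs hsC hspread
  have hγ' : 0 < γ' := by linarith
  set m : ℝ := (Fintype.card ι : ℝ) with hm
  -- The spread about `0` bounds the total spectrum from below, which keeps the signal coefficient
  -- positive and the index set nonempty.
  have hsumsq : v * n ≤ ∑ i, s i ^ 2 := by simpa using hspread 0 le_rfl hC.le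
  have hsum : v / C * n ≤ ∑ i, s i := by
    rw [div_mul_eq_mul_div, div_le_iff₀ hC, Finset.sum_mul]
    refine hsumsq.trans (Finset.sum_le_sum fun i _ => ?_)
    rw [sq]
    exact mul_le_mul_of_nonneg_left (hsC i) (hs i)
  have hm0 : 0 < m := by
    rw [hm]
    have : 0 < ∑ i, s i := lt_of_lt_of_le (by positivity) hsum
    by_contra h
    have h0 : Fintype.card ι = 0 := by
      have : (Fintype.card ι : ℝ) = 0 := le_antisymm (not_lt.1 h) (Nat.cast_nonneg _)
      exact_mod_cast this
    have := Fintype.card_eq_zero_iff.1 h0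
    simp at *
  have hpos : ∀ k i, 0 < s i + g k := fun k i => by have := hs i; have := hg k; positivity
  have hA1 : ∀ k, v / C / (C + G) ^ 2 ≤ (∑ i, s i / (s i + g k) ^ 2) / m := by
    intro k
    rw [le_div_iff₀ hm0]
    calc v / C / (C + G) ^ 2 * m ≤ v / C / (C + G) ^ 2 * n := by gcongr
      _ = v / C * n / (C + G) ^ 2 := by ring
      _ ≤ (∑ i, s i) / (C + G) ^ 2 := by gcongr
      _ = ∑ i, s i / (C + G) ^ 2 := Finset.sum_div _ _ _
      _ ≤ _ := Finset.sum_le_sum fun i _ => by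
        refine div_le_div_of_nonneg_left (hs i) (pow_pos (hpos k i) 2) ?_
        exact pow_le_pow_left₀ (hpos k i).le (add_le_add (hsC i) (hup k)) 2
  have hA2 : ∀ k, (∑ i, s i / (s i + g k) ^ 2) / m ≤ 1 / g₀ := by
    intro k
    rw [div_le_iff₀ hm0]
    calc ∑ i, s i / (s i + g k) ^ 2 ≤ ∑ _i : ι, 1 / g₀ := Finset.sum_le_sum fun i _ => by
          rw [div_le_div_iff₀ (pow_pos (hpos k i) 2) hg₀]
          have h1 : s i ≤ s i + g k := by linarith [hg k]
          have h2 : g₀ ≤ s i + g k := by linarith [hs i, hlow k]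
          nlinarith [mul_le_mul h1 h2 hg₀.le (hpos k i).le]
      _ = _ := by simp [hm, mul_comm]
  have hB1 : ∀ k, 1 / (C + G) ^ 2 ≤ (∑ i, 1 / (s i + g k) ^ 2) / m := by
    intro k
    rw [le_div_iff₀ hm0]
    calc 1 / (C + G) ^ 2 * m = ∑ _i : ι, 1 / (C + G) ^ 2 := by simp [hm, mul_comm]
      _ ≤ _ := Finset.sum_le_sum fun i _ => by
        refine one_div_le_one_div_of_le (pow_pos (hpos k i) 2) ?_
        exact pow_le_pow_left₀ (hpos k i).le (add_le_add (hsC i) (hup k)) 2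
  have hB2 : ∀ k, (∑ i, 1 / (s i + g k) ^ 2) / m ≤ 1 / g₀ ^ 2 := by
    intro k
    rw [div_le_iff₀ hm0]
    calc ∑ i, 1 / (s i + g k) ^ 2 ≤ ∑ _i : ι, 1 / g₀ ^ 2 := Finset.sum_le_sum fun i _ => by
          refine one_div_le_one_div_of_le (pow_pos hg₀ 2) ?_
          exact pow_le_pow_left₀ hg₀.le (by linarith [hs i, hlow k]) 2
      _ = _ := by simp [hm, mul_comm]
  simp only [fun k => coefA_eq γ' s hs (hg k), fun k => coefB_eq s hs (hg k)]
  rw [← hm]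
  have hA0 : ∀ k, 0 ≤ (∑ i, s i / (s i + g k) ^ 2) / m := fun k =>
    (by positivity : (0 : ℝ) ≤ v / C / (C + G) ^ 2).trans (hA1 k)
  have hB0 : ∀ k, 0 ≤ (∑ i, 1 / (s i + g k) ^ 2) / m := fun k =>
    (by positivity : (0 : ℝ) ≤ 1 / (C + G) ^ 2).trans (hB1 k)
  have hgk : ∀ k, g₀ ^ 2 ≤ g k ^ 2 := fun k => pow_le_pow_left₀ hg₀.le (hlow k) 2
  have hgk' : ∀ k, g k ^ 2 ≤ G ^ 2 := fun k => pow_le_pow_left₀ (hg k).le (hup k) 2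
  refine ⟨fun k => ⟨?_, ?_, ?_, ?_⟩, ?_⟩
  · refine (min_le_left _ _).trans (mul_le_mul ?_ (hA1 k) (by positivity) (by positivity))
    exact div_le_div₀ (sq_nonneg _) (hgk k) hγ' hγ2
  · refine le_trans (mul_le_mul ?_ (hA2 k) (hA0 k) (by positivity)) (le_max_left _ _)
    exact div_le_div₀ (sq_nonneg _) (hgk' k) (by positivity) hγ1
  · exact (min_le_right _ _).trans (mul_le_mul (hgk k) (hB1 k) (by positivity) (by positivity))
  · exact le_trans (mul_le_mul (hgk' k) (hB2 k) (hB0 k) (by positivity)) (le_max_right _ _)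
  · have hdet := sum_sq_sub_le_abs_det hs hsC hg₀ (hlow k₀) (hlow 0) (hup k₀) (hup 0)
    -- The spread hypothesis is applied about each `s i` in turn, which is why it is required for
    -- every centre in `[0, C]`.
    have hss : m * (v * n) ≤ ∑ i, ∑ j, (s i - s j) ^ 2 := by
      calc m * (v * n) = ∑ _i : ι, v * n := by simp [hm]
        _ ≤ _ := Finset.sum_le_sum fun i _ => by
          refine (hspread (s i) (hs i) (hsC i)).trans (le_of_eq ?_)
          exact Finset.sum_congr rfl fun j _ => by ring
    set F := ∑ i, 1 / (s i + g k₀) ^ 2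
    set F' := ∑ i, 1 / (s i + g 0) ^ 2
    set A := ∑ i, s i / (s i + g k₀) ^ 2
    set A' := ∑ i, s i / (s i + g 0) ^ 2
    have e : g k₀ ^ 2 * (F / m) * (g 0 ^ 2 / γ' * (A' / m))
        - g 0 ^ 2 * (F' / m) * (g k₀ ^ 2 / γ' * (A / m))
        = g k₀ ^ 2 * (g 0 ^ 2 / γ') * ((F * A' - F' * A) / m ^ 2) := by
      field_simp
    have hcoef : 0 ≤ g k₀ ^ 2 * (g 0 ^ 2 / γ') := by positivity
    rw [e, abs_mul, abs_of_nonneg hcoef, abs_div, abs_of_pos (by positivity : 0 < m ^ 2)]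
    refine mul_le_mul ?_ ?_ (by positivity) hcoef
    · exact mul_le_mul (hgk k₀) (div_le_div₀ (sq_nonneg _) (hgk 0) hγ' hγ2) (by positivity)
        (by positivity)
    · rw [le_div_iff₀ (by positivity : 0 < m ^ 2), abs_sub_comm (g k₀)]
      refine le_trans ?_ hdet
      calc |g 0 - g k₀| * (g₀ ^ 2 / (C + G) ^ 8) * v * m ^ 2
          = |g 0 - g k₀| * (g₀ ^ 2 / (C + G) ^ 8) * (m * (v * m)) := by ring
        _ ≤ |g 0 - g k₀| * (g₀ ^ 2 / (C + G) ^ 8) * (m * (v * n)) := by gcongr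
        _ ≤ _ := by gcongr

end LeastSquares

/-! ### Deterministic bounds: shrinkage factors, risk comparison, uniformity in `λ` -/

section Deterministic

/-- The factor by which ridge regression shrinks the signal error. -/
noncomputable def biasFactor (lam s : ℝ) : ℝ := lam / (s + lam)

/-- The factor by which ridge regression passes on the noise. -/
noncomputable def noiseFactor (lam s : ℝ) : ℝ := √s / (s + lam)

theorem biasFactor_nonneg {lam s : ℝ} (hl : 0 < lam) (hs : 0 ≤ s) : 0 ≤ biasFactor lam s := by
  unfold biasFactor; positivity

theorem biasFactor_le_one {lam s : ℝ} (hl : 0 < lam) (hs : 0 ≤ s) : biasFactor lam s ≤ 1 := by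
  unfold biasFactor
  rw [div_le_one (by positivity)]
  linarith

theorem noiseFactor_nonneg {lam s : ℝ} (hl : 0 < lam) (hs : 0 ≤ s) : 0 ≤ noiseFactor lam s := by
  unfold noiseFactor; positivity

theorem biasFactor_sq (lam s : ℝ) : biasFactor lam s ^ 2 = lam ^ 2 / (s + lam) ^ 2 := by
  rw [biasFactor, div_pow]

theorem noiseFactor_sq {s : ℝ} (hs : 0 ≤ s) (lam : ℝ) :
    noiseFactor lam s ^ 2 = s / (s + lam) ^ 2 := by
  rw [noiseFactor, div_pow, Real.sq_sqrt hs]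

/-- The square is at most `1 / l`; the bound `1 + 1 / l` on the root avoids a square root in later
constants. -/
theorem noiseFactor_le {l lam s : ℝ} (hl : 0 < l) (hlam : l ≤ lam) (hs : 0 ≤ s) :
    noiseFactor lam s ≤ 1 + 1 / l := by
  have hlam0 : 0 < lam := hl.trans_le hlam
  have h1 : noiseFactor lam s ^ 2 ≤ 1 / l := by
    rw [noiseFactor_sq hs, div_le_div_iff₀ (by positivity) hl]
    nlinarith
  have h2 : (0 : ℝ) < 1 / l := by positivity
  nlinarith [noiseFactor_nonneg hlam0 hs]

theorem abs_biasFactor_sub_le {l lam μ s : ℝ} (hl : 0 < l) (hlam : l ≤ lam) (hμ : l ≤ μ)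
    (hs : 0 ≤ s) : |biasFactor lam s - biasFactor μ s| ≤ |lam - μ| / l := by
  have h1 : 0 < s + lam := by linarith
  have h2 : 0 < s + μ := by linarith
  have e : biasFactor lam s - biasFactor μ s = (lam - μ) * (s / (s + lam) / (s + μ)) := by
    unfold biasFactor; field_simp; ring
  rw [e, abs_mul, abs_of_nonneg (by positivity : 0 ≤ s / (s + lam) / (s + μ)),
    div_eq_mul_one_div |lam - μ|]
  refine mul_le_mul_of_nonneg_left ?_ (abs_nonneg _)
  have h3 : s / (s + lam) ≤ 1 := by rw [div_le_one h1]; linarith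
  have h4 : l ≤ s + μ := by linarith
  exact div_le_div₀ zero_le_one h3 hl h4

theorem abs_noiseFactor_sub_le {l lam μ s : ℝ} (hl : 0 < l) (hlam : l ≤ lam) (hμ : l ≤ μ)
    (hs : 0 ≤ s) : |noiseFactor lam s - noiseFactor μ s| ≤ (1 + 1 / l) * |lam - μ| / l := by
  have h1 : 0 < s + lam := by linarith
  have h2 : 0 < s + μ := by linarith
  have e : noiseFactor lam s - noiseFactor μ s = -(lam - μ) * (noiseFactor lam s / (s + μ)) := by
    unfold noiseFactor; field_simp; ring
  have h0 := noiseFactor_nonneg (hl.trans_le hlam) hs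
  rw [e, abs_mul, abs_neg, abs_of_nonneg (by positivity : 0 ≤ noiseFactor lam s / (s + μ)),
    mul_comm (1 + 1 / l), mul_div_assoc]
  refine mul_le_mul_of_nonneg_left ?_ (abs_nonneg _)
  exact div_le_div₀ (by positivity) (noiseFactor_le hl hlam hs) hl (by linarith)

/-- The fluctuation of the conditional risk on the components outside `J`. -/
noncomputable def riskFluctuation {p : ℕ} (J : Finset (Fin p)) (w s b e : Fin p → ℝ) (u v lam : ℝ) :
    ℝ :=
  ∑ i, (if i ∈ J then 0 else w i) * (biasFactor lam (s i) ^ 2 * (b i ^ 2 - u)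
    - 2 * (biasFactor lam (s i) * noiseFactor lam (s i)) * (b i * e i)
    + noiseFactor lam (s i) ^ 2 * (e i ^ 2 - v))

theorem abs_mul_sub_mul_le {x x' y y' A B dx dy : ℝ} (h1 : |x'| ≤ A) (h2 : |y| ≤ B)
    (h3 : |x - x'| ≤ dx) (h4 : |y - y'| ≤ dy) : |x * y - x' * y'| ≤ dx * B + A * dy := by
  have e : x * y - x' * y' = (x - x') * y + x' * (y - y') := by ring
  rw [e]
  refine (abs_add_le _ _).trans ?_
  rw [abs_mul, abs_mul]
  exact add_le_add (mul_le_mul h3 h2 (abs_nonneg _) ((abs_nonneg _).trans h3))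
    (mul_le_mul h1 h4 (abs_nonneg _) ((abs_nonneg _).trans h1))

/-- The products `f²`, `fk` and `k²` each move by at most `2κ²q`, and the random factors are
dominated by sums of squares. -/
theorem abs_fluctuation_term_sub_le {f f' k k' b e u v κ q : ℝ} (hκ : 1 ≤ κ) (hq : 0 ≤ q)
    (hf : |f| ≤ 1) (hf' : |f'| ≤ 1) (hk : |k| ≤ κ) (hk' : |k'| ≤ κ) (df : |f - f'| ≤ q)
    (dk : |k - k'| ≤ κ * q) (hu : 0 ≤ u) (hv : 0 ≤ v) :
    |(f ^ 2 * (b ^ 2 - u) - 2 * (f * k) * (b * e) + k ^ 2 * (e ^ 2 - v))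
      - (f' ^ 2 * (b ^ 2 - u) - 2 * (f' * k') * (b * e) + k' ^ 2 * (e ^ 2 - v))|
      ≤ 2 * κ ^ 2 * q * (2 * b ^ 2 + 2 * e ^ 2 + (u + v)) := by
  have hκ2 : κ ≤ κ ^ 2 := by rw [sq]; exact le_mul_of_one_le_left (by linarith) hκ
  have hκq : κ * q ≤ κ ^ 2 * q := mul_le_mul_of_nonneg_right hκ2 hq
  have hqq : q ≤ κ ^ 2 * q := le_mul_of_one_le_left hq (hκ.trans hκ2)
  have hΛ0 : 0 ≤ 2 * κ ^ 2 * q := by positivity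
  have dff : |f * f - f' * f'| ≤ 2 * κ ^ 2 * q :=
    (abs_mul_sub_mul_le hf' hf df df).trans (by linarith)
  have dfk : |f * k - f' * k'| ≤ 2 * κ ^ 2 * q :=
    (abs_mul_sub_mul_le hf' hk df dk).trans (by linarith)
  have dkk : |k * k - k' * k'| ≤ 2 * κ ^ 2 * q :=
    (abs_mul_sub_mul_le hk' hk dk dk).trans (le_of_eq (by ring))
  have e1 : (f ^ 2 * (b ^ 2 - u) - 2 * (f * k) * (b * e) + k ^ 2 * (e ^ 2 - v))
      - (f' ^ 2 * (b ^ 2 - u) - 2 * (f' * k') * (b * e) + k' ^ 2 * (e ^ 2 - v))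
      = (f * f - f' * f') * (b ^ 2 - u) + (f * k - f' * k') * (-(2 * (b * e)))
        + (k * k - k' * k') * (e ^ 2 - v) := by ring
  rw [e1]
  have g1 : |b ^ 2 - u| ≤ b ^ 2 + u := by
    rw [abs_le]; constructor <;> linarith [sq_nonneg b]
  have g2 : |-(2 * (b * e))| ≤ b ^ 2 + e ^ 2 := by
    rw [abs_le]; constructor <;> linarith [sq_nonneg (b - e), sq_nonneg (b + e)]
  have g3 : |e ^ 2 - v| ≤ e ^ 2 + v := by
    rw [abs_le]; constructor <;> linarith [sq_nonneg e]
  have t1 := mul_le_mul dff g1 (abs_nonneg _) hΛ0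
  have t2 := mul_le_mul dfk g2 (abs_nonneg _) hΛ0
  have t3 := mul_le_mul dkk g3 (abs_nonneg _) hΛ0
  rw [← abs_mul] at t1 t2 t3
  calc _ ≤ 2 * κ ^ 2 * q * (b ^ 2 + u) + 2 * κ ^ 2 * q * (b ^ 2 + e ^ 2)
        + 2 * κ ^ 2 * q * (e ^ 2 + v) :=
        (abs_add_le _ _).trans (add_le_add ((abs_add_le _ _).trans (add_le_add t1 t2)) t3)
    _ = _ := by ring

/-- The Lipschitz constant is proportional to the total energy of signal and noise. That energy is
of order `n`, so after division by `n` the fluctuations are equi-Lipschitz in `lam`. -/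
theorem abs_riskFluctuation_sub_le {p : ℕ} (J : Finset (Fin p)) {w s b e : Fin p → ℝ}
    {u v l lam μ W : ℝ} (hl : 0 < l) (hlam : l ≤ lam) (hμ : l ≤ μ) (hs : ∀ i, 0 ≤ s i)
    (hw : ∀ i, |w i| ≤ W) (hu : 0 ≤ u) (hv : 0 ≤ v) :
    |riskFluctuation J w s b e u v lam - riskFluctuation J w s b e u v μ|
      ≤ W * (2 * (1 + 1 / l) ^ 2 / l) * |lam - μ|
        * (2 * ∑ i, b i ^ 2 + 2 * ∑ i, e i ^ 2 + p * (u + v)) := by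
  have hlam0 : 0 < lam := hl.trans_le hlam
  have hμ0 : 0 < μ := hl.trans_le hμ
  have hf : ∀ {t} (_ : 0 < t) i, |biasFactor t (s i)| ≤ 1 := fun ht i => by
    rw [abs_of_nonneg (biasFactor_nonneg ht (hs i))]; exact biasFactor_le_one ht (hs i)
  have hk : ∀ {t} (_ : l ≤ t) i, |noiseFactor t (s i)| ≤ 1 + 1 / l := fun ht i => by
    rw [abs_of_nonneg (noiseFactor_nonneg (hl.trans_le ht) (hs i))]
    exact noiseFactor_le hl ht (hs i)
  have hκ1 : 1 ≤ 1 + 1 / l := le_add_of_nonneg_right (by positivity)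
  have hwi : ∀ i, |if i ∈ J then 0 else w i| ≤ W := fun i => by
    split_ifs
    · rw [abs_zero]; exact (abs_nonneg _).trans (hw i)
    · exact hw i
  rw [riskFluctuation, riskFluctuation, ← Finset.sum_sub_distrib]
  refine (Finset.abs_sum_le_sum_abs _ _).trans ?_
  calc _ ≤ ∑ i, W * (2 * (1 + 1 / l) ^ 2 * (|lam - μ| / l)
        * (2 * b i ^ 2 + 2 * e i ^ 2 + (u + v))) := Finset.sum_le_sum fun i _ => by
          rw [← mul_sub, abs_mul]
          exact mul_le_mul (hwi i) (abs_fluctuation_term_sub_le hκ1 (by positivity) (hf hlam0 i)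
            (hf hμ0 i) (hk hlam i) (hk hμ i) (abs_biasFactor_sub_le hl hlam hμ (hs i))
            ((abs_noiseFactor_sub_le hl hlam hμ (hs i)).trans (le_of_eq (mul_div_assoc _ _ _)))
            hu hv) (abs_nonneg _) ((abs_nonneg _).trans (hwi i))
    _ = _ := by
        rw [← Finset.mul_sum, ← Finset.mul_sum, Finset.sum_add_distrib, Finset.sum_add_distrib,
          ← Finset.mul_sum, ← Finset.mul_sum, Finset.sum_const, Finset.card_univ,
          Fintype.card_fin, nsmul_eq_mul]
        ring

/-- Comparison of the estimated risk with the conditional risk. -/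
theorem abs_estimate_sub_risk_le {p : ℕ} (J : Finset (Fin p)) {w w' s b e θ x y : Fin p → ℝ}
    {u v u' v' lam κ η W : ℝ} (hl : 0 < lam) (hs : ∀ i, 0 ≤ s i)
    (hκ : ∀ i, noiseFactor lam (s i) ^ 2 ≤ κ) (hw : ∀ i, |w i| ≤ W)
    (hη : ∀ i, |w' i - w i| ≤ η) (hθ : ∀ i, i ∉ J → θ i = b i) (hx : ∀ i, 0 ≤ x i)
    (hy : ∀ i ∈ J, |(u + x i) * biasFactor lam (s i) ^ 2 + v * noiseFactor lam (s i) ^ 2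
      - (-(biasFactor lam (s i) * θ i) + noiseFactor lam (s i) * e i) ^ 2| ≤ y i) :
    |∑ i, w' i * ((u' + if i ∈ J then x i else 0) * biasFactor lam (s i) ^ 2
        + v' * noiseFactor lam (s i) ^ 2)
      - ∑ i, w i * (-(biasFactor lam (s i) * θ i) + noiseFactor lam (s i) * e i) ^ 2|
      ≤ η * (p * (|u'| + |v'| * κ) + ∑ i ∈ J, x i) + W * (p * (|u' - u| + κ * |v' - v|))
        + W * ∑ i ∈ J, y i + |riskFluctuation J w s b e u v lam| := by
  have hf0 : ∀ i, 0 ≤ biasFactor lam (s i) ^ 2 := fun i => sq_nonneg _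
  have hf1 : ∀ i, biasFactor lam (s i) ^ 2 ≤ 1 := fun i =>
    pow_le_one₀ (biasFactor_nonneg hl (hs i)) (biasFactor_le_one hl (hs i))
  have hk0 : ∀ i, 0 ≤ noiseFactor lam (s i) ^ 2 := fun i => sq_nonneg _
  set E : Fin p → ℝ := fun i => (u' + if i ∈ J then x i else 0) * biasFactor lam (s i) ^ 2
        + v' * noiseFactor lam (s i) ^ 2 with hE
  set Z : Fin p → ℝ := fun i => (u + x i) * biasFactor lam (s i) ^ 2 + v * noiseFactor lam (s i) ^ 2
      - (-(biasFactor lam (s i) * θ i) + noiseFactor lam (s i) * e i) ^ 2 with hZ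
  -- Four sources of error: the test weights, the estimates of `u` and `v`, the aligned components,
  -- and the random fluctuation of the others.
  have hsplit : ∑ i, w' i * E i
      - ∑ i, w i * (-(biasFactor lam (s i) * θ i) + noiseFactor lam (s i) * e i) ^ 2
      = ∑ i, (w' i - w i) * E i
        + ∑ i, w i * ((u' - u) * biasFactor lam (s i) ^ 2 + (v' - v) * noiseFactor lam (s i) ^ 2)
        + ∑ i ∈ J, w i * Z i - riskFluctuation J w s b e u v lam := by
    have hJ : ∑ i ∈ J, w i * Z i = ∑ i, if i ∈ J then w i * Z i else 0 := by
      rw [Finset.sum_ite_mem, Finset.univ_inter]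
    rw [hJ, riskFluctuation, ← Finset.sum_sub_distrib, ← Finset.sum_add_distrib,
      ← Finset.sum_add_distrib, ← Finset.sum_sub_distrib]
    refine Finset.sum_congr rfl fun i _ => ?_
    simp only [hE, hZ]
    by_cases hi : i ∈ J
    · simp only [if_pos hi]; ring
    · simp only [if_neg hi, hθ i hi]; ring
  have hEb : ∀ i, |E i| ≤ (|u'| + |v'| * κ) + if i ∈ J then x i else 0 := by
    intro i
    have hxi : 0 ≤ if i ∈ J then x i else 0 := by split_ifs; exacts [hx i, le_rfl]
    have h1 : |(u' + if i ∈ J then x i else 0) * biasFactor lam (s i) ^ 2|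
        ≤ |u'| + if i ∈ J then x i else 0 := by
      rw [abs_mul, abs_of_nonneg (hf0 i)]
      refine (mul_le_of_le_one_right (abs_nonneg _) (hf1 i)).trans ((abs_add_le _ _).trans ?_)
      rw [abs_of_nonneg hxi]
    have h2 : |v' * noiseFactor lam (s i) ^ 2| ≤ |v'| * κ := by
      rw [abs_mul, abs_of_nonneg (hk0 i)]
      exact mul_le_mul_of_nonneg_left (hκ i) (abs_nonneg _)
    refine (abs_add_le _ _).trans ?_
    linarith
  rw [hsplit]
  refine (abs_sub _ _).trans (add_le_add ((abs_add_le _ _).trans (add_le_add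
    ((abs_add_le _ _).trans (add_le_add ?_ ?_)) ?_)) le_rfl)
  · refine (Finset.abs_sum_le_sum_abs _ _).trans ?_
    calc ∑ i, |(w' i - w i) * E i|
        ≤ ∑ i, η * ((|u'| + |v'| * κ) + if i ∈ J then x i else 0) :=
          Finset.sum_le_sum fun i _ => by
            rw [abs_mul]
            exact mul_le_mul (hη i) (hEb i) (abs_nonneg _) ((abs_nonneg _).trans (hη i))
      _ = _ := by
          rw [← Finset.mul_sum, Finset.sum_add_distrib, Finset.sum_ite_mem, Finset.univ_inter,
            Finset.sum_const, Finset.card_univ, Fintype.card_fin, nsmul_eq_mul]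
  · refine (Finset.abs_sum_le_sum_abs _ _).trans ?_
    calc ∑ i, |w i * ((u' - u) * biasFactor lam (s i) ^ 2 + (v' - v) * noiseFactor lam (s i) ^ 2)|
        ≤ ∑ _i : Fin p, W * (|u' - u| + κ * |v' - v|) := Finset.sum_le_sum fun i _ => by
          rw [abs_mul]
          refine mul_le_mul (hw i) ((abs_add_le _ _).trans ?_) (abs_nonneg _)
            ((abs_nonneg _).trans (hw i))
          rw [abs_mul, abs_mul, abs_of_nonneg (hf0 i), abs_of_nonneg (hk0 i), mul_comm κ]
          exact add_le_add (mul_le_of_le_one_right (abs_nonneg _) (hf1 i))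
            (mul_le_mul_of_nonneg_left (hκ i) (abs_nonneg _))
      _ = _ := by simp; ring
  · refine (Finset.abs_sum_le_sum_abs _ _).trans ?_
    rw [Finset.mul_sum]
    refine Finset.sum_le_sum fun i hi => ?_
    rw [abs_mul]
    exact mul_le_mul (hw i) (hy i hi) (abs_nonneg _) ((abs_nonneg _).trans (hw i))

/-- The estimation error of one aligned component. -/
theorem abs_aligned_error_le {l lam s c θ e u v : ℝ} (hl : 0 < l) (hlam : l ≤ lam) (hc : 0 < c)
    (hs : c ≤ s) (hu : 0 ≤ u) (hv : 0 ≤ v) :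
    |(u + (θ + e / √s) ^ 2) * biasFactor lam s ^ 2 + v * noiseFactor lam s ^ 2
      - (-(biasFactor lam s * θ) + noiseFactor lam s * e) ^ 2|
      ≤ u + v * (1 + 1 / l) ^ 2 + (2 / √c + 2 * (1 + 1 / l)) * (|θ| * |e|)
        + (1 / c + (1 + 1 / l) ^ 2) * e ^ 2 := by
  have hs0 : 0 < s := hc.trans_le hs
  have hlam0 : 0 < lam := hl.trans_le hlam
  set f := biasFactor lam s
  set k := noiseFactor lam s
  set κ := 1 + 1 / l
  have hf0 : 0 ≤ f := biasFactor_nonneg hlam0 hs0.le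
  have hf1 : f ≤ 1 := biasFactor_le_one hlam0 hs0.le
  have hk0 : 0 ≤ k := noiseFactor_nonneg hlam0 hs0.le
  have hk1 : k ≤ κ := noiseFactor_le hl hlam hs0.le
  have hf2 : f ^ 2 ≤ 1 := pow_le_one₀ hf0 hf1
  have hk2 : k ^ 2 ≤ κ ^ 2 := pow_le_pow_left₀ hk0 hk1 2
  have hsc : 1 / √s ≤ 1 / √c := one_div_le_one_div_of_le (Real.sqrt_pos.2 hc) (Real.sqrt_le_sqrt hs)
  have hsc' : 1 / s ≤ 1 / c := one_div_le_one_div_of_le hc hs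
  -- The large terms `f² θ²` cancel; what remains is either bounded or carries a factor `e`.
  have e1 : (u + (θ + e / √s) ^ 2) * f ^ 2 + v * k ^ 2 - (-(f * θ) + k * e) ^ 2
      = u * f ^ 2 + v * k ^ 2 + ((2 * (1 / √s) * f ^ 2 + 2 * (f * k)) * (θ * e))
        + (1 / s * f ^ 2 - k ^ 2) * e ^ 2 := by
    have : (1 / √s) ^ 2 = 1 / s := by rw [div_pow, Real.sq_sqrt hs0.le, one_pow]
    rw [← this]; ring
  rw [e1]
  have hs1 : 0 ≤ 1 / √s := by positivity
  have hs2 : 0 ≤ 1 / s := by positivity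
  have a1 : |u * f ^ 2| ≤ u := by
    rw [abs_of_nonneg (by positivity)]; exact mul_le_of_le_one_right hu hf2
  have a2 : |v * k ^ 2| ≤ v * κ ^ 2 := by
    rw [abs_of_nonneg (by positivity)]; exact mul_le_mul_of_nonneg_left hk2 hv
  have a3 : |(2 * (1 / √s) * f ^ 2 + 2 * (f * k)) * (θ * e)|
      ≤ (2 / √c + 2 * κ) * (|θ| * |e|) := by
    rw [abs_mul, abs_mul θ, abs_of_nonneg (by positivity)]
    refine mul_le_mul_of_nonneg_right (add_le_add ?_ ?_) (by positivity)
    · calc 2 * (1 / √s) * f ^ 2 ≤ 2 * (1 / √s) := mul_le_of_le_one_right (by positivity) hf2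
        _ ≤ 2 * (1 / √c) := by linarith
        _ = 2 / √c := by ring
    · have : f * k ≤ 1 * κ := mul_le_mul hf1 hk1 hk0 zero_le_one
      linarith
  have a4 : |(1 / s * f ^ 2 - k ^ 2) * e ^ 2| ≤ (1 / c + κ ^ 2) * e ^ 2 := by
    rw [abs_mul, abs_of_nonneg (sq_nonneg e)]
    refine mul_le_mul_of_nonneg_right ((abs_sub _ _).trans (add_le_add ?_ ?_)) (sq_nonneg e)
    · rw [abs_of_nonneg (by positivity)]
      exact (mul_le_of_le_one_right hs2 hf2).trans hsc'
    · rw [abs_of_nonneg (by positivity)]; exact hk2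
  refine (abs_add_le _ _).trans (add_le_add ((abs_add_le _ _).trans (add_le_add
    ((abs_add_le _ _).trans (add_le_add a1 a2)) a3)) a4)

/-- An eventually equi-Lipschitz sequence that converges to zero on a countable dense grid
converges uniformly. -/
theorem eventually_forall_abs_le_of_grid {T : ℕ → ℝ → ℝ} {l₁ l₂ K : ℝ} (hl : l₁ < l₂)
    (hK : ∀ᶠ n in atTop, ∀ lam ∈ Set.Icc l₁ l₂, ∀ μ ∈ Set.Icc l₁ l₂,
      |T n lam - T n μ| ≤ K * |lam - μ|)
    (hT : ∀ j N : ℕ, Tendsto (fun n => T n (l₁ + (l₂ - l₁) * (j / (N + 1)))) atTop (𝓝 0))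
    {ε : ℝ} (hε : 0 < ε) : ∀ᶠ n in atTop, ∀ lam ∈ Set.Icc l₁ l₂, |T n lam| ≤ ε := by
  have hd : 0 < l₂ - l₁ := sub_pos.2 hl
  -- The mesh `(l₂ - l₁) / (N + 1)` is chosen so that moving to a neighbouring grid point costs at
  -- most `ε / 2`.
  obtain ⟨N, hN⟩ := exists_nat_gt (2 * |K| * (l₂ - l₁) / ε)
  have hN1 : (0 : ℝ) < N + 1 := by positivity
  have hstep : |K| * ((l₂ - l₁) / (N + 1)) ≤ ε / 2 := by
    rw [div_lt_iff₀ hε] at hN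
    rw [← mul_div_assoc, div_le_iff₀ hN1]
    nlinarith
  have hgrid : ∀ᶠ n in atTop, ∀ j ∈ Finset.range (N + 2),
      |T n (l₁ + (l₂ - l₁) * (j / (N + 1)))| ≤ ε / 2 := by
    rw [Filter.eventually_all_finset]
    intro j _
    have := (hT j N).abs
    rw [abs_zero] at this
    exact (this.eventually (gt_mem_nhds (half_pos hε))).mono fun n hn => hn.le
  filter_upwards [hK, hgrid] with n h1 h2 lam hlam
  set z := (lam - l₁) / (l₂ - l₁) * (N + 1) with hz
  have hz0 : 0 ≤ z := by
    have : 0 ≤ lam - l₁ := sub_nonneg.2 hlam.1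
    positivity
  have hz1 : z ≤ N + 1 := by
    refine mul_le_of_le_one_left hN1.le ?_
    rw [div_le_one hd]
    linarith [hlam.2]
  -- The grid point just below `lam`. The value `j = N + 1` occurs at `lam = l₂`, hence the range `N
  -- + 2`.
  set j := ⌊z⌋₊ with hj
  have hjz : (j : ℝ) ≤ z := Nat.floor_le hz0
  have hjz' : z < j + 1 := Nat.lt_floor_add_one z
  have hjN : j ∈ Finset.range (N + 2) := by
    rw [Finset.mem_range]
    have : (j : ℝ) < (N + 2 : ℕ) := by push_cast; linarith
    exact_mod_cast this
  have hlamz : lam = l₁ + (l₂ - l₁) * (z / (N + 1)) := by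
    rw [hz]; field_simp; ring
  set μ := l₁ + (l₂ - l₁) * ((j : ℝ) / (N + 1)) with hμ
  have hdiff : lam - μ = (l₂ - l₁) / (N + 1) * (z - j) := by
    rw [hμ]; nth_rewrite 1 [hlamz]; ring
  have hdiff0 : 0 ≤ lam - μ := by
    rw [hdiff]; exact mul_nonneg (by positivity) (by linarith)
  have hdiff1 : |lam - μ| ≤ (l₂ - l₁) / (N + 1) := by
    rw [abs_of_nonneg hdiff0, hdiff]
    exact mul_le_of_le_one_right (by positivity) (by linarith)
  have hμmem : μ ∈ Set.Icc l₁ l₂ := by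
    refine ⟨?_, by linarith [hlam.2]⟩
    rw [hμ]
    have : 0 ≤ (l₂ - l₁) * ((j : ℝ) / (N + 1)) := by positivity
    linarith
  have e1 : T n lam = (T n lam - T n μ) + T n μ := by ring
  rw [e1]
  refine (abs_add_le _ _).trans ?_
  have e2 : |T n lam - T n μ| ≤ |K| * ((l₂ - l₁) / (N + 1)) :=
    (h1 lam hlam μ hμmem).trans (mul_le_mul (le_abs_self K) hdiff1 (abs_nonneg _) (abs_nonneg _))
  have e3 := h2 j hjN
  linarith

theorem tendsto_iSup_ofReal_of_eventually {F : ℕ → ℝ → ℝ} {S : Set ℝ}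
    (h : ∀ ε > 0, ∀ᶠ n in atTop, ∀ lam ∈ S, |F n lam| ≤ ε) :
    Tendsto (fun n => ⨆ lam ∈ S, ENNReal.ofReal |F n lam|) atTop (𝓝 0) := by
  rw [ENNReal.tendsto_nhds_zero]
  intro ε hε
  by_cases htop : ε = ∞
  · exact Eventually.of_forall fun n => htop ▸ le_top
  filter_upwards [h ε.toReal (ENNReal.toReal_pos hε.ne' htop)] with n hn
  refine iSup₂_le fun lam hlam => ?_
  rw [← ENNReal.ofReal_toReal htop]
  exact ENNReal.ofReal_le_ofReal (hn lam hlam)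

end Deterministic

/-! ### Spectrum and training error of the reduced model -/

section Spectrum

theorem sum_sq_col_le_opNorm_sq {m p : ℕ} (A : Matrix (Fin m) (Fin p) ℝ) (i : Fin p) :
    ∑ k, A k i ^ 2 ≤ opNorm A ^ 2 := by
  let _ := Matrix.instL2OpNormedAddCommGroup (m := Fin m) (n := Fin p) (𝕜 := ℝ)
  have h := Matrix.l2_opNorm_mulVec A (EuclideanSpace.single i (1 : ℝ))
  have h1 : ‖(EuclideanSpace.single i (1 : ℝ) : EuclideanSpace ℝ (Fin p))‖ = 1 := by simp
  rw [h1, mul_one] at h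
  have h2 := pow_le_pow_left₀ (norm_nonneg _) h 2
  rw [EuclideanSpace.norm_sq_eq] at h2
  simpa [opNorm] using h2

theorem opNorm_nonneg {m p : ℕ} (A : Matrix (Fin m) (Fin p) ℝ) : 0 ≤ opNorm A := by
  let _ := Matrix.instL2OpNormedAddCommGroup (m := Fin m) (n := Fin p) (𝕜 := ℝ)
  exact norm_nonneg A

theorem gram_le_opNorm_sq {m p : ℕ} (D : Matrix (Fin m) (Fin p) ℝ) (i : Fin p) :
    (Dᵀ * D) i i ≤ opNorm D ^ 2 := by
  refine le_trans (le_of_eq ?_) (sum_sq_col_le_opNorm_sq D i)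
  rw [Matrix.mul_apply]
  exact Finset.sum_congr rfl fun k _ => by rw [Matrix.transpose_apply, sq]

theorem abs_diag_le_opNorm {p : ℕ} (A : Matrix (Fin p) (Fin p) ℝ) (i : Fin p) :
    |A i i| ≤ opNorm A := by
  refine abs_le_of_sq_le_sq ?_ (opNorm_nonneg A)
  exact (Finset.single_le_sum (f := fun k => A k i ^ 2) (fun k _ => sq_nonneg _)
    (Finset.mem_univ i)).trans (sum_sq_col_le_opNorm_sq A i)

theorem card_idx_le (p : ℕ) (J : Finset ℕ) : (idx p J).card ≤ J.card :=
  Finset.card_le_card_of_injOn (fun i => (i : ℕ)) (fun i hi => by simpa [idx] using hi)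
    Fin.val_injective.injOn

/-- The mean minimizes the sum of squared deviations. This frees the spread hypothesis from the mean
of the full nonzero spectrum before the aligned indices are removed. -/
theorem sum_sq_sub_mean_le {ι : Type*} (N : Finset ι) (s : ι → ℝ) (x : ℝ) :
    ∑ i ∈ N, (s i - (∑ j ∈ N, s j) / N.card) ^ 2 ≤ ∑ i ∈ N, (s i - x) ^ 2 := by
  rcases N.eq_empty_or_nonempty with rfl | hN
  · simp
  have hc : (0 : ℝ) < N.card := by exact_mod_cast hN.card_pos
  generalize hm : (∑ j ∈ N, s j) / N.card = m
  have hs : ∑ j ∈ N, s j = m * N.card := by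
    rw [← hm, div_mul_cancel₀ _ hc.ne']
  have e : ∑ i ∈ N, (s i - x) ^ 2 - ∑ i ∈ N, (s i - m) ^ 2 = N.card * (m - x) ^ 2 := by
    rw [← Finset.sum_sub_distrib]
    have : ∀ i ∈ N, (s i - x) ^ 2 - (s i - m) ^ 2 = 2 * (m - x) * s i + (x ^ 2 - m ^ 2) :=
      fun i _ => by ring
    rw [Finset.sum_congr rfl this, Finset.sum_add_distrib, ← Finset.mul_sum, hs, Finset.sum_const,
      nsmul_eq_mul]
    ring
  have : 0 ≤ (N.card : ℝ) * (m - x) ^ 2 := mul_nonneg (Nat.cast_nonneg _) (sq_nonneg _)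
  linarith

variable {n p : ℕ}

/-- Removing the aligned components does not destroy the spread of the spectrum. -/
theorem spread_residIdx {Ja : Finset ℕ} {D : Matrix (Fin n) (Fin p) ℝ} {c C x : ℝ} (hn : 0 < n)
    (hc : c ≤ spectralSpread D) (hC : ∀ i, (Dᵀ * D) i i ≤ C) (hx : 0 ≤ x) (hxC : x ≤ C)
    (hJ : (Ja.card : ℝ) * C ^ 2 ≤ c / 2 * n) :
    c / 2 * n ≤ ∑ i : residIdx D Ja, ((Dᵀ * D) i i - x) ^ 2 := by
  have hn' : (0 : ℝ) < n := by exact_mod_cast hn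
  rw [spectralSpread, le_div_iff₀ hn'] at hc
  have h1 := hc.trans (sum_sq_sub_mean_le (nonzeroIdx D) (fun i => (Dᵀ * D) i i) x)
  have h2 : ∑ i ∈ nonzeroIdx D, ((Dᵀ * D) i i - x) ^ 2
      ≤ ∑ i ∈ residIdx D Ja, ((Dᵀ * D) i i - x) ^ 2 + ∑ i ∈ idx p Ja, ((Dᵀ * D) i i - x) ^ 2 := by
    have hdis : Disjoint (residIdx D Ja) (idx p Ja) := Finset.sdiff_disjoint
    rw [← Finset.sum_union hdis]
    refine Finset.sum_le_sum_of_subset_of_nonneg (fun i hi => ?_) fun i _ _ => sq_nonneg _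
    rw [Finset.mem_union, residIdx, Finset.mem_sdiff]
    by_cases h : i ∈ idx p Ja
    · exact Or.inr h
    · exact Or.inl ⟨hi, h⟩
  have h3 : ∑ i ∈ idx p Ja, ((Dᵀ * D) i i - x) ^ 2 ≤ Ja.card * C ^ 2 := by
    calc ∑ i ∈ idx p Ja, ((Dᵀ * D) i i - x) ^ 2 ≤ ∑ _i ∈ idx p Ja, C ^ 2 :=
          Finset.sum_le_sum fun i _ => by
            have := hC i
            have := gram_nonneg D i
            exact sq_le_sq' (by linarith) (by linarith)
      _ = (idx p Ja).card * C ^ 2 := by simp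
      _ ≤ _ := by
        have : ((idx p Ja).card : ℝ) ≤ Ja.card := by exact_mod_cast card_idx_le p Ja
        gcongr
  rw [Finset.sum_coe_sort (residIdx D Ja) fun i => ((Dᵀ * D) i i - x) ^ 2]
  linarith

theorem gram_pos_of_mem_residIdx {Ja : Finset ℕ} {D : Matrix (Fin n) (Fin p) ℝ} {i : Fin p}
    (hi : i ∈ residIdx D Ja) : 0 < (Dᵀ * D) i i := by
  have := (Finset.mem_sdiff.1 hi).1
  simpa [nonzeroIdx] using this

theorem IsSingularValueMatrix.lt_of_mem_residIdx {Ja : Finset ℕ} {D : Matrix (Fin n) (Fin p) ℝ}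
    (hD : IsSingularValueMatrix D) {i : Fin p} (hi : i ∈ residIdx D Ja) : (i : ℕ) < n := by
  by_contra h
  exact (gram_pos_of_mem_residIdx hi).ne' (hD.gram_eq_zero i h)

theorem IsSingularValueMatrix.card_residIdx_le {Ja : Finset ℕ} {D : Matrix (Fin n) (Fin p) ℝ}
    (hD : IsSingularValueMatrix D) : (residIdx D Ja).card ≤ n := by
  have := Finset.card_le_card_of_injOn (s := residIdx D Ja) (t := Finset.range n)
    (fun i => (i : ℕ)) (fun i hi => by
      simpa using hD.lt_of_mem_residIdx hi) Fin.val_injective.injOn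
  simpa using this

/-- The weight with which the `i`-th component enters the training error of the reduced model. -/
noncomputable def residWeight (Ja : Finset ℕ) (r : ℝ → ℝ) (lam : ℝ) (i : Fin p) (s : ℝ) : ℝ :=
  if i ∈ idx p Ja then 0 else if 0 < s then r s / (s + lam) ^ 2 else 0

/-- Whether `i` belongs to the residual set depends on `D` only through its own Gram entry. So a sum
over a random index set becomes a sum over all of `Fin p` with weights of the form `φ i (s i)`, as
the concentration bounds require. -/
theorem sum_residWeight_mul (Ja : Finset ℕ) (D : Matrix (Fin n) (Fin p) ℝ) (r : ℝ → ℝ) (lam : ℝ)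
    (f : Fin p → ℝ) :
    ∑ i, residWeight Ja r lam i ((Dᵀ * D) i i) * f i
      = ∑ i ∈ residIdx D Ja, r ((Dᵀ * D) i i) / ((Dᵀ * D) i i + lam) ^ 2 * f i := by
  have : ∀ i, residWeight Ja r lam i ((Dᵀ * D) i i) * f i
      = if i ∈ residIdx D Ja then r ((Dᵀ * D) i i) / ((Dᵀ * D) i i + lam) ^ 2 * f i else 0 := by
    intro i
    by_cases h1 : i ∈ idx p Ja <;> by_cases h2 : 0 < (Dᵀ * D) i i <;>
      simp [residWeight, residIdx, nonzeroIdx, h1, h2]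
  rw [Finset.sum_congr rfl fun i _ => this i, Finset.sum_ite_mem, Finset.univ_inter]

/-- The training error of the reduced model is its conditional mean plus centered sums. -/
theorem trainErr_decomp {Ja : Finset ℕ} {D : Matrix (Fin n) (Fin p) ℝ}
    (hD : IsSingularValueMatrix D) {O : Orth p} {X : Matrix (Fin n) (Fin p) ℝ} {y : Fin n → ℝ}
    {b e θ : Fin p → ℝ}
    (hX : Xᵀ * X = (O : Matrix (Fin p) (Fin p) ℝ)ᵀ * Matrix.diagonal (fun i => (Dᵀ * D) i i)
      * (O : Matrix (Fin p) (Fin p) ℝ))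
    (hy : ∀ i, ((O : Matrix (Fin p) (Fin p) ℝ) *ᵥ (Xᵀ *ᵥ y)) i
      = (Dᵀ * D) i i * θ i + √((Dᵀ * D) i i) * e i)
    (hθ : ∀ i, i ∉ idx p Ja → θ i = b i) {lam γ u v : ℝ} (hl : 0 < lam) (hγ : γ ≠ 0) :
    trainErr (Xnew Ja D O) (ynew Ja D X O y) lam
      = u * γ * coefA γ (sqSingNew Ja D) lam + v * coefB (sqSingNew Ja D) lam
        + lam ^ 2 / (residIdx D Ja).card
          * (∑ i, residWeight Ja id lam i ((Dᵀ * D) i i) * (b i ^ 2 - u)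
            + 2 * ∑ i, residWeight Ja Real.sqrt lam i ((Dᵀ * D) i i) * (b i * e i)
            + ∑ i : Fin p, residWeight Ja (fun _ => 1) lam i ((Dᵀ * D) i i)
              * (e i ^ 2 - if (i : ℕ) < n then v else 0)) := by
  have hs0 := gram_nonneg D
  -- The reduced data again follow a linear model with signal `b` and noise `e`; the aligned part of
  -- the signal has disappeared.
  have hyn : ∀ i : residIdx D Ja, ynew Ja D X O y i = √((Dᵀ * D) i i) * b i + e i := by
    intro i
    have hpos := gram_pos_of_mem_residIdx i.2
    have hi : (i : Fin p) ∉ idx p Ja := (Finset.mem_sdiff.1 i.2).2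
    rw [ynew, singDiag, Matrix.mulVec_diagonal,
      pcr_apply O X y _ _ _ (fun j hj => (gram_pos_of_mem_residIdx hj).ne') hX hy, hθ _ hi]
    have h1 := Real.mul_self_sqrt hpos.le
    have h2 : √((Dᵀ * D) i i) ≠ 0 := (Real.sqrt_pos.2 hpos).ne'
    rw [mul_div_assoc', div_eq_iff hpos.ne']
    linear_combination e i * h1
  rw [trainErr_Xnew Ja D O _ hl, coefA_eq _ (sqSingNew Ja D) (fun i => hs0 i) hl,
    coefB_eq (sqSingNew Ja D) (fun i => hs0 i) hl, Fintype.card_coe,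
    sum_residWeight_mul, sum_residWeight_mul, sum_residWeight_mul]
  have e1 : ∑ i : residIdx D Ja, (lam * ynew Ja D X O y i / ((Dᵀ * D) i i + lam)) ^ 2
      = ∑ i ∈ residIdx D Ja, (lam * (√((Dᵀ * D) i i) * b i + e i) / ((Dᵀ * D) i i + lam)) ^ 2 := by
    rw [← Finset.sum_coe_sort (residIdx D Ja)]
    exact Finset.sum_congr rfl fun i _ => by rw [hyn]
  have e2 : ∑ i : residIdx D Ja, sqSingNew Ja D i / (sqSingNew Ja D i + lam) ^ 2
      = ∑ i ∈ residIdx D Ja, (Dᵀ * D) i i / ((Dᵀ * D) i i + lam) ^ 2 :=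
    Finset.sum_coe_sort (residIdx D Ja) fun i => (Dᵀ * D) i i / ((Dᵀ * D) i i + lam) ^ 2
  have e3 : ∑ i : residIdx D Ja, 1 / (sqSingNew Ja D i + lam) ^ 2
      = ∑ i ∈ residIdx D Ja, 1 / ((Dᵀ * D) i i + lam) ^ 2 :=
    Finset.sum_coe_sort (residIdx D Ja) fun i => 1 / ((Dᵀ * D) i i + lam) ^ 2
  rw [e1, e2, e3]
  have key : ∑ i ∈ residIdx D Ja, (lam * (√((Dᵀ * D) i i) * b i + e i) / ((Dᵀ * D) i i + lam)) ^ 2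
      = u * (lam ^ 2 * ∑ i ∈ residIdx D Ja, (Dᵀ * D) i i / ((Dᵀ * D) i i + lam) ^ 2)
        + v * (lam ^ 2 * ∑ i ∈ residIdx D Ja, 1 / ((Dᵀ * D) i i + lam) ^ 2)
        + lam ^ 2 * (∑ i ∈ residIdx D Ja,
            id ((Dᵀ * D) i i) / ((Dᵀ * D) i i + lam) ^ 2 * (b i ^ 2 - u)
          + 2 * ∑ i ∈ residIdx D Ja, √((Dᵀ * D) i i) / ((Dᵀ * D) i i + lam) ^ 2 * (b i * e i)
          + ∑ i ∈ residIdx D Ja, 1 / ((Dᵀ * D) i i + lam) ^ 2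
            * (e i ^ 2 - if (i : ℕ) < n then v else 0)) := by
    simp only [Finset.mul_sum, ← Finset.sum_add_distrib]
    refine Finset.sum_congr rfl fun i hi => ?_
    have hlt := hD.lt_of_mem_residIdx hi
    rw [if_pos hlt, div_pow, mul_pow, add_sq, mul_pow, Real.sq_sqrt (hs0 i), id]
    ring
  have hcancel : ∀ A : ℝ, u * γ * (lam ^ 2 / γ * A) = u * lam ^ 2 * A := fun A => by field_simp
  rw [key, hcancel]
  generalize (∑ i ∈ residIdx D Ja, (Dᵀ * D) i i / ((Dᵀ * D) i i + lam) ^ 2) = A₁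
  generalize (∑ i ∈ residIdx D Ja, 1 / ((Dᵀ * D) i i + lam) ^ 2) = A₂
  rw [add_div, add_div]
  ring_nf

end Spectrum

/-! ### Centered averages at the scale of the actual signal -/

section Averages

variable {Ω : Type*} [MeasurableSpace Ω] {P : Measure Ω} [IsProbabilityMeasure P]
  {p n' : ℕ → ℕ} {Jc : Finset ℕ} {σ γ : ℝ} {M : ∀ n, Data Ω n (n' n) (p n) Jc}

/-- The unaligned signal in the basis of right singular vectors. -/
noncomputable def Data.signalCoord {Ω : Type*} {n n' p : ℕ} {Jc : Finset ℕ}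
    (M : Data Ω n n' p Jc) (ω : Ω) : Fin p → ℝ :=
  (M.O ω : Matrix (Fin p) (Fin p) ℝ) *ᵥ M.β' ω

theorem Data.signalCoord_eq {Ω : Type*} {n n' p : ℕ} {Jc : Finset ℕ} (M : Data Ω n n' p Jc)
    (ω : Ω) (i : Fin p) :
    M.signalCoord ω i = √(∑ j, M.β' ω j ^ 2) * M.signalDir ω i := by
  rw [signalCoord, signalDir, ← smul_eq_mul, ← Pi.smul_apply, ← Matrix.mulVec_smul, smul_direction]

/-- The centered averages that govern the training error and the risk vanish. -/
theorem ae_tendsto_averages (hM : ∀ n, (M n).IsModel P σ) (hγ : 0 < γ)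
    (hp : Tendsto (fun n => (p n : ℝ) / n) atTop (𝓝 γ)) {r : ℝ}
    (hβ : ∀ᵐ ω ∂P, ∀ᶠ n : ℕ in atTop, √(∑ j, (M n).β' ω j ^ 2) ≤ r * √(n : ℝ))
    {φ : ∀ n, Fin (p n) → ℝ → ℝ} (hφ : ∀ n i, Measurable (φ n i)) {B : ℝ}
    (hB : ∀ᶠ n in atTop, ∀ i t, 0 ≤ t → |φ n i t| ≤ B) :
    ∀ᵐ ω ∂P,
      Tendsto (fun n : ℕ => (∑ i, φ n i ((((M n).D ω)ᵀ * (M n).D ω) i i)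
        * ((M n).signalCoord ω i ^ 2 - (∑ j, (M n).signalCoord ω j ^ 2) / p n)) / n) atTop (𝓝 0)
      ∧ Tendsto (fun n : ℕ => (∑ i, φ n i ((((M n).D ω)ᵀ * (M n).D ω) i i)
        * ((M n).signalCoord ω i * (M n).noiseCoord ω i)) / n) atTop (𝓝 0)
      ∧ Tendsto (fun n : ℕ => (∑ i : Fin (p n), φ n i ((((M n).D ω)ᵀ * (M n).D ω) i i)
        * ((M n).noiseCoord ω i ^ 2 - if (i : ℕ) < n then σ ^ 2 else 0)) / n) atTop (𝓝 0) := by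
  filter_upwards [hβ, ae_tendsto_signal hM hγ hp hφ hB, ae_tendsto_cross hM hγ hp hφ hB,
    ae_tendsto_noise hM hγ hp hφ hB] with ω hr h1 h2 h3
  refine ⟨?_, ?_, h3⟩
  -- The norm of `β'` is factored out of the bound for its direction. Its square divided by `n` is
  -- eventually at most `r²` on the given path.
  · have hz := (h1.abs).const_mul (r ^ 2)
    rw [abs_zero, mul_zero] at hz
    refine squeeze_zero_norm' ?_ hz
    filter_upwards [hr, eventually_gt_atTop 0] with n hn hn0
    have hn0' : (0 : ℝ) < n := by exact_mod_cast hn0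
    have e : ∑ i, φ n i ((((M n).D ω)ᵀ * (M n).D ω) i i)
        * ((M n).signalCoord ω i ^ 2 - (∑ j, (M n).signalCoord ω j ^ 2) / p n)
        = √(∑ j, (M n).β' ω j ^ 2) ^ 2 * ∑ i, φ n i ((((M n).D ω)ᵀ * (M n).D ω) i i)
        * ((M n).signalDir ω i ^ 2 - (∑ j, (M n).signalDir ω j ^ 2) / p n) := by
      simp only [Data.signalCoord_eq, mul_pow, ← Finset.mul_sum]
      rw [Finset.mul_sum (s := Finset.univ) (f := fun i => φ n i _ * _)]
      exact Finset.sum_congr rfl fun i _ => by ring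
    have hsq : √(∑ j, (M n).β' ω j ^ 2) ^ 2 / n ≤ r ^ 2 := by
      rw [div_le_iff₀ hn0']
      calc √(∑ j, (M n).β' ω j ^ 2) ^ 2 ≤ (r * √(n : ℝ)) ^ 2 :=
            pow_le_pow_left₀ (Real.sqrt_nonneg _) hn 2
        _ = r ^ 2 * n := by rw [mul_pow, Real.sq_sqrt hn0'.le]
    rw [e, mul_div_right_comm, Real.norm_eq_abs, abs_mul, abs_of_nonneg (by positivity)]
    exact mul_le_mul_of_nonneg_right hsq (abs_nonneg _)
  · have hz := (h2.abs).const_mul |r|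
    rw [abs_zero, mul_zero] at hz
    refine squeeze_zero_norm' ?_ hz
    filter_upwards [hr, eventually_gt_atTop 0] with n hn hn0
    have hn0' : (0 : ℝ) < n := by exact_mod_cast hn0
    have hsn : 0 < √(n : ℝ) := Real.sqrt_pos.2 hn0'
    have e : (∑ i, φ n i ((((M n).D ω)ᵀ * (M n).D ω) i i)
        * ((M n).signalCoord ω i * (M n).noiseCoord ω i)) / n
        = √(∑ j, (M n).β' ω j ^ 2) / √(n : ℝ) * ((∑ i, φ n i ((((M n).D ω)ᵀ * (M n).D ω) i i)
        * (M n).signalDir ω i * (M n).noiseCoord ω i) / √(n : ℝ)) := by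
      rw [div_mul_div_comm, Real.mul_self_sqrt hn0'.le, Finset.mul_sum]
      congr 1
      refine Finset.sum_congr rfl fun i _ => ?_
      rw [Data.signalCoord_eq]; ring
    rw [e, Real.norm_eq_abs, abs_mul, abs_of_nonneg (by positivity)]
    refine mul_le_mul_of_nonneg_right ?_ (abs_nonneg _)
    rw [div_le_iff₀ hsn]
    exact hn.trans (mul_le_mul_of_nonneg_right (le_abs_self r) hsn.le)

end Averages

/-! ### Consistency of the estimators of signal size and noise level -/

section Estimators

/-- The deviation of the training error of the reduced model from its conditional mean, up to
normalization. -/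
noncomputable def trainFluctuation {n p : ℕ} (Ja : Finset ℕ) (D : Matrix (Fin n) (Fin p) ℝ)
    (b e : Fin p → ℝ) (u v lam : ℝ) : ℝ :=
  ∑ i, residWeight Ja id lam i ((Dᵀ * D) i i) * (b i ^ 2 - u)
    + 2 * ∑ i, residWeight Ja Real.sqrt lam i ((Dᵀ * D) i i) * (b i * e i)
    + ∑ i : Fin p, residWeight Ja (fun _ => 1) lam i ((Dᵀ * D) i i)
      * (e i ^ 2 - if (i : ℕ) < n then v else 0)

/-- Deterministic error bound for the estimators of the signal size and the noise level. -/
theorem exists_abs_estimators_sub_le {L : ℕ} [NeZero L] {g : Fin L → ℝ} (hg : ∀ k, 0 < g k)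
    (hg' : ∃ k, g k ≠ g 0) {C c γ : ℝ} (hC : 0 < C) (hc : 0 < c) (hγ : 0 < γ) :
    ∃ K : ℝ, ∀ {n p : ℕ} {Ja : Finset ℕ} {D : Matrix (Fin n) (Fin p) ℝ}
      (_ : IsSingularValueMatrix D) {O : Orth p} {X : Matrix (Fin n) (Fin p) ℝ} {y : Fin n → ℝ}
      {b e θ : Fin p → ℝ}
      (_ : Xᵀ * X = (O : Matrix (Fin p) (Fin p) ℝ)ᵀ * Matrix.diagonal (fun i => (Dᵀ * D) i i)
        * (O : Matrix (Fin p) (Fin p) ℝ))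
      (_ : ∀ i, ((O : Matrix (Fin p) (Fin p) ℝ) *ᵥ (Xᵀ *ᵥ y)) i
        = (Dᵀ * D) i i * θ i + √((Dᵀ * D) i i) * e i)
      (_ : ∀ i, i ∉ idx p Ja → θ i = b i) (u v : ℝ) (_ : 0 < n) (_ : γ / 2 * n ≤ p)
      (_ : (p : ℝ) ≤ 2 * γ * n) (_ : ∀ i, (Dᵀ * D) i i ≤ C) (_ : c ≤ spectralSpread D)
      (_ : (Ja.card : ℝ) * C ^ 2 ≤ c / 2 * n),
      |rSqHat (p / n) g (Xnew Ja D O) (sqSingNew Ja D) (ynew Ja D X O y) - u * (p / n)|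
          ≤ K * ∑ k, g k ^ 2 * |trainFluctuation Ja D b e u v (g k) / n|
        ∧ |sigmaSqHat (p / n) g (Xnew Ja D O) (sqSingNew Ja D) (ynew Ja D X O y) - v|
          ≤ K * ∑ k, g k ^ 2 * |trainFluctuation Ja D b e u v (g k) / n| := by
  obtain ⟨k₀, hk₀⟩ := hg'
  obtain ⟨a, B, κ, ha, hκ, hcoef⟩ := exists_coef_bounds hg hk₀ hC (half_pos hc) hγ
  set K₀ := L * (2 / a * (2 * B / a)) / (κ ^ 2 / B ^ 4) with hK₀
  refine ⟨K₀ * (C ^ 2 / (c / 2)), ?_⟩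
  intro n p Ja D hD O X y b e θ hX hy hθ u v hn hp1 hp2 hs hcs hJ
  have hn' : (0 : ℝ) < n := by exact_mod_cast hn
  have hs0 := gram_nonneg D
  have hspread : ∀ x, 0 ≤ x → x ≤ C → c / 2 * n ≤ ∑ i : residIdx D Ja, (sqSingNew Ja D i - x) ^ 2 :=
    fun x hx hxC => spread_residIdx hn hcs hs hx hxC hJ
  have hγ1 : γ / 2 ≤ p / n := by rwa [le_div_iff₀ hn']
  have hγ2 : (p : ℝ) / n ≤ 2 * γ := by rwa [div_le_iff₀ hn']
  have hγ0 : (p : ℝ) / n ≠ 0 := ((half_pos hγ).trans_le hγ1).ne'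
  have hcard : (Fintype.card (residIdx D Ja) : ℝ) ≤ n := by
    rw [Fintype.card_coe]; exact_mod_cast hD.card_residIdx_le
  obtain ⟨hab, hsep⟩ := hcoef (sqSingNew Ja D) n (p / n) hn' hcard hγ1 hγ2 (fun i => hs0 i)
    (fun i => hs i) hspread
  -- The spread about `0` and the bound `C` force the reduced sample size to be of order `n`, so
  -- dividing by it is no worse than dividing by `n`.
  have hm : c / 2 * n ≤ (residIdx D Ja).card * C ^ 2 := by
    refine (hspread 0 le_rfl hC.le).trans ?_
    calc ∑ i : residIdx D Ja, (sqSingNew Ja D i - 0) ^ 2 ≤ ∑ _i : residIdx D Ja, C ^ 2 :=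
          Finset.sum_le_sum fun i _ => by
            rw [sub_zero]; exact pow_le_pow_left₀ (hs0 i) (hs i) 2
      _ = _ := by simp
  have hm0 : (0 : ℝ) < (residIdx D Ja).card := by
    by_contra h
    have h0 : ((residIdx D Ja).card : ℝ) = 0 := le_antisymm (not_lt.1 h) (Nat.cast_nonneg _)
    rw [h0, zero_mul] at hm
    have : 0 < c / 2 * n := by positivity
    linarith
  set δ : Fin L → ℝ := fun k =>
    g k ^ 2 / (residIdx D Ja).card * trainFluctuation Ja D b e u v (g k) with hδ
  have hδb : ∑ k, |δ k| ≤ C ^ 2 / (c / 2)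
      * ∑ k, g k ^ 2 * |trainFluctuation Ja D b e u v (g k) / n| := by
    rw [Finset.mul_sum]
    refine Finset.sum_le_sum fun k _ => ?_
    have h1 : 1 / ((residIdx D Ja).card : ℝ) ≤ C ^ 2 / (c / 2) / n := by
      rw [div_div, div_le_div_iff₀ hm0 (by positivity)]
      linarith
    have e1 : |δ k| = g k ^ 2 * |trainFluctuation Ja D b e u v (g k)|
        * (1 / ((residIdx D Ja).card : ℝ)) := by
      simp only [hδ]
      rw [abs_mul, abs_of_nonneg (by positivity)]
      ring
    rw [e1, abs_div, abs_of_pos hn']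
    refine (mul_le_mul_of_nonneg_left h1 (by positivity)).trans (le_of_eq ?_)
    ring
  have hdec : ∀ k, trainErr (Xnew Ja D O) (ynew Ja D X O y) (g k)
      = u * (p / n) * coefA (p / n) (sqSingNew Ja D) (g k) + v * coefB (sqSingNew Ja D) (g k)
        + δ k := fun k => trainErr_decomp hD hX hy hθ (hg k) hγ0
  have hK0 : 0 ≤ K₀ := by
    have : 0 < B := ha.trans_le ((hab 0).1.trans (hab 0).2.1)
    positivity
  rw [mul_assoc]
  constructor
  -- The same stability bound with the roles of the two coefficients exchanged. The determinant
  -- changes only its sign.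
  · refine le_trans ?_ (mul_le_mul_of_nonneg_left hδb hK0)
    refine abs_olsSlope_sub_le (u := v) (k₀ := k₀) ha hκ (fun k => (hab k).2.2.1)
      (fun k => (hab k).2.2.2) (fun k => ?_) ?_ fun k => ?_
    · rw [abs_of_pos (ha.trans_le (hab k).1)]; exact (hab k).2.1
    · rw [abs_sub_comm, mul_comm (coefA _ _ _), mul_comm (coefA _ _ _)]; exact hsep
    · rw [hdec]; ring
  · refine le_trans ?_ (mul_le_mul_of_nonneg_left hδb hK0)
    refine abs_olsSlope_sub_le (u := u * (p / n)) (k₀ := k₀) ha hκ (fun k => (hab k).1)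
      (fun k => (hab k).2.1) (fun k => ?_) hsep fun k => hdec k
    rw [abs_of_pos (ha.trans_le (hab k).2.2.1)]; exact (hab k).2.2.2

theorem abs_residWeight_le {p : ℕ} {Ja : Finset ℕ} {r : ℝ → ℝ} {lam B : ℝ} (hB : 0 ≤ B)
    (hr : ∀ t, 0 < t → |r t / (t + lam) ^ 2| ≤ B) (i : Fin p) (t : ℝ) :
    |residWeight Ja r lam i t| ≤ B := by
  unfold residWeight
  split_ifs with h1 h2
  · simpa using hB
  · exact hr t h2
  · simpa using hB

theorem measurable_residWeight {p : ℕ} (Ja : Finset ℕ) {r : ℝ → ℝ} (hr : Measurable r) (lam : ℝ)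
    (i : Fin p) : Measurable (residWeight Ja r lam i) := by
  unfold residWeight
  split_ifs
  · exact measurable_const
  · exact Measurable.ite measurableSet_Ioi (by fun_prop) measurable_const

variable {Ω : Type*} [MeasurableSpace Ω] {P : Measure Ω} [IsProbabilityMeasure P]
  {p n' : ℕ → ℕ} {Jc : Finset ℕ} {σ γ : ℝ} {M : ∀ n, Data Ω n (n' n) (p n) Jc}

/-- The three sums have weights `t`, `√t` and `1` over `(t + lam)²`, all bounded on `t > 0` for
fixed `lam`. Uniformity in `lam` is not needed, because the estimators use a finite grid. -/
theorem ae_tendsto_trainFluctuation (hM : ∀ n, (M n).IsModel P σ) (hγ : 0 < γ)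
    (hp : Tendsto (fun n => (p n : ℝ) / n) atTop (𝓝 γ)) {r : ℝ}
    (hβ : ∀ᵐ ω ∂P, ∀ᶠ n : ℕ in atTop, √(∑ j, (M n).β' ω j ^ 2) ≤ r * √(n : ℝ))
    (Ja : Finset ℕ) {lam : ℝ} (hl : 0 < lam) :
    ∀ᵐ ω ∂P, Tendsto (fun n : ℕ => trainFluctuation Ja ((M n).D ω) ((M n).signalCoord ω)
      ((M n).noiseCoord ω) ((∑ j, (M n).signalCoord ω j ^ 2) / p n) (σ ^ 2) lam / n)
      atTop (𝓝 0) := by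
  have b1 : ∀ t : ℝ, 0 < t → |id t / (t + lam) ^ 2| ≤ 1 / lam := fun t ht => by
    rw [id, abs_of_nonneg (by positivity), div_le_div_iff₀ (by positivity) hl]
    nlinarith [mul_pos ht hl, sq_nonneg t, sq_nonneg lam]
  have b3 : ∀ t : ℝ, 0 < t → |1 / (t + lam) ^ 2| ≤ 1 / lam ^ 2 := fun t ht => by
    rw [abs_of_nonneg (by positivity)]
    exact one_div_le_one_div_of_le (by positivity) (pow_le_pow_left₀ hl.le (by linarith) 2)
  have b2 : ∀ t : ℝ, 0 < t → |√t / (t + lam) ^ 2| ≤ 1 / lam + 1 / lam ^ 2 := fun t ht => by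
    rw [abs_of_nonneg (by positivity)]
    have h1 := (le_abs_self _).trans (b1 t ht)
    have h3 := (le_abs_self _).trans (b3 t ht)
    have hsq : √t ≤ t + 1 := by
      have := Real.sq_sqrt ht.le
      nlinarith [sq_nonneg (√t - 1), Real.sqrt_nonneg t]
    calc √t / (t + lam) ^ 2 ≤ (t + 1) / (t + lam) ^ 2 := by gcongr
      _ = id t / (t + lam) ^ 2 + 1 / (t + lam) ^ 2 := add_div _ _ _
      _ ≤ _ := add_le_add h1 h3
  filter_upwards [ae_tendsto_averages hM hγ hp hβ
      (φ := fun n i => residWeight Ja id lam i)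
      (fun n i => measurable_residWeight Ja measurable_id lam i)
      (B := 1 / lam)
      (Eventually.of_forall fun n i t _ => abs_residWeight_le (by positivity) b1 i t),
    ae_tendsto_averages hM hγ hp hβ (φ := fun n i => residWeight Ja Real.sqrt lam i)
      (fun n i => measurable_residWeight Ja Real.continuous_sqrt.measurable lam i)
      (B := 1 / lam + 1 / lam ^ 2)
      (Eventually.of_forall fun n i t _ => abs_residWeight_le (by positivity) b2 i t),
    ae_tendsto_averages hM hγ hp hβ (φ := fun n i => residWeight Ja (fun _ => 1) lam i)
      (fun n i => measurable_residWeight Ja measurable_const lam i) (B := 1 / lam ^ 2)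
      (Eventually.of_forall fun n i t _ => abs_residWeight_le (by positivity) b3 i t)]
    with ω h1 h2 h3
  have h := (h1.1.add (h2.2.1.const_mul 2)).add h3.2.2
  simp only [mul_zero, add_zero] at h
  refine h.congr fun n => ?_
  rw [trainFluctuation]
  ring

theorem Data.design_gram {Ω : Type*} {n n' p : ℕ} {M : Data Ω n n' p Jc} {ω : Ω}
    (hD : IsSingularValueMatrix (M.D ω)) :
    (M.X ω)ᵀ * M.X ω = (M.O ω : Matrix (Fin p) (Fin p) ℝ)ᵀ
      * Matrix.diagonal (fun i => ((M.D ω)ᵀ * M.D ω) i i) * (M.O ω : Matrix (Fin p) (Fin p) ℝ) :=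
  ROTI.design_gram hD (M.Q ω) (M.O ω) (M.X ω) rfl

theorem Data.design_response {Ω : Type*} {n n' p : ℕ} {M : Data Ω n n' p Jc} {ω : Ω}
    (hD : IsSingularValueMatrix (M.D ω)) (Ja : Finset ℕ) (α : ℕ → ℝ) (i : Fin p) :
    ((M.O ω : Matrix (Fin p) (Fin p) ℝ) *ᵥ ((M.X ω)ᵀ *ᵥ M.y Ja α ω)) i
      = ((M.D ω)ᵀ * M.D ω) i i * ((M.O ω : Matrix (Fin p) (Fin p) ℝ) *ᵥ M.β Ja α ω) i
        + √(((M.D ω)ᵀ * M.D ω) i i) * M.noiseCoord ω i :=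
  ROTI.design_response hD (M.Q ω) (M.O ω) (M.X ω) rfl (M.β Ja α ω) (M.ε ω) i

theorem Data.mulVec_signal {Ω : Type*} {n n' p : ℕ} (M : Data Ω n n' p Jc)
    (Ja : Finset ℕ) (α : ℕ → ℝ) (ω : Ω)
    (i : Fin p) : ((M.O ω : Matrix (Fin p) (Fin p) ℝ) *ᵥ M.β Ja α ω) i
      = M.signalCoord ω i + if i ∈ idx p Ja then √(n : ℝ) * α i else 0 := by
  have hrow : ∀ j, ((M.O ω : Matrix (Fin p) (Fin p) ℝ) *ᵥ (M.O ω : Matrix (Fin p) (Fin p) ℝ) j) i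
      = if i = j then 1 else 0 := fun j => by
    have h := congrFun (congrFun (Orth.mul_transpose (M.O ω)) i) j
    rw [Matrix.mul_apply, Matrix.one_apply] at h
    exact h
  rw [Data.β, Matrix.mulVec_add, Pi.add_apply, ← Data.signalCoord, Matrix.mulVec_sum,
    Finset.sum_apply]
  simp only [Matrix.mulVec_smul, Pi.smul_apply, smul_eq_mul, hrow, mul_ite, mul_one, mul_zero,
    Finset.sum_ite_eq]

theorem Data.mulVec_signal_of_notMem {Ω : Type*} {n n' p : ℕ} (M : Data Ω n n' p Jc) {Ja : Finset ℕ}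
    (α : ℕ → ℝ) (ω : Ω) {i : Fin p} (hi : i ∉ idx p Ja) :
    ((M.O ω : Matrix (Fin p) (Fin p) ℝ) *ᵥ M.β Ja α ω) i = M.signalCoord ω i := by
  rw [M.mulVec_signal, if_neg hi, add_zero]

/-- The estimators of the signal size and of the noise level are consistent. -/
theorem ae_tendsto_estimators (hM : ∀ n, (M n).IsModel P σ) (hγ : 0 < γ)
    (hp : Tendsto (fun n => (p n : ℝ) / n) atTop (𝓝 γ)) {C r : ℝ}
    (hD : ∀ᵐ ω ∂P, ∀ᶠ n in atTop, opNorm ((M n).D ω) ≤ C)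
    (hβ : ∀ᵐ ω ∂P, ∀ᶠ n : ℕ in atTop, √(∑ j, (M n).β' ω j ^ 2) ≤ r * √(n : ℝ))
    (hspread : ∀ᵐ ω ∂P, ∃ c > 0, ∀ᶠ n in atTop, c ≤ spectralSpread ((M n).D ω))
    (Ja : Finset ℕ) (α : ℕ → ℝ) {L : ℕ} [NeZero L] {g : Fin L → ℝ} (hg : ∀ k, 0 < g k)
    (hg' : ∃ k, g k ≠ g 0) :
    ∀ᵐ ω ∂P,
      Tendsto (fun n : ℕ => rSqHat ((p n : ℝ) / n) g (Xnew Ja ((M n).D ω) ((M n).O ω))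
          (sqSingNew Ja ((M n).D ω)) (ynew Ja ((M n).D ω) ((M n).X ω) ((M n).O ω) ((M n).y Ja α ω))
          - (∑ j, (M n).signalCoord ω j ^ 2) / p n * (p n / n)) atTop (𝓝 0)
      ∧ Tendsto (fun n : ℕ => sigmaSqHat ((p n : ℝ) / n) g (Xnew Ja ((M n).D ω) ((M n).O ω))
          (sqSingNew Ja ((M n).D ω)) (ynew Ja ((M n).D ω) ((M n).X ω) ((M n).O ω) ((M n).y Ja α ω))
          - σ ^ 2) atTop (𝓝 0) := by
  have hsing : ∀ᵐ ω ∂P, ∀ n, IsSingularValueMatrix ((M n).D ω) :=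
    ae_all_iff.2 fun n => (hM n).sing_D
  have hfluct := ae_all_iff.2 fun k => ae_tendsto_trainFluctuation hM hγ hp hβ Ja (hg k)
  filter_upwards [hsing, hfluct, hD, hspread] with ω hs hf hDω ⟨c, hc, hcω⟩
  -- The spread constant `c`, and with it `K`, depends on `ω`; this is harmless since the bound is
  -- deterministic. The `1` added to `C ^ 2` makes the spectral bound positive.
  obtain ⟨K, hK⟩ := exists_abs_estimators_sub_le hg hg' (by positivity : 0 < C ^ 2 + 1) hc hγ
  have hz : Tendsto (fun n : ℕ => K * ∑ k, g k ^ 2 * |trainFluctuation Ja ((M n).D ω)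
      ((M n).signalCoord ω) ((M n).noiseCoord ω) ((∑ j, (M n).signalCoord ω j ^ 2) / p n)
      (σ ^ 2) (g k) / n|) atTop (𝓝 0) := by
    have := (tendsto_finsetSum Finset.univ fun k _ => ((hf k).abs).const_mul (g k ^ 2)).const_mul K
    simpa using this
  have hlarge : ∀ᶠ n : ℕ in atTop, (Ja.card : ℝ) * (C ^ 2 + 1) ^ 2 ≤ c / 2 * n :=
    (tendsto_natCast_atTop_atTop.const_mul_atTop (half_pos hc)).eventually_ge_atTop _
  have hev : ∀ᶠ n : ℕ in atTop, ∀ i, (((M n).D ω)ᵀ * (M n).D ω) i i ≤ C ^ 2 + 1 := by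
    filter_upwards [hDω] with n hn i
    have h1 := gram_le_opNorm_sq ((M n).D ω) i
    have h2 := pow_le_pow_left₀ (opNorm_nonneg _) hn 2
    linarith
  constructor
  · refine squeeze_zero_norm' ?_ hz
    filter_upwards [hlarge, hev, hcω, eventually_dim_bounds hγ hp] with n h1 h2 h3 ⟨h4, _, h5, h6⟩
    exact (hK (hs n) (Data.design_gram (hs n)) (Data.design_response (hs n) Ja α)
      (fun i hi => (M n).mulVec_signal_of_notMem α ω hi) _ _ h4 h5 h6 h2 h3 h1).1
  · refine squeeze_zero_norm' ?_ hz
    filter_upwards [hlarge, hev, hcω, eventually_dim_bounds hγ hp] with n h1 h2 h3 ⟨h4, _, h5, h6⟩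
    exact (hK (hs n) (Data.design_gram (hs n)) (Data.design_response (hs n) Ja α)
      (fun i hi => (M n).mulVec_signal_of_notMem α ω hi) _ _ h4 h5 h6 h2 h3 h1).2

end Estimators

/-! ### Uniform comparison of estimated and conditional risk along a fixed path -/

section RiskComparison

/-- Bounds for the aligned components, whose number does not grow. -/
theorem sum_aligned_le {ι : Type*} (J : Finset ι) {θ e s : ι → ℝ} {c Θ m : ℝ} {N : ℕ}
    (hN : J.card ≤ N) (hc : 0 < c) (hs : ∀ i ∈ J, c ≤ s i) (hΘ : 0 ≤ Θ) (hm : 0 < m)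
    (hθ : ∀ i ∈ J, θ i ^ 2 ≤ Θ * m) :
    (∑ i ∈ J, (θ i + e i / √(s i)) ^ 2) / m ≤ 2 * N * Θ + 2 / c * ((∑ i ∈ J, e i ^ 2) / m)
      ∧ (∑ i ∈ J, |θ i| * |e i|) / m ≤ N * √(Θ * ((∑ i ∈ J, e i ^ 2) / m)) := by
  have hNr : (J.card : ℝ) ≤ N := by exact_mod_cast hN
  constructor
  · rw [div_le_iff₀ hm]
    calc ∑ i ∈ J, (θ i + e i / √(s i)) ^ 2
        ≤ ∑ i ∈ J, (2 * (Θ * m) + 2 / c * e i ^ 2) := Finset.sum_le_sum fun i hi => by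
          have hsi := hs i hi
          have h1 : (e i / √(s i)) ^ 2 ≤ 1 / c * e i ^ 2 := by
            rw [div_pow, Real.sq_sqrt (hc.le.trans hsi), div_eq_mul_one_div, mul_comm]
            exact mul_le_mul_of_nonneg_right (one_div_le_one_div_of_le hc hsi) (sq_nonneg _)
          have h2 : 2 / c * e i ^ 2 = 2 * (1 / c * e i ^ 2) := by ring
          have h3 := hθ i hi
          have h4 := add_sq_le (a := θ i) (b := e i / √(s i))
          linarith
      _ = J.card * (2 * (Θ * m)) + 2 / c * ∑ i ∈ J, e i ^ 2 := by
          rw [Finset.sum_add_distrib, Finset.sum_const, nsmul_eq_mul, Finset.mul_sum]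
      _ ≤ N * (2 * (Θ * m)) + 2 / c * ∑ i ∈ J, e i ^ 2 := by gcongr
      _ = _ := by field_simp
  · rw [div_le_iff₀ hm]
    set ξ := (∑ i ∈ J, e i ^ 2) / m with hξ
    have hξ0 : 0 ≤ ξ := div_nonneg (Finset.sum_nonneg fun i _ => sq_nonneg _) hm.le
    calc ∑ i ∈ J, |θ i| * |e i| ≤ ∑ _i ∈ J, √(Θ * ξ) * m := Finset.sum_le_sum fun i hi => by
          have h1 : e i ^ 2 ≤ ξ * m := by
            rw [hξ, div_mul_cancel₀ _ hm.ne']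
            exact Finset.single_le_sum (f := fun i => e i ^ 2) (fun i _ => sq_nonneg _) hi
          rw [← abs_mul]
          refine abs_le_of_sq_le_sq ?_ (by positivity)
          rw [mul_pow, mul_pow, Real.sq_sqrt (by positivity)]
          calc θ i ^ 2 * e i ^ 2 ≤ Θ * m * (ξ * m) :=
                mul_le_mul (hθ i hi) h1 (sq_nonneg _) (by positivity)
            _ = _ := by ring
      _ = J.card * (√(Θ * ξ) * m) := by rw [Finset.sum_const, nsmul_eq_mul]
      _ ≤ N * (√(Θ * ξ) * m) := by gcongr
      _ = _ := by ring

/-- The estimated risk approaches the conditional risk uniformly in the regularization strength. -/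
theorem eventually_forall_abs_estimate_sub_risk_le {p : ℕ → ℕ} {J : ∀ n, Finset (Fin (p n))}
    {w w' s b e θ : ∀ n, Fin (p n) → ℝ} {u u' v' η : ℕ → ℝ} {v γ c Θ W U B E l₁ l₂ : ℝ} {N : ℕ}
    (hl₁ : 0 < l₁) (hl : l₁ < l₂) (hγ : 0 < γ) (hc : 0 < c) (hΘ : 0 ≤ Θ) (hW : 0 ≤ W) (hv : 0 ≤ v)
    (hp : ∀ᶠ n : ℕ in atTop, (p n : ℝ) ≤ 2 * γ * n) (hN : ∀ n, (J n).card ≤ N)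
    (hs : ∀ n i, 0 ≤ s n i) (hsJ : ∀ᶠ n in atTop, ∀ i ∈ J n, c ≤ s n i)
    (hw : ∀ᶠ n in atTop, ∀ i, |w n i| ≤ W) (hη : ∀ᶠ n in atTop, ∀ i, |w' n i - w n i| ≤ η n)
    (hη' : ∀ n, 0 ≤ η n)
    (hη0 : Tendsto η atTop (𝓝 0)) (hθ : ∀ n i, i ∉ J n → θ n i = b n i)
    (hθJ : ∀ᶠ n : ℕ in atTop, ∀ i ∈ J n, θ n i ^ 2 ≤ Θ * n)
    (hξ : Tendsto (fun n : ℕ => (∑ i ∈ J n, e n i ^ 2) / n) atTop (𝓝 0))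
    (hu : ∀ n, 0 ≤ u n) (huU : ∀ᶠ n in atTop, u n ≤ U)
    (hu' : Tendsto (fun n => u' n - u n) atTop (𝓝 0))
    (hv' : Tendsto (fun n => v' n - v) atTop (𝓝 0))
    (hB : ∀ᶠ n : ℕ in atTop, (∑ i, b n i ^ 2) / n ≤ B)
    (hE : ∀ᶠ n : ℕ in atTop, (∑ i, e n i ^ 2) / n ≤ E)
    (hT : ∀ j k : ℕ, Tendsto (fun n : ℕ => riskFluctuation (J n) (w n) (s n) (b n) (e n) (u n) v
      (l₁ + (l₂ - l₁) * (j / (k + 1))) / n) atTop (𝓝 0)) {ε : ℝ} (hε : 0 < ε) :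
    ∀ᶠ n : ℕ in atTop, ∀ lam ∈ Set.Icc l₁ l₂,
      |∑ i, w' n i * ((u' n + if i ∈ J n then (θ n i + e n i / √(s n i)) ^ 2 else 0)
          * biasFactor lam (s n i) ^ 2 + v' n * noiseFactor lam (s n i) ^ 2)
        - ∑ i, w n i
          * (-(biasFactor lam (s n i) * θ n i) + noiseFactor lam (s n i) * e n i) ^ 2| / n
        ≤ ε := by
  set κ := (1 + 1 / l₁) ^ 2 with hκ
  have hκ0 : 0 ≤ κ := sq_nonneg _
  set ξ : ℕ → ℝ := fun n => (∑ i ∈ J n, e n i ^ 2) / n with hξd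
  -- The deterministic error bound divided by `n`, apart from the fluctuation, as a continuous
  -- function of five vanishing quantities: weight error, error of `u`, error of `v`, aligned noise
  -- energy per sample, and `1 / n`. It is zero at the origin.
  set F : ℝ × ℝ × ℝ × ℝ × ℝ → ℝ := fun z =>
    z.1 * (2 * γ * (|z.2.1| + U + (|z.2.2.1| + v) * κ) + (2 * N * Θ + 2 / c * z.2.2.2.1))
      + W * (2 * γ * (|z.2.1| + κ * |z.2.2.1|))
      + W * (N * (U + v * κ) * z.2.2.2.2 + (2 / √c + 2 * (1 + 1 / l₁)) * (N * √(Θ * z.2.2.2.1))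
        + (1 / c + κ) * z.2.2.2.1) with hF
  have hFc : Continuous F := by rw [hF]; fun_prop
  have hlim : Tendsto (fun n : ℕ => F (η n, u' n - u n, v' n - v, ξ n, 1 / (n : ℝ))) atTop
      (𝓝 0) := by
    have h := (hFc.tendsto (0, 0, 0, 0, 0)).comp (hη0.prodMk_nhds (hu'.prodMk_nhds
      (hv'.prodMk_nhds (hξ.prodMk_nhds tendsto_one_div_atTop_nhds_zero_nat))))
    have h0 : F (0, 0, 0, 0, 0) = 0 := by simp [hF]
    rwa [h0] at h
  have hTu := eventually_forall_abs_le_of_grid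
    (T := fun n lam => riskFluctuation (J n) (w n) (s n) (b n) (e n) (u n) v lam / n)
    (K := W * (2 * (1 + 1 / l₁) ^ 2 / l₁) * (2 * B + 2 * E + 2 * γ * (U + v)))
    hl ?_ hT (half_pos hε)
  · filter_upwards [hlim.eventually (gt_mem_nhds (half_pos hε)), hTu, hp, hsJ, hw, hη, hθJ, huU,
      eventually_gt_atTop 0] with n h1 h2 hpn hsn hwn hηn hθn hun hn0 lam hlam
    have hn : (0 : ℝ) < n := by exact_mod_cast hn0
    have hl0 : 0 < lam := hl₁.trans_le hlam.1
    have hT' := h2 lam hlam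
    rw [abs_div, abs_of_pos hn] at hT'
    have hcmp := abs_estimate_sub_risk_le (J n) (w := w n) (w' := w' n) (s := s n) (b := b n)
      (e := e n) (θ := θ n) (x := fun i => (θ n i + e n i / √(s n i)) ^ 2)
      (y := fun i => u n + v * (1 + 1 / l₁) ^ 2 + (2 / √c + 2 * (1 + 1 / l₁)) * (|θ n i| * |e n i|)
        + (1 / c + (1 + 1 / l₁) ^ 2) * e n i ^ 2)
      (u := u n) (v := v) (u' := u' n) (v' := v' n) (κ := κ) (η := η n) (W := W) hl0 (hs n)
      (fun i => pow_le_pow_left₀ (noiseFactor_nonneg hl0 (hs n i))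
        (noiseFactor_le hl₁ hlam.1 (hs n i)) 2) hwn hηn (hθ n) (fun i => sq_nonneg _)
      (fun i hi => abs_aligned_error_le hl₁ hlam.1 hc (hsn i hi) (hu n) hv)
    obtain ⟨hx, hy⟩ := sum_aligned_le (J n) (hN n) (e := e n) hc hsn hΘ hn hθn
    have hNr : ((J n).card : ℝ) ≤ N := by exact_mod_cast hN n
    rw [div_le_iff₀ hn] at hx hy hT' ⊢
    have t1 : η n * (p n * (|u' n| + |v' n| * κ) + ∑ i ∈ J n, (θ n i + e n i / √(s n i)) ^ 2)
        ≤ η n * (2 * γ * (|u' n - u n| + U + (|v' n - v| + v) * κ) + (2 * N * Θ + 2 / c * ξ n))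
          * n := by
      have a1 : |u' n| ≤ |u' n - u n| + U := by
        have := abs_add_le (u' n - u n) (u n)
        rw [sub_add_cancel, abs_of_nonneg (hu n)] at this
        linarith
      have a2 : |v' n| ≤ |v' n - v| + v := by
        have := abs_add_le (v' n - v) v
        rwa [sub_add_cancel, abs_of_nonneg hv] at this
      have a3 : (p n : ℝ) * (|u' n| + |v' n| * κ)
          ≤ 2 * γ * n * (|u' n - u n| + U + (|v' n - v| + v) * κ) := by gcongr
      rw [mul_assoc]
      refine mul_le_mul_of_nonneg_left ?_ (hη' n)
      linarith
    have t2 : W * (p n * (|u' n - u n| + κ * |v' n - v|))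
        ≤ W * (2 * γ * (|u' n - u n| + κ * |v' n - v|)) * n := by
      rw [mul_assoc]
      refine mul_le_mul_of_nonneg_left ?_ hW
      calc (p n : ℝ) * (|u' n - u n| + κ * |v' n - v|)
          ≤ 2 * γ * n * (|u' n - u n| + κ * |v' n - v|) := by gcongr
        _ = _ := by ring
    have t3 : W * ∑ i ∈ J n, (u n + v * κ + (2 / √c + 2 * (1 + 1 / l₁)) * (|θ n i| * |e n i|)
          + (1 / c + κ) * e n i ^ 2)
        ≤ W * (N * (U + v * κ) * (1 / (n : ℝ)) + (2 / √c + 2 * (1 + 1 / l₁)) * (N * √(Θ * ξ n))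
          + (1 / c + κ) * ξ n) * n := by
      rw [mul_assoc]
      refine mul_le_mul_of_nonneg_left ?_ hW
      have b1 : (J n).card * (u n + v * κ) ≤ N * (U + v * κ) := by
        have := hu n
        gcongr
      have b2 : (2 / √c + 2 * (1 + 1 / l₁)) * ∑ i ∈ J n, |θ n i| * |e n i|
          ≤ (2 / √c + 2 * (1 + 1 / l₁)) * (N * √(Θ * ξ n) * n) := by gcongr
      have b3 : ∑ i ∈ J n, e n i ^ 2 = ξ n * n := (div_mul_cancel₀ _ hn.ne').symm
      have b4 : N * (U + v * κ) * (1 / (n : ℝ)) * n = N * (U + v * κ) := by field_simp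
      rw [Finset.sum_add_distrib, Finset.sum_add_distrib, ← Finset.mul_sum, ← Finset.mul_sum,
        Finset.sum_const, nsmul_eq_mul, b3]
      linarith
    have t4 : F (η n, u' n - u n, v' n - v, ξ n, 1 / (n : ℝ)) * n ≤ ε / 2 * n :=
      mul_le_mul_of_nonneg_right h1.le hn.le
    have t5 : F (η n, u' n - u n, v' n - v, ξ n, 1 / (n : ℝ)) * n
        = η n * (2 * γ * (|u' n - u n| + U + (|v' n - v| + v) * κ) + (2 * N * Θ + 2 / c * ξ n)) * n
          + W * (2 * γ * (|u' n - u n| + κ * |v' n - v|)) * n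
          + W * (N * (U + v * κ) * (1 / (n : ℝ)) + (2 / √c + 2 * (1 + 1 / l₁)) * (N * √(Θ * ξ n))
          + (1 / c + κ) * ξ n) * n := by
      simp only [hF]; ring
    refine hcmp.trans ?_
    linarith
  · filter_upwards [hp, hw, hB, hE, huU, eventually_gt_atTop 0] with
      n hpn hwn hBn hEn hun hn0 lam hlam μ hμ
    have hn : (0 : ℝ) < n := by exact_mod_cast hn0
    have h := abs_riskFluctuation_sub_le (J n) (b := b n) (e := e n) hl₁ hlam.1 hμ.1 (hs n) hwn
      (hu n) hv
    rw [← sub_div, abs_div, abs_of_pos hn, div_le_iff₀ hn]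
    rw [div_le_iff₀ hn] at hBn hEn
    refine h.trans ?_
    have hpu : (p n : ℝ) * (u n + v) ≤ 2 * γ * n * (U + v) := by
      have := hu n
      gcongr
    calc W * (2 * (1 + 1 / l₁) ^ 2 / l₁) * |lam - μ|
        * (2 * ∑ i, b n i ^ 2 + 2 * ∑ i, e n i ^ 2 + p n * (u n + v))
        ≤ W * (2 * (1 + 1 / l₁) ^ 2 / l₁) * |lam - μ|
        * (2 * (B * n) + 2 * (E * n) + 2 * γ * n * (U + v)) := by gcongr
      _ = _ := by ring

end RiskComparison

/-! ### Test weights and their estimates -/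

section Weights

theorem testWeight_eq {p : ℕ} (Jc : Finset ℕ) (d : ℕ → ℝ) (db : ℝ) (i : Fin p) :
    testWeight Jc d db i = if i ∈ idx p Jc then d i else db := by
  unfold testWeight; split_ifs <;> ring

theorem abs_testWeight_le {p : ℕ} {Jc : Finset ℕ} {d : ℕ → ℝ} {db W : ℝ} (hd : ∀ i, |d i| ≤ W)
    (hdb : |db| ≤ W) (i : Fin p) : |testWeight Jc d db i| ≤ W := by
  rw [testWeight_eq]
  split_ifs
  exacts [hd _, hdb]

theorem abs_testWeight_sub_le {p : ℕ} (Jc : Finset ℕ) (d d' : ℕ → ℝ) (db db' : ℝ) (i : Fin p) :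
    |testWeight Jc d' db' i - testWeight Jc d db i|
      ≤ |db' - db| + ∑ j ∈ Jc, |d' j - d j| := by
  have h0 : 0 ≤ ∑ j ∈ Jc, |d' j - d j| := Finset.sum_nonneg fun _ _ => abs_nonneg _
  rw [testWeight_eq, testWeight_eq]
  split_ifs with h
  · have hi : (i : ℕ) ∈ Jc := by simpa [idx] using h
    have := Finset.single_le_sum (f := fun j => |d' j - d j|) (fun _ _ => abs_nonneg _) hi
    have := abs_nonneg (db' - db)
    linarith
  · linarith

/-- From `x² - d = (x - √d) ((x - √d) + 2√d)`. The sequence `d` need not converge, so its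
boundedness is what controls the second factor. -/
theorem tendsto_abs_sq_sub {x d : ℕ → ℝ} {C : ℝ} (hd : ∀ n, 0 ≤ d n) (hdC : ∀ᶠ n in atTop, d n ≤ C)
    (h : Tendsto (fun n => |x n - √(d n)|) atTop (𝓝 0)) :
    Tendsto (fun n => |x n ^ 2 - d n|) atTop (𝓝 0) := by
  have hz := h.mul (h.add_const (2 * √C))
  rw [zero_mul] at hz
  refine squeeze_zero' (Eventually.of_forall fun n => abs_nonneg _) ?_ hz
  filter_upwards [hdC] with n hn
  have e : x n ^ 2 - d n = (x n - √(d n)) * ((x n - √(d n)) + 2 * √(d n)) := by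
    have := Real.sq_sqrt (hd n)
    linear_combination this
  rw [e, abs_mul]
  refine mul_le_mul_of_nonneg_left ((abs_add_le _ _).trans ?_) (abs_nonneg _)
  have := Real.sqrt_le_sqrt hn
  rw [abs_of_nonneg (by positivity : 0 ≤ 2 * √(d n))]
  linarith

variable {Ω : Type*} [MeasurableSpace Ω] {P : Measure Ω} {n n' p : ℕ} {Jc : Finset ℕ}

theorem Data.dSq_nonneg (M : Data Ω n n' p Jc) (P : Measure Ω) (i : ℕ) : 0 ≤ M.dSq P i := by
  unfold dSq
  split_ifs
  · exact integral_nonneg fun ω => gram_nonneg _ _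
  · exact le_rfl

theorem Data.dSq_le (M : Data Ω n n' p Jc) (P : Measure Ω) (i : ℕ) :
    M.dSq P i ≤ opNorm (M.expDtSq P) := by
  unfold dSq
  split_ifs
  · exact (le_abs_self _).trans (abs_diag_le_opNorm _ _)
  · exact opNorm_nonneg _

theorem Data.dBulkSq_eq (M : Data Ω n n' p Jc) (P : Measure Ω) :
    M.dBulkSq P = (∑ i ∈ (idx p Jc)ᶜ, M.dSq P i) / ((idx p Jc)ᶜ.card : ℝ) := by
  have h := Finset.card_add_card_compl (idx p Jc)
  rw [Fintype.card_fin] at h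
  have h' : ((idx p Jc).card : ℝ) + ((idx p Jc)ᶜ.card : ℝ) = p := by exact_mod_cast h
  rw [dBulkSq, ← h', add_sub_cancel_left]

theorem Data.dBulkSq_nonneg (M : Data Ω n n' p Jc) (P : Measure Ω) : 0 ≤ M.dBulkSq P := by
  rw [M.dBulkSq_eq]
  exact div_nonneg (Finset.sum_nonneg fun i _ => M.dSq_nonneg P i) (Nat.cast_nonneg _)

theorem Data.dBulkSq_le (M : Data Ω n n' p Jc) (P : Measure Ω) :
    M.dBulkSq P ≤ opNorm (M.expDtSq P) := by
  rw [M.dBulkSq_eq]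
  refine div_le_of_le_mul₀ (Nat.cast_nonneg _) (opNorm_nonneg _) ?_
  rw [mul_comm, ← nsmul_eq_mul]
  exact Finset.sum_le_card_nsmul _ _ _ fun i _ => M.dSq_le P i

end Weights

/-! ### Estimator and ridge error in coordinates, for a fixed sample size -/

section OneSample

variable {Ω : Type*} {n n' p : ℕ} {Jc : Finset ℕ}

/-- Brings the estimator to the shape of `IsModel.risk_eq`, so that the two are compared component
by component. -/
theorem Data.aROTI_eq (M : Data Ω n n' p Jc) {L : ℕ} [NeZero L] (Ja : Finset ℕ) (α : ℕ → ℝ)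
    (g : Fin L → ℝ) (dHat : Ω → ℕ → ℝ) (dBulkHat : Ω → ℝ) (lam : ℝ) (ω : Ω) :
    M.aROTI Ja α g dHat dBulkHat lam ω = 1 / n' *
      ∑ i : Fin p, testWeight Jc (fun i => dHat ω i ^ 2) (dBulkHat ω ^ 2) i
        * ((rSqHat ((p : ℝ) / n) g (Xnew Ja (M.D ω) (M.O ω)) (sqSingNew Ja (M.D ω))
              (ynew Ja (M.D ω) (M.X ω) (M.O ω) (M.y Ja α ω)) / ((p : ℝ) / n)
            + if i ∈ idx p Ja then n * alphaHat Ja (M.X ω) (M.O ω) (M.y Ja α ω) i ^ 2 else 0)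
            * biasFactor lam (((M.D ω)ᵀ * M.D ω) i i) ^ 2
          + sigmaSqHat ((p : ℝ) / n) g (Xnew Ja (M.D ω) (M.O ω)) (sqSingNew Ja (M.D ω))
              (ynew Ja (M.D ω) (M.X ω) (M.O ω) (M.y Ja α ω))
            * noiseFactor lam (((M.D ω)ᵀ * M.D ω) i i) ^ 2) := by
  unfold aROTI biasFormula varFormula
  simp only
  rw [div_mul_eq_mul_div, div_mul_eq_mul_div, ← add_div, one_div, inv_mul_eq_div, Finset.mul_sum,
    Finset.mul_sum, ← Finset.sum_add_distrib]
  congr 1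
  refine Finset.sum_congr rfl fun i _ => ?_
  rw [biasFactor_sq, noiseFactor_sq (gram_nonneg _ _)]
  ring

/-- The component regression returns `(s θ + √s e) / s`. It estimates the whole aligned coordinate,
including the contribution of `β'`, and this is also what enters the risk. -/
theorem Data.mul_alphaHat_sq {M : Data Ω n n' p Jc} {ω : Ω} (hD : IsSingularValueMatrix (M.D ω))
    {Ja : Finset ℕ} (α : ℕ → ℝ) (hn : 0 < n) (hs : ∀ i ∈ idx p Ja, 0 < ((M.D ω)ᵀ * M.D ω) i i)
    {i : Fin p} (hi : i ∈ idx p Ja) :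
    n * alphaHat Ja (M.X ω) (M.O ω) (M.y Ja α ω) i ^ 2
      = (((M.O ω : Matrix (Fin p) (Fin p) ℝ) *ᵥ M.β Ja α ω) i
          + M.noiseCoord ω i / √(((M.D ω)ᵀ * M.D ω) i i)) ^ 2 := by
  have hn' : (0 : ℝ) < n := by exact_mod_cast hn
  rw [alphaHat, dif_pos hi, pcr_apply (M.O ω) (M.X ω) _ _ _ _ (fun j hj => (hs j hj).ne')
    (Data.design_gram hD) (Data.design_response hD Ja α), div_pow, Real.sq_sqrt hn'.le,
    mul_div_cancel₀ _ hn'.ne']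
  congr 1
  have h1 := hs i hi
  have h2 := Real.mul_self_sqrt h1.le
  have h3 := (Real.sqrt_pos.2 h1).ne'
  set s := ((M.D ω)ᵀ * M.D ω) i i
  rw [add_div, mul_div_cancel_left₀ _ h1.ne']
  congr 1
  rw [div_eq_div_iff h1.ne' h3]
  linear_combination M.noiseCoord ω i * h2

/-- The bias is `s / (s + lam) - 1 = -lam / (s + lam)` times the signal coordinate; the noise is
passed on with factor `√s / (s + lam)`. -/
theorem Data.mulVec_ridge_sub {M : Data Ω n n' p Jc} {ω : Ω} (hD : IsSingularValueMatrix (M.D ω))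
    (Ja : Finset ℕ) (α : ℕ → ℝ) {lam : ℝ} (hl : 0 < lam) (i : Fin p) :
    ((M.O ω : Matrix (Fin p) (Fin p) ℝ) *ᵥ (ridge (M.X ω) (M.y Ja α ω) lam - M.β Ja α ω)) i
      = -(biasFactor lam (((M.D ω)ᵀ * M.D ω) i i)
          * ((M.O ω : Matrix (Fin p) (Fin p) ℝ) *ᵥ M.β Ja α ω) i)
        + noiseFactor lam (((M.D ω)ᵀ * M.D ω) i i) * M.noiseCoord ω i := by
  rw [Matrix.mulVec_sub, Pi.sub_apply, ridge_rotated (M.O ω) (M.X ω) _ _ _ (gram_nonneg (M.D ω))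
    (Data.design_gram hD) (Data.design_response hD Ja α) hl]
  have h : ((M.D ω)ᵀ * M.D ω) i i + lam ≠ 0 := by
    have := gram_nonneg (M.D ω) i
    positivity
  rw [biasFactor, noiseFactor]
  field_simp
  ring

theorem Data.sum_sq_signalCoord (M : Data Ω n n' p Jc) (ω : Ω) :
    ∑ i, M.signalCoord ω i ^ 2 = ∑ i, M.β' ω i ^ 2 :=
  Orth.sum_sq_mulVec _ _

end OneSample

/-! ### Almost sure inputs for the comparison of risks -/

section Asymptotics

variable {Ω : Type*} [MeasurableSpace Ω] {P : Measure Ω} [IsProbabilityMeasure P]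
  {p n' : ℕ → ℕ} {Jc : Finset ℕ} {σ γ : ℝ} {M : ∀ n, Data Ω n (n' n) (p n) Jc}

/-- The test weights `w` are deterministic, so they can be absorbed into the coefficient functions.
What remains are the signal, cross and noise averages with coefficients `f²`, `fk` and `k²`. -/
theorem ae_tendsto_riskFluctuation (hM : ∀ n, (M n).IsModel P σ) (hγ : 0 < γ)
    (hp : Tendsto (fun n => (p n : ℝ) / n) atTop (𝓝 γ)) {r : ℝ}
    (hβ : ∀ᵐ ω ∂P, ∀ᶠ n : ℕ in atTop, √(∑ j, (M n).β' ω j ^ 2) ≤ r * √(n : ℝ))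
    (J : ∀ n, Finset (Fin (p n))) {w : ∀ n, Fin (p n) → ℝ} {W : ℝ}
    (hw : ∀ᶠ n in atTop, ∀ i, |w n i| ≤ W) {lam : ℝ} (hl : 0 < lam) :
    ∀ᵐ ω ∂P, Tendsto (fun n : ℕ => riskFluctuation (J n) (w n)
      (fun i => (((M n).D ω)ᵀ * (M n).D ω) i i) ((M n).signalCoord ω) ((M n).noiseCoord ω)
      ((∑ j, (M n).signalCoord ω j ^ 2) / p n) (σ ^ 2) lam / n) atTop (𝓝 0) := by
  have hκ : (1 : ℝ) ≤ 1 + 1 / lam := le_add_of_nonneg_right (by positivity)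
  have key : ∀ ψ : ℝ → ℝ, Measurable ψ → (∀ t, 0 ≤ t → |ψ t| ≤ (1 + 1 / lam) ^ 2) →
      (∀ n i, Measurable fun t => (if i ∈ J n then 0 else w n i) * ψ t) ∧
      ∀ᶠ n in atTop, ∀ (i : Fin (p n)) (t : ℝ), 0 ≤ t →
        |(if i ∈ J n then 0 else w n i) * ψ t| ≤ W * (1 + 1 / lam) ^ 2 := by
    intro ψ hψ hb
    refine ⟨fun n i => hψ.const_mul _, ?_⟩
    filter_upwards [hw] with n hn i t ht
    rw [abs_mul]
    have hW := (abs_nonneg _).trans (hn i)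
    refine mul_le_mul ?_ (hb t ht) (abs_nonneg _) hW
    split_ifs
    · rwa [abs_zero]
    · exact hn i
  have mf : Measurable (biasFactor lam) := by unfold biasFactor; fun_prop
  have mk : Measurable (noiseFactor lam) := by unfold noiseFactor; fun_prop
  have bf : ∀ t, 0 ≤ t → |biasFactor lam t| ≤ 1 + 1 / lam := fun t ht => by
    rw [abs_of_nonneg (biasFactor_nonneg hl ht)]; exact (biasFactor_le_one hl ht).trans hκ
  have bk : ∀ t, 0 ≤ t → |noiseFactor lam t| ≤ 1 + 1 / lam := fun t ht => by
    rw [abs_of_nonneg (noiseFactor_nonneg hl ht)]; exact noiseFactor_le hl le_rfl ht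
  have prodb : ∀ {x y : ℝ}, |x| ≤ 1 + 1 / lam → |y| ≤ 1 + 1 / lam → |x * y| ≤ (1 + 1 / lam) ^ 2 :=
    fun hx hy => by
      rw [abs_mul, sq]; exact mul_le_mul hx hy (abs_nonneg _) (zero_le_one.trans hκ)
  obtain ⟨m1, k1⟩ := key _ (mf.mul mf) fun t ht => prodb (bf t ht) (bf t ht)
  obtain ⟨m2, k2⟩ := key _ (mf.mul mk) fun t ht => prodb (bf t ht) (bk t ht)
  obtain ⟨m3, k3⟩ := key _ (mk.mul mk) fun t ht => prodb (bk t ht) (bk t ht)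
  have hsing : ∀ᵐ ω ∂P, ∀ n, IsSingularValueMatrix ((M n).D ω) :=
    ae_all_iff.2 fun n => (hM n).sing_D
  filter_upwards [hsing, ae_tendsto_averages hM hγ hp hβ m1 k1,
    ae_tendsto_averages hM hγ hp hβ m2 k2, ae_tendsto_averages hM hγ hp hβ m3 k3]
    with ω hs h1 h2 h3
  have h := (h1.1.sub (h2.2.1.const_mul 2)).add h3.2.2
  simp only [mul_zero, add_zero, sub_zero] at h
  refine h.congr fun n => ?_
  rw [← mul_div_assoc, ← sub_div, ← add_div, riskFluctuation, Finset.mul_sum,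
    ← Finset.sum_sub_distrib, ← Finset.sum_add_distrib]
  congr 1
  refine Finset.sum_congr rfl fun i _ => ?_
  by_cases hi : (i : ℕ) < n
  · rw [if_pos hi]
    simp only [Pi.mul_apply]
    ring
  -- The fluctuation subtracts `σ²` at every coordinate, although the noise exists only for `i < n`;
  -- at the others the singular value, hence the noise factor, is zero.
  · have h0 : noiseFactor lam ((((M n).D ω)ᵀ * (M n).D ω) i i) = 0 := by
      rw [noiseFactor, (hs n).gram_eq_zero i hi, Real.sqrt_zero, zero_div]
    simp only [Pi.mul_apply, h0]
    ring

/-- The noise does not concentrate on finitely many components. -/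
theorem ae_tendsto_sum_noise_sq (hM : ∀ n, (M n).IsModel P σ) (hγ : 0 < γ)
    (hp : Tendsto (fun n => (p n : ℝ) / n) atTop (𝓝 γ)) (Ja : Finset ℕ) :
    ∀ᵐ ω ∂P, Tendsto (fun n : ℕ => (∑ i ∈ idx (p n) Ja, (M n).noiseCoord ω i ^ 2) / n)
      atTop (𝓝 0) := by
  filter_upwards [ae_tendsto_noise hM hγ hp (φ := fun n i _ => if i ∈ idx (p n) Ja then 1 else 0)
    (fun n i => measurable_const) (B := 1)
    (Eventually.of_forall fun n i t _ => by split_ifs <;> simp)] with ω h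
  have hz : Tendsto (fun n : ℕ => (Ja.card : ℝ) * σ ^ 2 / n) atTop (𝓝 0) :=
    tendsto_const_div_atTop_nhds_zero_nat _
  have hs := h.add hz
  rw [add_zero] at hs
  refine squeeze_zero (fun n => div_nonneg (Finset.sum_nonneg fun i _ => sq_nonneg _)
    (Nat.cast_nonneg n)) (fun n => ?_) hs
  rw [← add_div]
  refine div_le_div_of_nonneg_right ?_ (Nat.cast_nonneg n)
  simp only [ite_mul, one_mul, zero_mul, Finset.sum_ite_mem, Finset.univ_inter,
    Finset.sum_sub_distrib]
  have hc : ∑ i ∈ idx (p n) Ja, (if (i : ℕ) < n then σ ^ 2 else 0) ≤ Ja.card * σ ^ 2 := by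
    calc ∑ i ∈ idx (p n) Ja, (if (i : ℕ) < n then σ ^ 2 else 0)
        ≤ ∑ _i ∈ idx (p n) Ja, σ ^ 2 := Finset.sum_le_sum fun i _ => by
          split_ifs
          exacts [le_rfl, sq_nonneg σ]
      _ = (idx (p n) Ja).card * σ ^ 2 := by rw [Finset.sum_const, nsmul_eq_mul]
      _ ≤ _ := by
        have : ((idx (p n) Ja).card : ℝ) ≤ Ja.card := by exact_mod_cast card_idx_le _ _
        gcongr
  linarith

theorem ae_eventually_sum_noise_sq_le (hM : ∀ n, (M n).IsModel P σ) (hγ : 0 < γ)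
    (hp : Tendsto (fun n => (p n : ℝ) / n) atTop (𝓝 γ)) :
    ∀ᵐ ω ∂P, ∀ᶠ n : ℕ in atTop,
      (∑ i, (M n).noiseCoord ω i ^ 2) / n ≤ 2 * γ * σ ^ 2 + 1 := by
  filter_upwards [ae_tendsto_noise hM hγ hp (φ := fun n i _ => 1)
    (fun n i => measurable_const) (B := 1) (Eventually.of_forall fun n i t _ => by simp)] with ω h
  filter_upwards [h.eventually (gt_mem_nhds one_pos), eventually_dim_bounds hγ hp]
    with n hn ⟨h0, _, _, h1⟩
  have h0' : (0 : ℝ) < n := by exact_mod_cast h0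
  rw [div_lt_iff₀ h0'] at hn
  rw [div_le_iff₀ h0']
  simp only [one_mul, Finset.sum_sub_distrib] at hn
  have hc : ∑ i : Fin (p n), (if (i : ℕ) < n then σ ^ 2 else 0) ≤ 2 * γ * n * σ ^ 2 := by
    calc ∑ i : Fin (p n), (if (i : ℕ) < n then σ ^ 2 else 0)
        ≤ ∑ _i : Fin (p n), σ ^ 2 := Finset.sum_le_sum fun i _ => by
          split_ifs
          exacts [le_rfl, sq_nonneg σ]
      _ = p n * σ ^ 2 := by simp
      _ ≤ _ := by gcongr
  linarith

theorem exists_eventually_le_gram {D : ∀ n, Matrix (Fin n) (Fin (p n)) ℝ} (Ja : Finset ℕ)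
    (h : ∀ i ∈ Ja, ∃ c > 0, ∀ᶠ n in atTop, ∀ h : i < p n, c ≤ ((D n)ᵀ * D n) ⟨i, h⟩ ⟨i, h⟩) :
    ∃ c > 0, ∀ᶠ n in atTop, ∀ i ∈ idx (p n) Ja, c ≤ ((D n)ᵀ * D n) i i := by
  choose! c hc h using h
  -- A common positive lower bound for finitely many constants that also makes sense when `Ja` is
  -- empty.
  have hsum : ∀ i ∈ Ja, (1 + ∑ j ∈ Ja, (c j)⁻¹)⁻¹ ≤ c i := fun i hi => by
    have h1 := Finset.single_le_sum (f := fun j => (c j)⁻¹)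
      (fun j hj => (inv_pos.2 (hc j hj)).le) hi
    refine inv_le_of_inv_le₀ (hc i hi) ?_
    linarith
  refine ⟨(1 + ∑ j ∈ Ja, (c j)⁻¹)⁻¹, ?_, ?_⟩
  · have : 0 ≤ ∑ j ∈ Ja, (c j)⁻¹ := Finset.sum_nonneg fun j hj => (inv_pos.2 (hc j hj)).le
    positivity
  · filter_upwards [(Filter.eventually_all_finset Ja).2 h] with n hn i hi
    have hi' : (i : ℕ) ∈ Ja := by simpa [idx] using hi
    exact (hsum i hi').trans (hn i hi' i.2)

end Asymptotics

end ROTI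

/-! ### The main theorem -/

open ROTI in
theorem mainTheorem7 {Ω : Type*} [MeasurableSpace Ω] (P : Measure Ω) [IsProbabilityMeasure P]
    (p n' : ℕ → ℕ) (Ja Jc : Finset ℕ) (α : ℕ → ℝ) (σ γ : ℝ)
    (M : ∀ n, Data Ω n (n' n) (p n) Jc)
    (hM : ∀ n, (M n).IsModel P σ)
    -- proportional asymptotics
    (hγ : 0 < γ) (hp : Tendsto (fun n => (p n : ℝ) / n) atTop (𝓝 γ))
    -- the test sample size is at least of the order of the training sample size
    (hn' : ∃ C : ℝ, ∀ᶠ n : ℕ in atTop, (n : ℝ) ≤ C * n' n)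
    -- the singular values of the training design are asymptotically bounded
    (hD : ∃ C : ℝ, ∀ᵐ ω ∂P, ∀ᶠ n in atTop, opNorm ((M n).D ω) ≤ C)
    -- the unaligned signal has norm of order at most `√n`
    (hβ : ∃ r : ℝ, ∀ᵐ ω ∂P, ∀ᶠ n : ℕ in atTop, √(∑ j, (M n).β' ω j ^ 2) ≤ r * √(n : ℝ))
    -- the mean spectrum of the test design is asymptotically bounded
    (hDt : ∃ C : ℝ, ∀ᶠ n in atTop, opNorm ((M n).expDtSq P) ≤ C)
    -- the aligned singular values do not degenerate to zero
    (hJa : ∀ i ∈ Ja, ∀ᵐ ω ∂P, ∃ c > 0, ∀ᶠ n in atTop, ∀ h : i < p n,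
      c ≤ (((M n).D ω)ᵀ * (M n).D ω) ⟨i, h⟩ ⟨i, h⟩)
    -- the nonzero spectrum of the training design does not degenerate to a point
    (hspread : ∀ᵐ ω ∂P, ∃ c > 0, ∀ᶠ n in atTop, c ≤ spectralSpread ((M n).D ω))
    -- consistent estimators of the test spectrum
    (dHat : ℕ → Ω → ℕ → ℝ) (dBulkHat : ℕ → Ω → ℝ)
    (hdHat : ∀ i ∈ Ja ∪ Jc, ∀ᵐ ω ∂P,
      Tendsto (fun n => |dHat n ω i - √((M n).dSq P i)|) atTop (𝓝 0))
    (hdBulkHat : ∀ᵐ ω ∂P, Tendsto (fun n => |dBulkHat n ω - √((M n).dBulkSq P)|) atTop (𝓝 0))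
    -- the grid used to estimate the signal size and the noise level
    {L : ℕ} [NeZero L] (g : Fin L → ℝ) (hg : ∀ k, 0 < g k) (hg' : ∃ k, g k ≠ g 0)
    (l₁ l₂ : ℝ) (hl₁ : 0 < l₁) (hl₂ : l₁ < l₂) :
    ∀ᵐ ω ∂P, Tendsto
      (fun n => ⨆ lam ∈ Set.Icc l₁ l₂,
        ENNReal.ofReal |(M n).aROTI Ja α g (dHat n) (dBulkHat n) lam ω
          - (M n).risk P Ja α lam ω|)
      atTop (𝓝 0) := by
  obtain ⟨C, hn'⟩ := hn'
  obtain ⟨CD, hD⟩ := hD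
  obtain ⟨r, hβ⟩ := hβ
  obtain ⟨W, hW⟩ := hDt
  have hW0 : 0 ≤ W := by
    obtain ⟨n, hn⟩ := hW.exists
    exact (opNorm_nonneg _).trans hn
  have hw : ∀ᶠ n in atTop, ∀ i : Fin (p n),
      |testWeight Jc ((M n).dSq P) ((M n).dBulkSq P) i| ≤ W := by
    filter_upwards [hW] with n hn
    refine abs_testWeight_le (fun i => ?_) ?_
    · rw [abs_of_nonneg ((M n).dSq_nonneg P i)]; exact ((M n).dSq_le P i).trans hn
    · rw [abs_of_nonneg ((M n).dBulkSq_nonneg P)]; exact ((M n).dBulkSq_le P).trans hn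
  -- The points `(j, k)` form a countable family containing all grids, so a single null set suffices
  -- for the uniform limit.
  have hfluct : ∀ᵐ ω ∂P, ∀ j k : ℕ, Tendsto (fun n : ℕ => riskFluctuation (idx (p n) Ja)
      (testWeight Jc ((M n).dSq P) ((M n).dBulkSq P))
      (fun i => (((M n).D ω)ᵀ * (M n).D ω) i i) ((M n).signalCoord ω) ((M n).noiseCoord ω)
      ((∑ j, (M n).signalCoord ω j ^ 2) / p n) (σ ^ 2) (l₁ + (l₂ - l₁) * (j / (k + 1))) / n)
      atTop (𝓝 0) :=
    ae_all_iff.2 fun j => ae_all_iff.2 fun k =>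
      ae_tendsto_riskFluctuation hM hγ hp hβ (fun n => idx (p n) Ja) hw (by
        have : 0 < l₂ - l₁ := sub_pos.2 hl₂
        positivity)
  have hsing : ∀ᵐ ω ∂P, ∀ n, IsSingularValueMatrix ((M n).D ω) :=
    ae_all_iff.2 fun n => (hM n).sing_D
  have hrisk := ae_all_iff.2 fun n => (hM n).risk_eq Ja α
  have hJa' := (Filter.eventually_all_finset Ja).2 hJa
  have hdHat' := (Filter.eventually_all_finset Jc).2 fun i hi =>
    hdHat i (Finset.mem_union_right _ hi)
  filter_upwards [hfluct, hsing, hrisk, hJa', hdHat', hdBulkHat, hβ,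
    ae_tendsto_estimators hM hγ hp hD hβ hspread Ja α hg hg',
    ae_tendsto_sum_noise_sq hM hγ hp Ja, ae_eventually_sum_noise_sq_le hM hγ hp]
    with ω hT hs hR hJ hd hdb hr ⟨hest₁, hest₂⟩ hξ hE
  obtain ⟨c, hc, hsJ⟩ := exists_eventually_le_gram Ja hJ
  have hdim := eventually_dim_bounds hγ hp
  have hsignal : ∀ᶠ n : ℕ in atTop, ∑ i, (M n).signalCoord ω i ^ 2 ≤ r ^ 2 * n := by
    filter_upwards [hr] with n hn
    rw [(M n).sum_sq_signalCoord]
    have h := pow_le_pow_left₀ (Real.sqrt_nonneg _) hn 2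
    rwa [mul_pow, Real.sq_sqrt (Nat.cast_nonneg n),
      Real.sq_sqrt (Finset.sum_nonneg fun i _ => sq_nonneg _)] at h
  have hη0 : Tendsto (fun n => |dBulkHat n ω ^ 2 - (M n).dBulkSq P|
      + ∑ j ∈ Jc, |dHat n ω j ^ 2 - (M n).dSq P j|) atTop (𝓝 0) := by
    have h1 := tendsto_abs_sq_sub (fun n => (M n).dBulkSq_nonneg P)
      (hW.mono fun n hn => ((M n).dBulkSq_le P).trans hn) hdb
    have h2 := tendsto_finsetSum Jc fun j hj => tendsto_abs_sq_sub
      (fun n => (M n).dSq_nonneg P j) (hW.mono fun n hn => ((M n).dSq_le P j).trans hn) (hd j hj)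
    simpa using h1.add h2
  have hu' : Tendsto (fun n : ℕ => rSqHat ((p n : ℝ) / n) g (Xnew Ja ((M n).D ω) ((M n).O ω))
      (sqSingNew Ja ((M n).D ω)) (ynew Ja ((M n).D ω) ((M n).X ω) ((M n).O ω) ((M n).y Ja α ω))
      / ((p n : ℝ) / n) - (∑ j, (M n).signalCoord ω j ^ 2) / p n) atTop (𝓝 0) := by
    -- The estimator `r̂²` tracks `‖β'‖² / n`; dividing by `p / n` turns this into `u = ‖β'‖² / p`.
    have h := hest₁.div hp hγ.ne'
    rw [zero_div] at h
    refine h.congr' ?_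
    filter_upwards [hdim] with n ⟨h0, h1, _⟩
    have h0' : (n : ℝ) ≠ 0 := by exact_mod_cast h0.ne'
    have h1' : (p n : ℝ) ≠ 0 := by exact_mod_cast h1.ne'
    simp only [Pi.div_apply]
    rw [sub_div, mul_div_cancel_right₀ _ (div_ne_zero h1' h0')]
  refine tendsto_iSup_ofReal_of_eventually fun ε hε => ?_
  -- Here `Θ` comes from `(x + y)² ≤ 2x² + 2y²` applied to `θ i = b i + √n α i`, and `U` from `‖β'‖²
  -- ≤ r² n` and `p ≥ γ n / 2`. The factor `|C| + 1` pays for replacing `1 / n` by `1 / n'`.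
  have hmain := eventually_forall_abs_estimate_sub_risk_le
    (J := fun n => idx (p n) Ja) (w := fun n => testWeight Jc ((M n).dSq P) ((M n).dBulkSq P))
    (w' := fun n => testWeight Jc (fun i => dHat n ω i ^ 2) (dBulkHat n ω ^ 2))
    (s := fun n i => (((M n).D ω)ᵀ * (M n).D ω) i i) (b := fun n => (M n).signalCoord ω)
    (e := fun n => (M n).noiseCoord ω)
    (θ := fun n => ((M n).O ω : Matrix (Fin (p n)) (Fin (p n)) ℝ) *ᵥ (M n).β Ja α ω)
    (u := fun n => (∑ j, (M n).signalCoord ω j ^ 2) / p n) (v := σ ^ 2)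
    (Θ := 2 * r ^ 2 + 2 * ∑ j ∈ Ja, α j ^ 2) (U := 2 * r ^ 2 / γ) (B := r ^ 2)
    hl₁ hl₂ hγ hc (by positivity) hW0 (sq_nonneg σ) (hdim.mono fun n h => h.2.2.2)
    (fun n => card_idx_le (p n) Ja) (fun n => gram_nonneg _) hsJ hw
    (Eventually.of_forall fun n => abs_testWeight_sub_le Jc _ _ _ _) (fun n => by positivity) hη0
    (fun n i hi => (M n).mulVec_signal_of_notMem α ω hi) ?_ hξ (fun n => by positivity) ?_ hu' hest₂
    ?_ hE hT (ε := ε / (|C| + 1)) (by positivity)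
  · filter_upwards [hmain, hdim, hsJ, hn'] with n h ⟨hn0, _⟩ hsn hCn lam hlam
    have hn : (0 : ℝ) < n := by exact_mod_cast hn0
    have hn'0 : (0 : ℝ) < n' n := by
      by_contra h0
      have h0' : (n' n : ℝ) = 0 := le_antisymm (not_lt.1 h0) (Nat.cast_nonneg _)
      rw [h0', mul_zero] at hCn
      linarith
    have hl0 : 0 < lam := hl₁.trans_le hlam.1
    have hα : ∀ i, (if i ∈ idx (p n) Ja then
        (n : ℝ) * alphaHat Ja ((M n).X ω) ((M n).O ω) ((M n).y Ja α ω) i ^ 2 else 0)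
        = if i ∈ idx (p n) Ja then
          ((((M n).O ω : Matrix (Fin (p n)) (Fin (p n)) ℝ) *ᵥ (M n).β Ja α ω) i
          + (M n).noiseCoord ω i / √((((M n).D ω)ᵀ * (M n).D ω) i i)) ^ 2 else 0 := fun i => by
      split_ifs with hi
      · exact Data.mul_alphaHat_sq (hs n) α hn0 (fun j hj => hc.trans_le (hsn j hj)) hi
      · rfl
    rw [(M n).aROTI_eq, hR n lam, ← mul_sub]
    simp only [Data.mulVec_ridge_sub (hs n) Ja α hl0, hα]
    have hlam' := h lam hlam
    rw [div_le_iff₀ hn] at hlam'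
    rw [abs_mul, abs_of_pos (by positivity : 0 < 1 / (n' n : ℝ)), one_div_mul_eq_div,
      div_le_iff₀ hn'0]
    refine hlam'.trans ?_
    have hCn' : (n : ℝ) ≤ (|C| + 1) * n' n := by
      refine hCn.trans (mul_le_mul_of_nonneg_right ?_ hn'0.le)
      linarith [le_abs_self C]
    calc ε / (|C| + 1) * n ≤ ε / (|C| + 1) * ((|C| + 1) * n' n) := by gcongr
      _ = ε * n' n := by field_simp
  · filter_upwards [hsignal] with n hn i hi
    have hi' : (i : ℕ) ∈ Ja := by simpa [idx] using hi
    have h1 : (M n).signalCoord ω i ^ 2 ≤ r ^ 2 * n :=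
      (Finset.single_le_sum (f := fun i => (M n).signalCoord ω i ^ 2) (fun i _ => sq_nonneg _)
        (Finset.mem_univ i)).trans hn
    have h2 : α i ^ 2 ≤ ∑ j ∈ Ja, α j ^ 2 :=
      Finset.single_le_sum (f := fun j => α j ^ 2) (fun j _ => sq_nonneg _) hi'
    have h3 := mul_le_mul_of_nonneg_right h2 (Nat.cast_nonneg (α := ℝ) n)
    rw [(M n).mulVec_signal, if_pos hi]
    refine add_sq_le.trans ?_
    rw [mul_pow, Real.sq_sqrt (Nat.cast_nonneg n)]
    linarith
  · filter_upwards [hsignal, hdim] with n hn ⟨_, h1, h2, _⟩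
    have h1' : (0 : ℝ) < p n := by exact_mod_cast h1
    rw [div_le_iff₀ h1', div_mul_eq_mul_div, le_div_iff₀ hγ]
    have h4 := mul_le_mul_of_nonneg_right hn hγ.le
    have h5 := mul_le_mul_of_nonneg_left h2 (sq_nonneg r)
    linarith
  · filter_upwards [hsignal, hdim] with n hn ⟨h0, _⟩
    have h0' : (0 : ℝ) < n := by exact_mod_cast h0
    rwa [div_le_iff₀ h0']
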